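/- **Setting.** Let $d\in\{2,3\}$ and let $\Omega\subset\mathbb R^d$ be a bounded open set with Lipschitz boundary $\Gamma$. Let $T_h$ be a finite triangulation (for $d=3$, tetrahedrization) without hanging nodes of a polyhedral region containing $\Omega$, with mesh size $h$. Let $\mathcal T_h=\{K\in T_h: K\subset\overline\Omega\}$, let $D_h$ be the interior of $\bigcup_{K\in\mathcal T_h}K$, and $\Gamma_h=\partial D_h$. Let $\mathcal E_h$ be the set of faces (edges if $d=2$) of the elements of $\mathcal T_h$. A face is interior if two elements share it, and otherwise it is a boundary face. For a boundary face $e$, $K_e$ is its element, $\boldsymbol n_e$ the outward unit normal of $K_e$ on $e$, and $h_e^\perp$ the height of $K_e$ over $e$. Write $\boldsymbol n_h$ for the outward unit normal on $\partial K$, and $\boldsymbol n$ for that of $\Omega$ on $\Gamma$. Assume that $T_h$ is *admissible*, with a map $\boldsymbol\phi:\Gamma_h\to\Gamma$ that is measurable on boundary faces. This means that, for some positive constants $r,\rho,C,c$, some $n\in\mathbb N$ and some $\delta\in(0,1)$: 1. $r h\le \operatorname{diam}K$ for all $K\in T_h$. 2. Every $K\in T_h$ contains a ball of diameter at least $\rho\operatorname{diam}K$.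 3. $\boldsymbol\phi$ is a bijection, and for every $\boldsymbol x\in\Gamma_h$ the segment from $\boldsymbol x$ to $\boldsymbol\phi(\boldsymbol x)$ (the transfer path, of length $l(\boldsymbol x)$) does not meet $D_h$ and satisfies $l(\boldsymbol x)\le C h^{n+\delta}$. 4. $\|\psi\circ\boldsymbol\phi\|_{L^2(\Gamma_h)}\le c\,\|\psi\|_{L^2(\Gamma)}$ and $\|\psi\|_{L^2(\Gamma)}\le c\,\|\psi\circ\boldsymbol\phi\|_{L^2(\Gamma_h)}$ for all $\psi\in C_c^\infty(\mathbb R^d)$. Assume that $D_h$ is connected. Let the boundary faces be split into Dirichlet faces (at least one), with union $\Gamma_h^D$, and Neumann faces, with union $\Gamma_h^N$. Let $k\ge 0$ be an integer, $\tau>0$ a constant, and $a$ a real function with $0<\underline a\le a\le\overline a<\infty$ almost everywhere in $\Omega$. For every boundary face $e$ let $K_e^{ext}\subset\overline\Omega\setminus D_h$ be a measurable set containing $e$ (the extension patch). Let $H_e^\perp$ be the supremum of the lengths of the segments from $e$ to $\Gamma$ that point in the direction $\boldsymbol n_e$ and are contained in $K_e^{ext}$. Set $r_e=H_e^\perp/h_e^\perp$,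 $R=\max_e r_e$ over the boundary faces, and $$C_e^{ext}=\frac1{\sqrt{r_e}}\sup_{\zeta}\frac{\|\zeta\|_{L^2(K_e^{ext})}}{\|\zeta\|_{L^2(K_e)}},\qquad C_e^{inv}=h_e^\perp\sup_{\zeta}\frac{\|\partial_{\boldsymbol n_e}\zeta\|_{L^2(K_e)}}{\|\zeta\|_{L^2(K_e)}},$$ with suprema over $0\ne\zeta\in[\mathbb P_k]^d\cdot\boldsymbol n_e$, where $\mathbb P_k$ denotes the polynomials of total degree at most $k$. (Arithmetic is in $[0,\infty]$ with $0\cdot\infty=0/0=0$.) Assume that the mesh is *sufficiently fine* in the sense that, for every boundary face $e$, $$H_e^\perp\le\Big(4\tau\min\big\{1,\sup_{\boldsymbol x\in\Gamma_h}(1+a(\boldsymbol x)^{-1})\big\}\Big)^{-1},\qquad R<2^{-1/3}\big(C_e^{inv}C_e^{ext}\big)^{-2/3}.$$ Assume also that the transfer paths are normal on $\Gamma_h^D$: for every Dirichlet face $e$ and every $\boldsymbol x$ in its relative interior, $\boldsymbol\phi(\boldsymbol x)=\boldsymbol x+l(\boldsymbol x)\boldsymbol n_e$, and the segment from $\boldsymbol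 x$ to $\boldsymbol\phi(\boldsymbol x)$ lies in $K_e^{ext}$. **Data.** Let $g\in H^2(\Omega)$ and $\widetilde y\in H^1(\Omega)$, and let $\boldsymbol p_h,\boldsymbol r_h$ be any vector fields that belong to $[\mathbb P_k]^d$ on each $K\in\mathcal T_h$. On $\boldsymbol\phi(e)$, for a boundary face $e$, set $$G_h=\boldsymbol r_h\cdot\boldsymbol n\,\big(a^{-1}\boldsymbol p_h\cdot\boldsymbol n+\partial_{\boldsymbol n}g\big)+\tfrac12(g-\widetilde y)^2,$$ where the polynomials $\boldsymbol p_h|_{K_e},\boldsymbol r_h|_{K_e}$ are extrapolated from $K_e$ and the values of $g,\nabla g,\widetilde y$ on $\Gamma$ are traces. Assume that $(G_h\boldsymbol n)\circ\boldsymbol\phi$ is integrable on every Neumann face. **Claim.** There exists a unique triple $(\boldsymbol\sigma_h,\boldsymbol V_h,\widehat{\boldsymbol V}_h)\in\mathbb Z_h\times\boldsymbol W_h\times\boldsymbol M_h$ such that, for all $(\boldsymbol\psi,\boldsymbol w,\boldsymbol\mu)\in\mathbb Z_h\times\boldsymbol W_h\times\boldsymbol M_h$, $$\begin{aligned} (\boldsymbol\sigma_h,\boldsymbol\psi)_{D_h}-(\boldsymbol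 V_h,\operatorname{div}\boldsymbol\psi)_{D_h}+\langle\widehat{\boldsymbol V}_h,\boldsymbol\psi\boldsymbol n_h\rangle_{\mathcal E_h}&=0,\\ -(\boldsymbol\sigma_h,\nabla\boldsymbol w)_{D_h}+\langle\widehat{\boldsymbol\sigma}_h\boldsymbol n_h,\boldsymbol w\rangle_{\mathcal E_h}&=0,\\ \langle\widehat{\boldsymbol\sigma}_h\boldsymbol n_h,\boldsymbol\mu\rangle_{\mathcal E_h\setminus\Gamma_h}&=0,\\ \langle\widehat{\boldsymbol\sigma}_h\boldsymbol n_h,\boldsymbol\mu\rangle_{\Gamma_h^N}&=\langle(G_h\boldsymbol n)\circ\boldsymbol\phi,\boldsymbol\mu\rangle_{\Gamma_h^N},\\ \langle\widehat{\boldsymbol V}_h,\boldsymbol\mu\rangle_{\Gamma_h^D}&=\langle\boldsymbol g_h^D,\boldsymbol\mu\rangle_{\Gamma_h^D}. \end{aligned}$$ Here $\mathbb Z_h$ and $\boldsymbol W_h$ are the spaces of $d\times d$ matrix fields and of vector fields with components in $\mathbb P_k$ on each $K\in\mathcal T_h$, and $\boldsymbol M_h$ is the space of vector fields on the faces whose restriction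 to each $e\in\mathcal E_h$ has components in $\mathbb P_k(e)$. The pairing $(\cdot,\cdot)_{D_h}$ is $\sum_{K\in\mathcal T_h}\int_K$. The pairing $\langle\cdot,\cdot\rangle_{\mathcal E_h}$ is $\sum_{K\in\mathcal T_h}\int_{\partial K}$, and $\langle\cdot,\cdot\rangle_{\mathcal E_h\setminus\Gamma_h}$, $\langle\cdot,\cdot\rangle_{\Gamma_h^N}$, $\langle\cdot,\cdot\rangle_{\Gamma_h^D}$ are its restrictions to the interior, Neumann and Dirichlet faces. Divergence and gradient are taken row-wise. The numerical flux and the transferred Dirichlet datum are $$\widehat{\boldsymbol\sigma}_h\boldsymbol n_h=\boldsymbol\sigma_h\boldsymbol n_h+\tau(\boldsymbol V_h-\widehat{\boldsymbol V}_h),\qquad \boldsymbol g_h^D(\boldsymbol x)=\int_0^{l(\boldsymbol x)}\boldsymbol\sigma_h(\boldsymbol x+s\,\boldsymbol t(\boldsymbol x))\,\boldsymbol t(\boldsymbol x)\,ds,$$ where $\boldsymbol t(\boldsymbol x)=(\boldsymbol\phi(\boldsymbol x)-\boldsymbol x)/l(\boldsymbol x)$ and, for $\boldsymbol x\in e$,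 the polynomial $\boldsymbol\sigma_h|_{K_e}$ is extrapolated from $K_e$. -/

import Mathlib

open MeasureTheory Set Filter Topology
open scoped ENNReal ContDiff

namespace HDG

/-! ### Domains, normals, Sobolev functions and traces -/

/-- Euclidean space of dimension `d`. -/
abbrev E (d : ℕ) := EuclideanSpace ℝ (Fin d)

/-- The surface (`(d-1)`-dimensional Euclidean Hausdorff) measure on subsets of `E d`. -/
noncomputable abbrev surf (d : ℕ) : Measure (E d) := Measure.euclideanHausdorffMeasure (d - 1)

/-- `Ω` is a bounded open set with Lipschitz boundary: near every boundary point, after choosing a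
unit vector `v`, the set `Ω` is the part strictly above the graph of a Lipschitz function of the
variables orthogonal to `v`. -/
structure IsLipschitzDomain {d : ℕ} (Ω : Set (E d)) : Prop where
  isOpen : IsOpen Ω
  isBounded : Bornology.IsBounded Ω
  locally_epigraph : ∀ x ∈ frontier Ω, ∃ (v : E d) (f : E d → ℝ) (L : NNReal) (r : ℝ),
    ‖v‖ = 1 ∧ LipschitzWith L f ∧ (∀ (y : E d) (s : ℝ), f (y + s • v) = f y) ∧ 0 < r ∧
    ∀ y ∈ Metric.ball x r, y ∈ Ω ↔ f y < inner ℝ y v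

/-- `ν` is the outward unit normal of `Ω` at `y`: blowing up at `y`, the set `Ω` becomes the half
space `{z | ⟪z - y, ν⟫ < 0}`. -/
def IsOuterNormal {d : ℕ} (Ω : Set (E d)) (y ν : E d) : Prop :=
  ‖ν‖ = 1 ∧
  Tendsto (fun r : ℝ =>
      volume (symmDiff Ω {z : E d | inner ℝ (z - y) ν < 0} ∩ Metric.ball y r) /
        volume (Metric.ball y r))
    (𝓝[>] 0) (𝓝 0)

/-- `u ∈ H¹(Ω)` with weak gradient `Du`. -/
structure MemH1 {d : ℕ} (Ω : Set (E d)) (u : E d → ℝ) (Du : E d → E d) : Prop where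
  memLp : MemLp u 2 (volume.restrict Ω)
  memLp_grad : MemLp Du 2 (volume.restrict Ω)
  weak_grad : ∀ f : E d → ℝ, ContDiff ℝ ∞ f → HasCompactSupport f → tsupport f ⊆ Ω →
    ∀ v : E d, ∫ x in Ω, u x * fderiv ℝ f x v = - ∫ x in Ω, inner ℝ (Du x) v * f x

/-- `uΓ ∈ L²(∂Ω)` is the trace of `u ∈ H¹(Ω)` (with weak gradient `Du`): the limit of the boundary
values of smooth functions that converge to `u` in `H¹(Ω)`. -/
def IsTrace {d : ℕ} (Ω : Set (E d)) (u : E d → ℝ) (Du : E d → E d) (uΓ : E d → ℝ) : Prop :=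
  MemLp uΓ 2 ((surf d).restrict (frontier Ω)) ∧
  ∃ f : ℕ → E d → ℝ, (∀ m, ContDiff ℝ ∞ (f m)) ∧ (∀ m, HasCompactSupport (f m)) ∧
    Tendsto (fun m => eLpNorm (fun x => f m x - u x) 2 (volume.restrict Ω)) atTop (𝓝 0) ∧
    Tendsto (fun m => eLpNorm (fun x => gradient (f m) x - Du x) 2 (volume.restrict Ω))
      atTop (𝓝 0) ∧
    Tendsto (fun m => eLpNorm (fun x => f m x - uΓ x) 2 ((surf d).restrict (frontier Ω)))
      atTop (𝓝 0)

/-- `u ∈ H¹(Ω)` has trace `uΓ` on `∂Ω`. -/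
def HasH1Trace {d : ℕ} (Ω : Set (E d)) (u uΓ : E d → ℝ) : Prop :=
  ∃ Du : E d → E d, MemH1 Ω u Du ∧ IsTrace Ω u Du uΓ

/-- `u ∈ H²(Ω)` has trace `uΓ` on `∂Ω`, and its gradient has trace `DuΓ` on `∂Ω`. -/
def HasH2Trace {d : ℕ} (Ω : Set (E d)) (u uΓ : E d → ℝ) (DuΓ : E d → E d) : Prop :=
  ∃ Du : E d → E d, MemH1 Ω u Du ∧ IsTrace Ω u Du uΓ ∧
    ∀ i : Fin d, ∃ D2 : E d → E d,
      MemH1 Ω (fun x => Du x i) D2 ∧ IsTrace Ω (fun x => Du x i) D2 (fun x => DuΓ x i)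

/-! ### Background mesh, computational mesh, faces -/

section Mesh

variable {d : ℕ} {ι : Type}

/-- The background mesh `T` is a triangulation without hanging nodes: distinct cells have distinct
vertex sets and meet exactly in the (possibly empty) common sub-simplex spanned by their common
vertices. -/
def IsTriangulation (T : ι → Affine.Simplex ℝ (E d) d) : Prop :=
  ∀ K K' : ι, K ≠ K' →
    range (T K).points ≠ range (T K').points ∧
    (T K).closedInterior ∩ (T K').closedInterior =
      convexHull ℝ (range (T K).points ∩ range (T K').points)

/-- The cells of the computational mesh: the cells of `T` that are contained in `closure Ω`. -/
def Cells (T : ι → Affine.Simplex ℝ (E d) d) (Ω : Set (E d)) : Type :=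
  {K : ι // (T K).closedInterior ⊆ closure Ω}

noncomputable instance [Finite ι] (T : ι → Affine.Simplex ℝ (E d) d) (Ω : Set (E d)) :
    Fintype (Cells T Ω) :=
  have : Finite (Cells T Ω) := Subtype.finite
  Fintype.ofFinite _

/-- The closed simplex of a computational cell. -/
def cell (T : ι → Affine.Simplex ℝ (E d) d) (Ω : Set (E d)) (K : Cells T Ω) : Set (E d) :=
  (T K.1).closedInterior

/-- The computational domain `D_h`. -/
def compDomain (T : ι → Affine.Simplex ℝ (E d) d) (Ω : Set (E d)) : Set (E d) :=
  interior (⋃ K : Cells T Ω, cell T Ω K)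

/-- The mesh size `h` of the background mesh. -/
noncomputable def meshSize (T : ι → Affine.Simplex ℝ (E d) d) : ℝ :=
  ⨆ K : ι, Metric.diam (T K).closedInterior

variable [NeZero d]

/-- The closed face of `K` opposite to its `i`-th vertex. -/
def faceSet (T : ι → Affine.Simplex ℝ (E d) d) (Ω : Set (E d)) (K : Cells T Ω)
    (i : Fin (d + 1)) : Set (E d) :=
  ((T K.1).faceOpposite i).closedInterior

/-- The height `h_e^⊥` of `K` with respect to its face opposite to the `i`-th vertex. -/
noncomputable def faceHeight (T : ι → Affine.Simplex ℝ (E d) d) (Ω : Set (E d)) (K : Cells T Ω)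
    (i : Fin (d + 1)) : ℝ :=
  (T K.1).height i

/-- The outward unit normal of `K` on its face opposite to the `i`-th vertex: the normalized vector
from that vertex to the foot of the altitude. -/
noncomputable def normal (T : ι → Affine.Simplex ℝ (E d) d) (Ω : Set (E d)) (K : Cells T Ω)
    (i : Fin (d + 1)) : E d :=
  ((T K.1).height i)⁻¹ • ((T K.1).altitudeFoot i - (T K.1).points i)

/-- The faces of the computational mesh (the set `ℰ_h`), as subsets of space. A face shared by
two cells occurs once. -/
def Face (T : ι → Affine.Simplex ℝ (E d) d) (Ω : Set (E d)) : Type :=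
  {e : Set (E d) // ∃ (K : Cells T Ω) (i : Fin (d + 1)), e = faceSet T Ω K i}

/-- The face of `K` opposite to its `i`-th vertex, as an element of `ℰ_h`. -/
def faceOf (T : ι → Affine.Simplex ℝ (E d) d) (Ω : Set (E d)) (K : Cells T Ω)
    (i : Fin (d + 1)) : Face T Ω :=
  ⟨faceSet T Ω K i, K, i, rfl⟩

/-- A boundary face (an element of `ℰ_h^∂`) is one that is not shared by two cells of the
computational mesh. -/
def Face.IsBoundary {T : ι → Affine.Simplex ℝ (E d) d} {Ω : Set (E d)} (e : Face T Ω) : Prop :=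
  ¬ ∃ K K' : Cells T Ω, K ≠ K' ∧ (∃ i, e.1 = faceSet T Ω K i) ∧ ∃ i, e.1 = faceSet T Ω K' i

/-- The geometric conditions on an admissible triangulation of mesh size `h`, with transfer map `φ`
from the computational boundary `Γ_h = ∂D_h` to `Γ = ∂Ω`; `r, ρ, C, n, δ, c` are the constants in
these conditions. -/
structure IsAdmissible (T : ι → Affine.Simplex ℝ (E d) d) (Ω : Set (E d)) (φ : E d → E d)
    (r ρ C : ℝ) (n : ℕ) (δ c : ℝ) : Prop where
  /-- The background mesh covers `Ω`. -/
  covers : Ω ⊆ ⋃ K, (T K).closedInterior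
  /-- No hanging nodes. -/
  conforming : IsTriangulation T
  /-- Quasi uniformity. -/
  quasi_uniform : ∀ K, r * meshSize T ≤ Metric.diam (T K).closedInterior
  /-- Uniform shape regularity: every cell contains a ball of diameter at least `ρ` times the
  diameter of the cell. -/
  shape_regular : ∀ K, ∃ (x : E d) (s : ℝ), Metric.ball x s ⊆ (T K).closedInterior ∧
    ρ * Metric.diam (T K).closedInterior ≤ 2 * s
  /-- The transfer map is a bijection from `Γ_h` onto `Γ`. -/
  bijOn : BijOn φ (frontier (compDomain T Ω)) (frontier Ω)
  /-- It is measurable on every boundary face. -/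
  measurable : ∀ e : Face T Ω, e.IsBoundary → AEMeasurable φ ((surf d).restrict e.1)
  /-- Transfer paths do not meet the interior of the computational domain. -/
  path_disjoint : ∀ x ∈ frontier (compDomain T Ω),
    Disjoint (segment ℝ x (φ x)) (compDomain T Ω)
  /-- Local proximity condition of order `n`. -/
  proximity : ∀ x ∈ frontier (compDomain T Ω), dist x (φ x) ≤ C * meshSize T ^ ((n : ℝ) + δ)
  /-- Equivalence of the `L²` norms on `Γ_h` and `Γ` (the unit normal does not change the norm). -/
  norm_equiv : ∀ f : E d → ℝ, ContDiff ℝ ∞ f → HasCompactSupport f →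
    eLpNorm (fun x => f (φ x)) 2 ((surf d).restrict (frontier (compDomain T Ω))) ≤
        ENNReal.ofReal c * eLpNorm f 2 ((surf d).restrict (frontier Ω)) ∧
    eLpNorm f 2 ((surf d).restrict (frontier Ω)) ≤
        ENNReal.ofReal c *
          eLpNorm (fun x => f (φ x)) 2 ((surf d).restrict (frontier (compDomain T Ω)))

end Mesh

/-! ### Polynomials and discrete spaces -/

/-- Polynomials of total degree at most `k` in `d` variables. On a cell (which has non-empty
interior) they are the same as polynomial functions, and evaluating them outside the cell is the
extrapolation `E_h`. -/
noncomputable abbrev Pk (d k : ℕ) : Submodule ℝ (MvPolynomial (Fin d) ℝ) :=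
  MvPolynomial.restrictTotalDegree (Fin d) ℝ k

/-- The value of a polynomial at a point. -/
noncomputable def ev {d : ℕ} (p : MvPolynomial (Fin d) ℝ) (x : E d) : ℝ :=
  MvPolynomial.eval (fun j => x j) p

/-- The linear map sending a polynomial to its restriction to `s` (extended by zero). -/
noncomputable def restrictTo {d : ℕ} (s : Set (E d)) :
    MvPolynomial (Fin d) ℝ →ₗ[ℝ] (E d → ℝ) where
  toFun p := s.indicator (ev p)
  map_add' p q := by
    ext x
    by_cases hx : x ∈ s <;> simp [ev, hx]
  map_smul' c p := by
    ext x
    by_cases hx : x ∈ s <;> simp [ev, hx]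

/-- `ℙ_k(s)`: the restrictions to `s` of the polynomials of degree at most `k`, as functions that
are extended by zero outside `s`. -/
noncomputable def polyOn {d : ℕ} (k : ℕ) (s : Set (E d)) : Submodule ℝ (E d → ℝ) :=
  (Pk d k).map (restrictTo s)

/-- The value of a vector of polynomials. -/
noncomputable def evVec {d k : ℕ} (p : Fin d → Pk d k) (x : E d) : E d :=
  WithLp.toLp 2 fun i => ev (p i).1 x

/-- The matrix-vector product `σ(x) v` for a matrix `σ` of polynomials. -/
noncomputable def evMatVec {d k : ℕ} (σ : Fin d → Fin d → Pk d k) (x v : E d) : E d :=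
  WithLp.toLp 2 fun i => ∑ j, ev (σ i j).1 x * v j

/-- The row-wise divergence of a matrix of polynomials. -/
noncomputable def evDiv {d k : ℕ} (ψ : Fin d → Fin d → Pk d k) (x : E d) : E d :=
  WithLp.toLp 2 fun i => ∑ j, ev (MvPolynomial.pderiv j (ψ i j).1) x

section Spaces

variable {d : ℕ} {ι : Type} [NeZero d]

/-- The space `Z_h` of piecewise polynomial vector fields. -/
abbrev ZSpace (T : ι → Affine.Simplex ℝ (E d) d) (Ω : Set (E d)) (k : ℕ) : Type :=
  Cells T Ω → Fin d → Pk d k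

/-- The space `ℤ_h` of piecewise polynomial matrix fields. -/
abbrev ZZSpace (T : ι → Affine.Simplex ℝ (E d) d) (Ω : Set (E d)) (k : ℕ) : Type :=
  Cells T Ω → Fin d → Fin d → Pk d k

/-- The space `W_h` of piecewise polynomial vector fields. -/
abbrev WSpace (T : ι → Affine.Simplex ℝ (E d) d) (Ω : Set (E d)) (k : ℕ) : Type :=
  Cells T Ω → Fin d → Pk d k

/-- The space `M_h` of vector fields on the union of the faces that are polynomial on each face. -/
abbrev MSpace (T : ι → Affine.Simplex ℝ (E d) d) (Ω : Set (E d)) (k : ℕ) : Type :=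
  (e : Face T Ω) → Fin d → polyOn k e.1

/-- The value at `x` of the restriction of `μ ∈ M_h` to the face `e`. -/
noncomputable def evM {T : ι → Affine.Simplex ℝ (E d) d} {Ω : Set (E d)} {k : ℕ}
    (μ : MSpace T Ω k) (e : Face T Ω) (x : E d) : E d :=
  WithLp.toLp 2 fun i => (μ e i).1 x

end Spaces

/-! ### Extension patches and the proximity conditions -/

section Proximity

variable {d : ℕ} {ι : Type} [NeZero d]

/-- The extension patch `Kext e` of every boundary face `e` is a measurable part of the region
between `D_h` and `Γ` that has `e` as a face. -/
structure IsExtensionPatch (T : ι → Affine.Simplex ℝ (E d) d) (Ω : Set (E d))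
    (Kext : Face T Ω → Set (E d)) : Prop where
  measurable : ∀ e : Face T Ω, e.IsBoundary → MeasurableSet (Kext e)
  face_subset : ∀ e : Face T Ω, e.IsBoundary → e.1 ⊆ Kext e
  subset : ∀ e : Face T Ω, e.IsBoundary → Kext e ⊆ closure Ω \ compDomain T Ω

/-- The length `H_e^⊥` of the longest segment from `e` to `Γ` that is parallel to the normal of `e`
and contained in the extension patch of `e`. -/
noncomputable def Hperp (T : ι → Affine.Simplex ℝ (E d) d) (Ω : Set (E d))
    (Kext : Face T Ω → Set (E d)) (K : Cells T Ω) (i : Fin (d + 1)) : ℝ≥0∞ :=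
  ⨆ (x : E d) (s : ℝ) (_ : x ∈ faceSet T Ω K i ∧ 0 ≤ s ∧ x + s • normal T Ω K i ∈ frontier Ω ∧
      segment ℝ x (x + s • normal T Ω K i) ⊆ Kext (faceOf T Ω K i)), ENNReal.ofReal s

/-- `r_e = H_e^⊥ / h_e^⊥`. -/
noncomputable def ratio (T : ι → Affine.Simplex ℝ (E d) d) (Ω : Set (E d))
    (Kext : Face T Ω → Set (E d)) (K : Cells T Ω) (i : Fin (d + 1)) : ℝ≥0∞ :=
  Hperp T Ω Kext K i / ENNReal.ofReal (faceHeight T Ω K i)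

/-- The proximity parameter `R`, the maximum of `r_e` over the boundary faces. -/
noncomputable def proximityR (T : ι → Affine.Simplex ℝ (E d) d) (Ω : Set (E d))
    (Kext : Face T Ω → Set (E d)) : ℝ≥0∞ :=
  ⨆ (K : Cells T Ω) (i : Fin (d + 1)) (_ : (faceOf T Ω K i).IsBoundary), ratio T Ω Kext K i

/-- The polynomial `p · n` for a vector `p` of polynomials and a constant vector `n`. -/
noncomputable def dotPoly {d k : ℕ} (p : Fin d → Pk d k) (n : E d) : MvPolynomial (Fin d) ℝ :=
  ∑ i, MvPolynomial.C (n i) * (p i).1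

/-- The directional derivative `∂_n ζ` of a polynomial. -/
noncomputable def dirDeriv {d : ℕ} (n : E d) (ζ : MvPolynomial (Fin d) ℝ) :
    MvPolynomial (Fin d) ℝ :=
  ∑ j, MvPolynomial.C (n j) * MvPolynomial.pderiv j ζ

/-- `C_e^ext = r_e^(-1/2) sup ‖ζ‖_{K_e^ext} / ‖ζ‖_{K_e}`, the supremum over the nonzero `ζ` in
`[ℙ_k]^d · n_e`; the norms are `L²` norms. -/
noncomputable def Cext (T : ι → Affine.Simplex ℝ (E d) d) (Ω : Set (E d))
    (Kext : Face T Ω → Set (E d)) (k : ℕ) (K : Cells T Ω) (i : Fin (d + 1)) : ℝ≥0∞ :=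
  (⨆ (p : Fin d → Pk d k) (_ : dotPoly p (normal T Ω K i) ≠ 0),
    eLpNorm (ev (dotPoly p (normal T Ω K i))) 2 (volume.restrict (Kext (faceOf T Ω K i))) /
      eLpNorm (ev (dotPoly p (normal T Ω K i))) 2 (volume.restrict (cell T Ω K))) /
    ratio T Ω Kext K i ^ (1 / 2 : ℝ)

/-- `C_e^inv = h_e^⊥ sup ‖∂_n ζ‖_{K_e} / ‖ζ‖_{K_e}`, the supremum over the nonzero `ζ` in
`[ℙ_k]^d · n_e`; the norms are `L²` norms. -/
noncomputable def Cinv (T : ι → Affine.Simplex ℝ (E d) d) (Ω : Set (E d))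
    (k : ℕ) (K : Cells T Ω) (i : Fin (d + 1)) : ℝ≥0∞ :=
  ENNReal.ofReal (faceHeight T Ω K i) *
  ⨆ (p : Fin d → Pk d k) (_ : dotPoly p (normal T Ω K i) ≠ 0),
    eLpNorm (ev (dirDeriv (normal T Ω K i) (dotPoly p (normal T Ω K i)))) 2
        (volume.restrict (cell T Ω K)) /
      eLpNorm (ev (dotPoly p (normal T Ω K i))) 2 (volume.restrict (cell T Ω K))

/-- The bound on the distance between `Γ` and `Γ_h` in terms of the stabilization parameter `τ` and
the diffusivity `a`. -/
def HBound (T : ι → Affine.Simplex ℝ (E d) d) (Ω : Set (E d)) (Kext : Face T Ω → Set (E d))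
    (τ : ℝ) (a : E d → ℝ) : Prop :=
  ∀ (K : Cells T Ω) (i : Fin (d + 1)), (faceOf T Ω K i).IsBoundary →
    Hperp T Ω Kext K i ≤
      (4 * ENNReal.ofReal τ *
        min 1 (⨆ x ∈ frontier (compDomain T Ω), (1 + (ENNReal.ofReal (a x))⁻¹)))⁻¹

/-- The bound on the proximity parameter. The arithmetic is that of `[0, ∞]`; in particular the
right-hand side is `∞` if the product of the two constants is zero. -/
def RBound (T : ι → Affine.Simplex ℝ (E d) d) (Ω : Set (E d)) (Kext : Face T Ω → Set (E d))
    (k : ℕ) : Prop :=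
  ∀ (K : Cells T Ω) (i : Fin (d + 1)), (faceOf T Ω K i).IsBoundary →
    proximityR T Ω Kext <
      2 ^ (-(1 / 3) : ℝ) * (Cinv T Ω k K i * Cext T Ω Kext k K i) ^ (-(2 / 3) : ℝ)

/-- The transfer paths are normal on the Dirichlet part of `Γ_h`: for `x` in the relative interior
of a Dirichlet face, `φ x = x + l(x) n` with `l(x) = |φ x - x|`, and the path from `x` to `φ x` lies
in the extension patch of the face. -/
def NormalPaths (T : ι → Affine.Simplex ℝ (E d) d) (Ω : Set (E d)) (Kext : Face T Ω → Set (E d))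
    (φ : E d → E d) (ΓD : Set (Face T Ω)) : Prop :=
  ∀ (K : Cells T Ω) (i : Fin (d + 1)), faceOf T Ω K i ∈ ΓD →
    ∀ x ∈ ((T K.1).faceOpposite i).interior,
      φ x = x + dist x (φ x) • normal T Ω K i ∧ segment ℝ x (φ x) ⊆ Kext (faceOf T Ω K i)

end Proximity

/-! ### The scheme -/

section Scheme

variable {d : ℕ} {ι : Type} [NeZero d]

/-- The value at `y ∈ φ(e)`, for a face `e` of `K`, of
`G_h = (r_h · n) (a⁻¹ p_h · n + ∂_n g) + (g - y_t)² / 2`. The discrete fluxes are extrapolated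
from `K`; `n` is the outward normal of `Ω`, and `gΓ, DgΓ, ytΓ` are the boundary values of `g`, of
its gradient, and of `y_t`. -/
noncomputable def Gh {T : ι → Affine.Simplex ℝ (E d) d} {Ω : Set (E d)} {k : ℕ}
    (a gΓ ytΓ : E d → ℝ) (DgΓ n : E d → E d) (ph rh : ZSpace T Ω k) (K : Cells T Ω) (y : E d) : ℝ :=
  inner ℝ (evVec (rh K) y) (n y) *
      ((a y)⁻¹ * inner ℝ (evVec (ph K) y) (n y) + inner ℝ (DgΓ y) (n y)) +
    1 / 2 * (gΓ y - ytΓ y) ^ 2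

/-- The transferred Dirichlet datum `g_h^D(x) = ∫_0^{l(x)} E_h(σ_h)(x + s t(x)) t(x) ds` at a point
`x` of a boundary face of `K`, where `l(x) = |φ x - x|` and `t(x) = (φ x - x) / l(x)`. -/
noncomputable def ghD {T : ι → Affine.Simplex ℝ (E d) d} {Ω : Set (E d)} {k : ℕ}
    (φ : E d → E d) (σ : ZZSpace T Ω k) (K : Cells T Ω) (x : E d) : E d :=
  ∫ s in (0 : ℝ)..dist x (φ x),
    evMatVec (σ K) (x + s • ((dist x (φ x))⁻¹ • (φ x - x))) ((dist x (φ x))⁻¹ • (φ x - x))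

/-- The numerical flux `σ̂_h n = σ_h n + τ (V_h - V̂_h)` on the face of `K` opposite to its `i`-th
vertex. -/
noncomputable def flux {T : ι → Affine.Simplex ℝ (E d) d} {Ω : Set (E d)} {k : ℕ} (τ : ℝ)
    (σ : ZZSpace T Ω k) (V : WSpace T Ω k) (Vhat : MSpace T Ω k) (K : Cells T Ω) (i : Fin (d + 1))
    (x : E d) : E d :=
  evMatVec (σ K) x (normal T Ω K i) + τ • (evVec (V K) x - evM Vhat (faceOf T Ω K i) x)

open Classical in
/-- The sum, over the cells `K` of the computational mesh and over the faces of `K` that satisfy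
`P`, of the surface integrals of `f`. -/
noncomputable def faceSum (T : ι → Affine.Simplex ℝ (E d) d) (Ω : Set (E d)) [Finite ι]
    (P : Face T Ω → Prop) (f : Cells T Ω → Fin (d + 1) → E d → ℝ) : ℝ :=
  ∑ K : Cells T Ω, ∑ i : Fin (d + 1),
    if P (faceOf T Ω K i) then ∫ x in faceSet T Ω K i, f K i x ∂(surf d) else 0

/-- `(σ, V, Vhat)` solves the unfitted HDG scheme for the deformation field. The Dirichlet part
of `Γ_h` consists of the faces in `ΓD`, the Neumann part of the other boundary faces. -/
structure IsSolution (T : ι → Affine.Simplex ℝ (E d) d) (Ω : Set (E d)) [Finite ι] (k : ℕ)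
    (φ : E d → E d) (ΓD : Set (Face T Ω)) (τ : ℝ)
    (a gΓ ytΓ : E d → ℝ) (DgΓ n : E d → E d) (ph rh : ZSpace T Ω k)
    (σ : ZZSpace T Ω k) (V : WSpace T Ω k) (Vhat : MSpace T Ω k) : Prop where
  eq_a : ∀ ψ : ZZSpace T Ω k,
    (∑ K : Cells T Ω, ∫ x in cell T Ω K, ∑ i, ∑ j, ev (σ K i j).1 x * ev (ψ K i j).1 x) -
      (∑ K : Cells T Ω, ∫ x in cell T Ω K, inner ℝ (evVec (V K) x) (evDiv (ψ K) x)) +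
      faceSum T Ω (fun _ => True) (fun K i x =>
        inner ℝ (evM Vhat (faceOf T Ω K i) x) (evMatVec (ψ K) x (normal T Ω K i))) = 0
  eq_b : ∀ w : WSpace T Ω k,
    -(∑ K : Cells T Ω, ∫ x in cell T Ω K,
        ∑ i, ∑ j, ev (σ K i j).1 x * ev (MvPolynomial.pderiv j (w K i).1) x) +
      faceSum T Ω (fun _ => True) (fun K i x =>
        inner ℝ (flux τ σ V Vhat K i x) (evVec (w K) x)) = 0
  eq_c : ∀ μ : MSpace T Ω k,
    faceSum T Ω (fun e => ¬ e.IsBoundary) (fun K i x =>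
      inner ℝ (flux τ σ V Vhat K i x) (evM μ (faceOf T Ω K i) x)) = 0
  eq_neumann : ∀ μ : MSpace T Ω k,
    faceSum T Ω (fun e => e.IsBoundary ∧ e ∉ ΓD) (fun K i x =>
      inner ℝ (flux τ σ V Vhat K i x) (evM μ (faceOf T Ω K i) x)) =
    faceSum T Ω (fun e => e.IsBoundary ∧ e ∉ ΓD) (fun K i x =>
      inner ℝ (Gh a gΓ ytΓ DgΓ n ph rh K (φ x) • n (φ x)) (evM μ (faceOf T Ω K i) x))
  eq_dirichlet : ∀ μ : MSpace T Ω k,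
    faceSum T Ω (fun e => e ∈ ΓD) (fun K i x =>
      inner ℝ (evM Vhat (faceOf T Ω K i) x) (evM μ (faceOf T Ω K i) x)) =
    faceSum T Ω (fun e => e ∈ ΓD) (fun K i x =>
      inner ℝ (ghD φ σ K x) (evM μ (faceOf T Ω K i) x))

end Scheme

end HDG

open HDG

/-!
The scheme is a square linear system: the unknowns `(σ, V, Vhat)` and the test functions run over
the same finite-dimensional space, and by testing with one component at a time the five equations
are equivalent to one equation `schemeForm s t = F t` for all `t` (`isSolution_iff`). The
transferred Dirichlet datum depends linearly on `σ`, so it belongs to the left-hand side.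
Existence and uniqueness therefore follow once the homogeneous system has only the trivial
solution (`eq_zero_of_schemeForm_eq_zero`).

For this, a solution `(σ, V, Vhat)` of the homogeneous system is tested with `ψ = σ`, `w = V`, and
with `μ = -Vhat` on the faces off the Dirichlet part and `μ = τ Vhat - σ n` on it. After
integration by parts on every cell one is left with the square norms of `σ` on the cells and of
`V - Vhat` on the faces, and, on every Dirichlet face, with the term `⟨σ n, g⟩ - τ ‖g‖² / 2`,
where `g` is the transferred datum; the squares of `Vhat - g` and of `V` are dropped
(`faceIntegrand_energy_ge`). On a transfer path of length `l` in the direction `n`, the datum `g`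
differs from `l σ n` by a weighted integral of `∂_n (σ n)`, so that this term is nonnegative up to
an error of `2 l² / 7` times the integral of `|∂_n (σ n)|²`, if `4 τ l ≤ 1` (`transfer_pointwise`).
Integrated over the face, the error is an integral over a part of the extension patch, and the
definitions of the extension and inverse constants and the bound on the proximity parameter turn
it into at most `‖σ n‖² / 7` on the cell (`lintegral_ext_dirDeriv_le`, `dirichlet_face_estimate`).
A cell has at most four faces and `4 / 7 < 1`, hence `σ = 0`, and `V = Vhat` on all faces.

With `σ = 0`, testing the first equation with the gradient of `V` shows that `V` is constant on
every cell; `V = Vhat` makes the constants agree across common faces, and the Dirichlet condition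
makes `V` vanish on the Dirichlet faces. Since the computational domain is connected, the cells
are connected through common faces (`exists_shared_face`): a segment between generic points avoids
the intersections of cells of codimension at least two. Hence `V = 0` and `Vhat = 0`.

Integration by parts on a cell rests on the divergence theorem on a simplex with respect to the
Euclidean Hausdorff measure of its faces (`integral_simplex_fderiv`). It is proved for the fields
`f(x) (x - v)`, where `v` is a vertex, by slicing parallel to the opposite face; differences of
such fields are `f` times the edge vectors, which span the space.
-/

namespace HDG

/-! ### Orthogonal coordinates with respect to a hyperplane -/

section Coordinates

variable {d : ℕ}

/-- The hyperplane through the origin orthogonal to `n`. -/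
noncomputable abbrev perp (n : E d) : Submodule ℝ (E d) := (ℝ ∙ n)ᗮ

lemma finrank_perp {n : E d} (hn : ‖n‖ = 1) : Module.finrank ℝ (perp n) = d - 1 := by
  have h0 : n ≠ 0 := by rintro rfl; simp at hn
  have h1 := Submodule.finrank_add_finrank_orthogonal (ℝ ∙ n)
  rw [finrank_span_singleton h0, finrank_euclideanSpace_fin] at h1
  change Module.finrank ℝ ((ℝ ∙ n)ᗮ : Submodule ℝ (E d)) = d - 1
  omega

lemma mem_perp_iff {n z : E d} : z ∈ perp n ↔ inner ℝ z n = 0 := by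
  rw [Submodule.mem_orthogonal_singleton_iff_inner_left]

/-- Orthogonal coordinates `(u, z) ↦ p + u n + z` with respect to the hyperplane through `p` with
normal `n`. -/
noncomputable def orthCoord (p n : E d) (q : ℝ × perp n) : E d := p + q.1 • n + q.2

lemma measurePreserving_orthCoord (p : E d) {n : E d} (hn : ‖n‖ = 1) :
    MeasurePreserving (orthCoord p n) (volume.prod volume) volume ∧
      MeasurableEmbedding (orthCoord p n) := by
  have h1 := ((ℝ ∙ n).measurePreserving_measurableEquivProd p).symm
  have h2 := (LinearIsometryEquiv.toSpanUnitSingleton (𝕜 := ℝ) n hn).measurePreserving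
  have h3 := h2.prod (MeasurePreserving.id (volume : Measure (perp n)))
  have h4 := h1.comp h3
  have e : orthCoord p n = ((ℝ ∙ n).measurableEquivProd p).symm ∘
      Prod.map (LinearIsometryEquiv.toSpanUnitSingleton (𝕜 := ℝ) n hn) id := by
    ext1 q
    simp [orthCoord, LinearIsometryEquiv.toSpanUnitSingleton_apply]
    abel
  rw [e]
  constructor
  · have h5 := InnerProductSpace.euclideanHausdorffMeasure_eq_volume (V := E d)
    rwa [h5] at h4
  · refine (MeasurableEquiv.measurableEmbedding _).comp ?_
    exact (LinearIsometryEquiv.toSpanUnitSingleton (𝕜 := ℝ) n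
      hn).toHomeomorph.measurableEmbedding.prodMap MeasurableEmbedding.id

/-- The parametrization `z ↦ p + z` of the hyperplane through `p` with normal `n`. -/
def planePt (p : E d) {n : E d} (z : perp n) : E d := p + z

lemma isometry_planePt (p n : E d) : Isometry (planePt p (n := n)) :=
  Isometry.of_dist_eq fun x y => by simp [planePt, Subtype.dist_eq]

lemma continuous_planePt (p n : E d) : Continuous (planePt p (n := n)) :=
  (isometry_planePt p n).continuous

lemma measurableEmbedding_planePt (p n : E d) : MeasurableEmbedding (planePt p (n := n)) :=
  ((isometry_planePt p n).isClosedEmbedding).measurableEmbedding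

/-- On a measurable part of a hyperplane, the surface measure is the Lebesgue measure of the
hyperplane. -/
lemma surf_restrict_eq_map (p : E d) {n : E d} (hn : ‖n‖ = 1) {F : Set (E d)}
    (hF : MeasurableSet F) (hFp : ∀ x ∈ F, inner ℝ (x - p) n = 0) :
    (surf d).restrict F = (volume.restrict (planePt p (n := n) ⁻¹' F)).map (planePt p) := by
  have h1 := (isometry_planePt p n).map_euclideanHausdorffMeasure (d := d - 1)
  rw [show (Measure.euclideanHausdorffMeasure (d - 1) : Measure (perp n)) = volume by
    rw [← InnerProductSpace.euclideanHausdorffMeasure_eq_volume, finrank_perp hn]] at h1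
  rw [← (measurableEmbedding_planePt p n).restrict_map, h1, Measure.restrict_restrict hF]
  congr 1
  symm
  refine inter_eq_left.2 fun x hx => ⟨⟨x - p, mem_perp_iff.2 (hFp x hx)⟩, by simp [planePt]⟩

/-- The parametrization of a hyperplane as an affine map. -/
noncomputable def planeMap (p n : E d) : perp n →ᵃ[ℝ] E d :=
  (perp n).subtype.toAffineMap + AffineMap.const ℝ _ p

lemma planeMap_apply (p n : E d) (z : perp n) : planeMap p n z = planePt p z := by
  simp [planeMap, planePt, add_comm]

lemma planeMap_injective (p n : E d) : Function.Injective (planeMap p n) := fun x y h => by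
  simpa [planeMap_apply, planePt] using h

end Coordinates

/-! ### Geometry of a simplex -/

lemma convex_simplex {V : Type*} [NormedAddCommGroup V] [NormedSpace ℝ V] {m : ℕ}
    (t : Affine.Simplex ℝ V m) : Convex ℝ t.closedInterior := by
  rw [← Affine.Simplex.convexHull_eq_closedInterior]; exact convex_convexHull _ _

/-- A simplex of full dimension is the closure of its interior. -/
lemma closure_interior_simplex {V : Type*} [NormedAddCommGroup V] [NormedSpace ℝ V]
    [FiniteDimensional ℝ V] {m : ℕ} (t : Affine.Simplex ℝ V m) (hm : Module.finrank ℝ V = m) :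
    (interior t.closedInterior).Nonempty ∧
      closure (interior t.closedInterior) = t.closedInterior := by
  have h : (interior t.closedInterior).Nonempty := by
    rw [← Affine.Simplex.convexHull_eq_closedInterior,
      interior_convexHull_nonempty_iff_affineSpan_eq_top]
    exact t.span_eq_top hm
  exact ⟨h, by rw [(convex_simplex t).closure_interior_eq_closure_of_nonempty_interior h,
    t.isClosed_closedInterior.closure_eq]⟩

lemma continuousOn_eq_zero_of_ae {X : Type*} [TopologicalSpace X] [MeasurableSpace X]
    [OpensMeasurableSpace X]
    {μ : Measure X} [μ.IsOpenPosMeasure] {S : Set X} (hS : S ⊆ closure (interior S))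
    {f : X → ℝ} (hf : ContinuousOn f S)
    (h : ∀ᵐ x ∂(μ.restrict S), f x = 0) : ∀ x ∈ S, f x = 0 := by
  have h1 : EqOn f (fun _ => 0) (interior S) := by
    refine Measure.eqOn_open_of_ae_eq (μ := μ) ?_ isOpen_interior (hf.mono interior_subset)
      continuousOn_const
    exact ae_restrict_of_ae_restrict_of_subset interior_subset h
  have h2 := h1.of_subset_closure (t := S) hf continuousOn_const interior_subset hS
  exact fun x hx => h2 hx

section Simplex

variable {d : ℕ} [NeZero d]

/-- The outward unit normal of a simplex on its face opposite to the `i`-th vertex. -/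
noncomputable def outNormal (s : Affine.Simplex ℝ (E d) d) (i : Fin (d + 1)) : E d :=
  (s.height i)⁻¹ • (s.altitudeFoot i - s.points i)

variable (s : Affine.Simplex ℝ (E d) d)

lemma norm_outNormal (i : Fin (d + 1)) : ‖outNormal s i‖ = 1 := by
  have h := s.height_pos i
  rw [outNormal, norm_smul, norm_inv, Real.norm_of_nonneg h.le, ← dist_eq_norm, dist_comm]
  exact inv_mul_cancel₀ h.ne'

lemma height_smul_outNormal (i : Fin (d + 1)) :
    s.points i + s.height i • outNormal s i = s.altitudeFoot i := by
  rw [outNormal, smul_smul, mul_inv_cancel₀ (s.height_pos i).ne', one_smul]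
  abel

/-- Two points of the hyperplane spanned by a face differ by a vector orthogonal to the normal. -/
lemma inner_sub_altitudeFoot {i : Fin (d + 1)} {x : E d}
    (hx : x ∈ affineSpan ℝ (range (s.faceOpposite i).points)) :
    inner ℝ (x - s.altitudeFoot i) (outNormal s i) = 0 := by
  have h0 : ∀ y ∈ range (s.faceOpposite i).points,
      y ∈ AffineSubspace.mk' (s.altitudeFoot i) (perp (outNormal s i)) := by
    rw [Affine.Simplex.range_faceOpposite_points]
    rintro _ ⟨j, hj, rfl⟩
    rw [AffineSubspace.mem_mk', mem_perp_iff]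
    have hij : i ≠ j := fun h => hj (by simp [h])
    have := s.inner_vsub_altitudeFoot_vsub_altitudeFoot_eq_zero hij
    simp only [vsub_eq_sub] at this ⊢
    rw [outNormal, inner_smul_right, ← neg_sub (s.points i), inner_neg_right, this]
    simp
  have h1 := (affineSpan_le.2 h0) hx
  rwa [AffineSubspace.mem_mk', mem_perp_iff] at h1

lemma inner_sub_vertex {i : Fin (d + 1)} {x : E d}
    (hx : x ∈ affineSpan ℝ (range (s.faceOpposite i).points)) :
    inner ℝ (x - s.points i) (outNormal s i) = s.height i := by
  have h := inner_sub_altitudeFoot s hx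
  rw [← height_smul_outNormal, ← sub_sub, inner_sub_left, real_inner_smul_left,
    real_inner_self_eq_norm_sq, norm_outNormal] at h
  linarith

lemma vertex_mem_span_face {i j : Fin (d + 1)} (h : j ≠ i) :
    s.points j ∈ affineSpan ℝ (range (s.faceOpposite i).points) := by
  refine subset_affineSpan ℝ _ ?_
  rw [Affine.Simplex.range_faceOpposite_points]
  exact ⟨j, h, rfl⟩

lemma inner_edge_outNormal {a b : Fin (d + 1)} (hab : a ≠ b) (i : Fin (d + 1)) :
    inner ℝ (outNormal s i) (s.points a - s.points b) =
      if i = b then s.height b else if i = a then - s.height a else 0 := by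
  rw [real_inner_comm]
  split_ifs with h1 h2
  · subst h1; exact inner_sub_vertex s (vertex_mem_span_face s hab)
  · subst h2
    rw [← inner_sub_vertex s (vertex_mem_span_face s hab.symm), ← inner_neg_left, neg_sub]
  · have ha := inner_sub_altitudeFoot s (vertex_mem_span_face s (Ne.symm h2))
    have hb := inner_sub_altitudeFoot s (vertex_mem_span_face s (Ne.symm h1))
    rw [← sub_sub_sub_cancel_right _ _ (s.altitudeFoot i), inner_sub_left, ha, hb, sub_zero]

lemma face_inner_sub_foot {i : Fin (d + 1)} {x : E d} (hx : x ∈ (s.faceOpposite i).closedInterior) :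
    inner ℝ (x - s.altitudeFoot i) (outNormal s i) = 0 :=
  inner_sub_altitudeFoot s ((s.faceOpposite i).closedInterior_subset_affineSpan hx)

/-- The face opposite to the `i`-th vertex, in coordinates of its hyperplane. -/
def facePar (i : Fin (d + 1)) : Set (perp (outNormal s i)) :=
  planePt (s.altitudeFoot i) ⁻¹' (s.faceOpposite i).closedInterior

lemma surf_face_eq_map (i : Fin (d + 1)) :
    (surf d).restrict (s.faceOpposite i).closedInterior =
      (volume.restrict (facePar s i)).map (planePt (s.altitudeFoot i)) :=
  surf_restrict_eq_map _ (norm_outNormal s i)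
    ((s.faceOpposite i).isClosed_closedInterior.measurableSet) fun _ hx => face_inner_sub_foot s hx

/-- The face opposite to the `i`-th vertex as a simplex in its hyperplane. -/
noncomputable def faceSimplex (i : Fin (d + 1)) :
    Affine.Simplex ℝ (perp (outNormal s i)) (d - 1) where
  points j := ⟨(s.faceOpposite i).points j - s.altitudeFoot i, mem_perp_iff.2
    (inner_sub_altitudeFoot s (mem_affineSpan ℝ (mem_range_self j)))⟩
  independent := by
    have h := (s.faceOpposite i).independent
    refine AffineIndependent.of_comp (planeMap (s.altitudeFoot i) (outNormal s i)) ?_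
    have e : planeMap (s.altitudeFoot i) (outNormal s i) ∘ (fun j => (⟨_, mem_perp_iff.2
        (inner_sub_altitudeFoot s (mem_affineSpan ℝ (mem_range_self j)))⟩ :
          perp (outNormal s i))) = (s.faceOpposite i).points := by
      ext1 j
      simp [planeMap]
    rw [e]
    exact h

lemma faceSimplex_map (i : Fin (d + 1)) :
    (faceSimplex s i).map (planeMap (s.altitudeFoot i) (outNormal s i)) (planeMap_injective _ _) =
      s.faceOpposite i := by
  refine Affine.Simplex.ext fun j => ?_
  simp [faceSimplex, planeMap]

lemma facePar_eq (i : Fin (d + 1)) : facePar s i = (faceSimplex s i).closedInterior := by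
  have h := (faceSimplex s i).closedInterior_map
    (planeMap_injective (s.altitudeFoot i) (outNormal s i))
  rw [faceSimplex_map] at h
  ext z
  simp only [facePar, mem_preimage, h, ← planeMap_apply]
  exact (planeMap_injective _ _).mem_set_image

lemma isCompact_facePar (i : Fin (d + 1)) : IsCompact (facePar s i) :=
  facePar_eq s i ▸ (faceSimplex s i).isCompact_closedInterior

/-- The relative boundary of a face is negligible. -/
lemma ae_mem_face_interior (hd : 2 ≤ d) (i : Fin (d + 1)) :
    ∀ᵐ x ∂((surf d).restrict (s.faceOpposite i).closedInterior),
      x ∈ (s.faceOpposite i).interior := by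
  have : NeZero (d - 1) := ⟨by omega⟩
  set t := faceSimplex s i
  have hmap := (faceSimplex s i).interior_map
    (planeMap_injective (s.altitudeFoot i) (outNormal s i))
  rw [faceSimplex_map] at hmap
  rw [surf_face_eq_map, (measurableEmbedding_planePt _ _).ae_map_iff, facePar_eq,
    ae_restrict_iff' t.isClosed_closedInterior.measurableSet, ae_iff]
  refine measure_mono_null (t := t.closedInterior \ t.interior) ?_ ?_
  · intro z hz
    simp only [mem_ofPred_eq, Classical.not_imp] at hz
    refine ⟨hz.1, fun h => hz.2 ?_⟩
    rw [hmap, ← planeMap_apply]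
    exact mem_image_of_mem _ h
  · rw [Affine.Simplex.closedInterior_sdiff_interior]
    refine measure_iUnion_null fun j => measure_mono_null
      ((t.faceOpposite j).closedInterior_subset_affineSpan) (Measure.addHaar_affineSubspace _ _ ?_)
    intro h
    have := t.points_notMem_affineSpan_faceOpposite j
    rw [h] at this
    exact this (AffineSubspace.mem_top _ _ _)

lemma surf_face_lt_top (i : Fin (d + 1)) : surf d (s.faceOpposite i).closedInterior < ⊤ := by
  have h : (surf d).restrict (s.faceOpposite i).closedInterior univ < ⊤ := by
    rw [surf_face_eq_map, (measurableEmbedding_planePt _ _).map_apply, preimage_univ]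
    simpa using (isCompact_facePar s i).measure_lt_top
  simpa using h

lemma integral_face_eq {G : Type*} [NormedAddCommGroup G] [NormedSpace ℝ G] (i : Fin (d + 1))
    (f : E d → G) :
    ∫ x in (s.faceOpposite i).closedInterior, f x ∂(surf d) =
      ∫ z in facePar s i, f (planePt (s.altitudeFoot i) z) := by
  rw [surf_face_eq_map, (measurableEmbedding_planePt _ _).integral_map]

/-- A continuous function on a face that vanishes almost everywhere vanishes. -/
lemma eq_zero_on_face {i : Fin (d + 1)} {f : E d → ℝ}
    (hf : ContinuousOn f (s.faceOpposite i).closedInterior)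
    (h : ∀ᵐ x ∂((surf d).restrict (s.faceOpposite i).closedInterior), f x = 0) :
    ∀ x ∈ (s.faceOpposite i).closedInterior, f x = 0 := by
  rw [surf_face_eq_map, (measurableEmbedding_planePt _ _).ae_map_iff] at h
  have h1 := continuousOn_eq_zero_of_ae (S := facePar s i) (f := f ∘ planePt (s.altitudeFoot i)) ?_
    (hf.comp (continuous_planePt _ _).continuousOn fun z hz => hz) h
  · intro x hx
    have := h1 ⟨x - s.altitudeFoot i, mem_perp_iff.2 (face_inner_sub_foot s hx)⟩
      (by simpa [facePar, planePt] using hx)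
    simpa [planePt] using this
  · rw [facePar_eq, (closure_interior_simplex _ (finrank_perp (norm_outNormal s i))).2]

end Simplex

/-! ### The divergence theorem on a simplex -/

section Divergence

variable {d : ℕ} [NeZero d] (s : Affine.Simplex ℝ (E d) d)

lemma mem_simplex_iff_face (i : Fin (d + 1)) (x : E d) :
    x ∈ s.closedInterior ↔ ∃ y ∈ (s.faceOpposite i).closedInterior, ∃ t ∈ Icc (0 : ℝ) 1,
      x = s.points i + t • (y - s.points i) := by
  have h1 : range s.points = insert (s.points i) (range (s.faceOpposite i).points) := by
    rw [Affine.Simplex.range_faceOpposite_points, ← image_insert_eq, ← image_univ]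
    congr 1
    ext j
    simp [em]
  rw [← Affine.Simplex.convexHull_eq_closedInterior, h1, convexHull_insert (range_nonempty _),
    Affine.Simplex.convexHull_eq_closedInterior]
  simp only [convexJoin_singleton_left, mem_iUnion, segment_eq_image', mem_image, exists_prop]
  refine exists_congr fun y => and_congr_right fun _ => exists_congr fun t => and_congr_right
    fun _ => eq_comm

lemma orthCoord_mem_simplex_iff (i : Fin (d + 1)) {u : ℝ} (hu : 0 < u)
    (z : perp (outNormal s i)) :
    orthCoord (s.points i) (outNormal s i) (u, z) ∈ s.closedInterior ↔
      u ≤ s.height i ∧ (s.height i / u) • z ∈ facePar s i := by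
  have hh := s.height_pos i
  have hz : inner ℝ (z : E d) (outNormal s i) = 0 := mem_perp_iff.1 z.2
  have hn : inner ℝ (outNormal s i) (outNormal s i) = 1 := by
    rw [real_inner_self_eq_norm_sq, norm_outNormal]; norm_num
  rw [mem_simplex_iff_face s i]
  simp only [facePar, mem_preimage, planePt, orthCoord, ← height_smul_outNormal, Submodule.coe_smul]
  constructor
  · rintro ⟨y, hy, t, ht, he⟩
    have h1 : u • outNormal s i + (z : E d) = t • (y - s.points i) := by
      rw [add_assoc] at he
      exact add_left_cancel he
    have h2 : u = t * s.height i := by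
      have := congrArg (fun x => inner ℝ x (outNormal s i)) h1
      simp only [inner_add_left, real_inner_smul_left, hn, hz] at this
      rw [inner_sub_vertex s ((s.faceOpposite i).closedInterior_subset_affineSpan hy)] at this
      linarith
    have ht0 : 0 < t := by by_contra h; nlinarith
    refine ⟨by nlinarith [ht.2], ?_⟩
    convert hy using 1
    have h3 : s.height i / u = t⁻¹ := by rw [h2]; field_simp
    have h4 : y - s.points i = t⁻¹ • (u • outNormal s i + (z : E d)) := by
      rw [h1, smul_smul, inv_mul_cancel₀ ht0.ne', one_smul]
    rw [eq_add_of_sub_eq h4, h3, smul_add, smul_smul, h2]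
    rw [show t⁻¹ * (t * s.height i) = s.height i by field_simp]
    abel
  · rintro ⟨h1, h2⟩
    refine ⟨_, h2, u / s.height i, ⟨by positivity, (div_le_one hh).2 h1⟩, ?_⟩
    rw [add_sub_right_comm, add_sub_cancel_left, smul_add, smul_smul, smul_smul]
    rw [show u / s.height i * s.height i = u by field_simp,
      show u / s.height i * (s.height i / u) = 1 by field_simp, one_smul, add_assoc]

lemma orthCoord_notMem_simplex (i : Fin (d + 1)) {u : ℝ} (hu : u < 0)
    (z : perp (outNormal s i)) :
    orthCoord (s.points i) (outNormal s i) (u, z) ∉ s.closedInterior := by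
  have hz : inner ℝ (z : E d) (outNormal s i) = 0 := mem_perp_iff.1 z.2
  have hn : inner ℝ (outNormal s i) (outNormal s i) = 1 := by
    rw [real_inner_self_eq_norm_sq, norm_outNormal]; norm_num
  rw [mem_simplex_iff_face s i]
  rintro ⟨y, hy, t, ht, he⟩
  have h1 : u • outNormal s i + (z : E d) = t • (y - s.points i) := by
    rw [orthCoord, add_assoc] at he
    exact add_left_cancel he
  have := congrArg (fun x => inner ℝ x (outNormal s i)) h1
  simp only [inner_add_left, real_inner_smul_left, hn, hz] at this
  rw [inner_sub_vertex s ((s.faceOpposite i).closedInterior_subset_affineSpan hy)] at this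
  nlinarith [mul_nonneg ht.1 (s.height_pos i).le]

/-- Integration over a simplex by slices parallel to a face: the slice at distance `u` from the
opposite vertex is the face scaled by `u / h`. -/
lemma integral_simplex_eq_slices (i : Fin (d + 1)) {g : E d → ℝ} (hg : Continuous g) :
    ∫ x in s.closedInterior, g x = ∫ u in (0 : ℝ)..s.height i, ∫ z in facePar s i,
      (u / s.height i) ^ (d - 1) *
        g (s.points i + (u / s.height i) • (s.height i • outNormal s i + (z : E d))) := by
  have hh := s.height_pos i
  set h := s.height i
  set n := outNormal s i
  set v := s.points i
  have hK := s.isClosed_closedInterior.measurableSet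
  obtain ⟨hmp, hme⟩ := measurePreserving_orthCoord v (norm_outNormal s i)
  have hint : Integrable (s.closedInterior.indicator g) volume :=
    (hg.continuousOn.integrableOn_compact s.isCompact_closedInterior).integrable_indicator hK
  have hint2 : Integrable (fun q => s.closedInterior.indicator g (orthCoord v n q))
      ((volume : Measure ℝ).prod (volume : Measure (perp n))) :=
    (hmp.integrable_comp_emb hme).2 hint
  rw [← integral_indicator hK, ← hmp.integral_comp hme, integral_prod _ hint2,
    intervalIntegral.integral_of_le hh.le, ← integral_indicator measurableSet_Ioc]
  refine integral_congr_ae ?_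
  have h0 : ∀ᵐ u : ℝ ∂volume, u ≠ 0 := by
    rw [ae_iff]; simp
  filter_upwards [h0] with u hu0
  rcases lt_or_gt_of_ne hu0 with hu | hu
  · rw [indicator_of_notMem (fun h => by linarith [h.1])]
    simp [n, v, indicator_of_notMem (orthCoord_notMem_simplex s i hu _)]
  by_cases hu1 : u ≤ h
  · rw [indicator_of_mem (show u ∈ Ioc 0 h from ⟨hu, hu1⟩)]
    set f : perp n → ℝ := (facePar s i).indicator
      (fun z => g (v + (u / h) • (h • n + (z : E d)))) with hf
    have e : ∀ z : perp n, s.closedInterior.indicator g (orthCoord v n (u, z)) =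
        f ((h / u) • z) := by
      intro z
      have := orthCoord_mem_simplex_iff s i hu z
      simp only [hf, indicator]
      by_cases hz : (h / u) • z ∈ facePar s i
      · rw [if_pos (this.2 ⟨hu1, hz⟩), if_pos hz]
        congr 1
        simp only [orthCoord, smul_add, smul_smul, Submodule.coe_smul, add_assoc]
        rw [show u / h * h = u by field_simp, show u / h * (h / u) = 1 by field_simp, one_smul]
      · rw [if_neg (fun h => hz (this.1 h).2), if_neg hz]
    simp only [e]
    rw [Measure.integral_comp_smul, finrank_perp (norm_outNormal s i),
      abs_of_nonneg (by positivity), smul_eq_mul, hf, integral_indicator ((isCompact_facePar s i).measurableSet),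
      ← integral_const_mul, ← inv_pow, inv_div]
  · rw [indicator_of_notMem (fun h => hu1 h.2)]
    have : ∀ z, orthCoord v n (u, z) ∉ s.closedInterior := fun z hz =>
      hu1 ((orthCoord_mem_simplex_iff s i hu z).1 hz).1
    simp [indicator_of_notMem (this _)]

/-- The divergence theorem for the field `f(x) (x - v)`, where `v` is a vertex: the field is
tangential on all the faces through `v`. -/
lemma integral_simplex_radial (i : Fin (d + 1)) {f : E d → ℝ} (hf : ContDiff ℝ 1 f) :
    ∫ x in s.closedInterior, (d * f x + fderiv ℝ f x (x - s.points i)) =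
      s.height i * ∫ x in (s.faceOpposite i).closedInterior, f x ∂(surf d) := by
  have hh := s.height_pos i
  have hfd := hf.continuous_fderiv one_ne_zero
  have hfc := hf.continuous
  rw [integral_simplex_eq_slices s i (by fun_prop), integral_face_eq,
    intervalIntegral.integral_of_le hh.le, ← integral_const_mul, integral_integral_swap]
  · refine integral_congr_ae (Eventually.of_forall fun z => ?_)
    simp only
    rw [← intervalIntegral.integral_of_le hh.le]
    set h := s.height i
    set v := s.points i
    have hder : ∀ u : ℝ, HasDerivAt (fun u : ℝ => h * (u / h) ^ d *
        f (v + (u / h) • (h • outNormal s i + (z : E d))))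
        ((u / h) ^ (d - 1) * (d * f (v + (u / h) • (h • outNormal s i + (z : E d))) +
          fderiv ℝ f (v + (u / h) • (h • outNormal s i + (z : E d)))
            (v + (u / h) • (h • outNormal s i + (z : E d)) - v))) u := by
      intro u
      have h1 : HasDerivAt (fun u : ℝ => u / h) (1 / h) u := (hasDerivAt_id u).div_const h
      have h2 : HasDerivAt (fun u : ℝ => v + (u / h) • (h • outNormal s i + (z : E d)))
          ((1 / h) • (h • outNormal s i + (z : E d))) u := (h1.smul_const _).const_add v
      have h3 := ((hf.differentiable one_ne_zero).differentiableAt.hasFDerivAt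
        (x := v + (u / h) • (h • outNormal s i + (z : E d)))).comp_hasDerivAt u h2
      have h4 := ((h1.pow d).const_mul h).mul h3
      refine h4.congr_deriv ?_
      obtain ⟨m, rfl⟩ : ∃ m, d = m + 1 := ⟨d - 1, by have := NeZero.pos d; omega⟩
      simp only [add_sub_cancel_left, map_smul, smul_eq_mul, Function.comp, pow_succ, Pi.pow_apply]
      simp only [Nat.add_sub_cancel]
      field_simp
    rw [intervalIntegral.integral_eq_sub_of_hasDerivAt (fun u _ => hder u)]
    · have hd0 : d ≠ 0 := NeZero.ne d
      simp only [div_self hh.ne', one_pow, zero_div, zero_pow hd0, one_smul, mul_one, mul_zero,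
        zero_mul, sub_zero, planePt, ← height_smul_outNormal]
      simp only [h, v, add_assoc]
    · refine Continuous.intervalIntegrable ?_ _ _
      fun_prop
  · rw [Measure.prod_restrict]
    refine IntegrableOn.mono_set ?_ (prod_mono_left Ioc_subset_Icc_self)
    refine ContinuousOn.integrableOn_compact (isCompact_Icc.prod (isCompact_facePar s i)) ?_
    refine Continuous.continuousOn ?_
    unfold Function.uncurry
    fun_prop

/-- The divergence theorem in the direction of an edge: the difference of the identities of
`integral_simplex_radial` for the two end points. -/
lemma integral_simplex_edge {a b : Fin (d + 1)} {f : E d → ℝ} (hf : ContDiff ℝ 1 f) :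
    ∫ x in s.closedInterior, fderiv ℝ f x (s.points a - s.points b) =
      s.height b * ∫ x in (s.faceOpposite b).closedInterior, f x ∂(surf d) -
      s.height a * ∫ x in (s.faceOpposite a).closedInterior, f x ∂(surf d) := by
  have hfd := hf.continuous_fderiv one_ne_zero
  have hfc := hf.continuous
  rw [← integral_simplex_radial s a hf, ← integral_simplex_radial s b hf, ← integral_sub]
  · congr 1
    ext x
    rw [add_sub_add_left_eq_sub, ← map_sub]
    congr 1
    abel
  · exact Continuous.continuousOn (by fun_prop) |>.integrableOn_compact s.isCompact_closedInterior
  · exact Continuous.continuousOn (by fun_prop) |>.integrableOn_compact s.isCompact_closedInterior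

/-- The divergence theorem on a simplex. -/
lemma integral_simplex_fderiv {f : E d → ℝ} (hf : ContDiff ℝ 1 f) (w : E d) :
    ∫ x in s.closedInterior, fderiv ℝ f x w =
      ∑ i, inner ℝ (outNormal s i) w *
        ∫ x in (s.faceOpposite i).closedInterior, f x ∂(surf d) := by
  have hfd := hf.continuous_fderiv one_ne_zero
  have hint : ∀ w : E d, IntegrableOn (fun x => fderiv ℝ f x w) s.closedInterior := fun w =>
    Continuous.continuousOn (by fun_prop) |>.integrableOn_compact s.isCompact_closedInterior
  -- both sides are linear in `w`, and the edge vectors span the space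
  have hspan : vectorSpan ℝ (range s.points) = ⊤ := by
    rw [← direction_affineSpan, s.span_eq_top (by simp), AffineSubspace.direction_top]
  have hw : w ∈ vectorSpan ℝ (range s.points) := hspan ▸ Submodule.mem_top
  rw [vectorSpan_def] at hw
  induction hw using Submodule.span_induction with
  | mem x hx =>
    obtain ⟨_, ⟨a, rfl⟩, _, ⟨b, rfl⟩, rfl⟩ := hx
    by_cases hab : a = b
    · subst hab; simp
    simp only [vsub_eq_sub]
    rw [integral_simplex_edge s hf]
    simp only [inner_edge_outNormal s hab, ite_mul, zero_mul]
    rw [Finset.sum_ite, Finset.sum_ite, Finset.sum_const_zero, add_zero]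
    have h1 : Finset.univ.filter (fun i => i = b) = {b} := by ext; simp
    have h2 : (Finset.univ.filter (fun i => ¬ i = b)).filter (fun i => i = a) = {a} := by
      ext j; simp only [Finset.mem_filter, Finset.mem_univ, true_and, Finset.mem_singleton]
      exact ⟨fun h => h.2, fun h => ⟨fun h' => hab (h ▸ h'), h⟩⟩
    rw [h1, h2]
    simp
    ring
  | zero => simp
  | add x y _ _ hx hy =>
    simp only [map_add, inner_add_right, add_mul, Finset.sum_add_distrib, ← hx, ← hy]
    exact integral_add (hint x) (hint y)
  | smul c x _ hx =>
    simp only [map_smul, smul_eq_mul, real_inner_smul_right, mul_assoc, ← Finset.mul_sum, ← hx]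
    exact integral_const_mul _ _

end Divergence

/-! ### Combinatorics and topology of the mesh -/

section MeshGeometry

variable {d : ℕ} {ι : Type}

lemma mem_convexHull_common {T : ι → Affine.Simplex ℝ (E d) d} {Ω : Set (E d)}
    (hT : IsTriangulation T) {K K' : Cells T Ω} (hK : K ≠ K') {x : E d} (hx : x ∈ cell T Ω K)
    (hx' : x ∈ cell T Ω K') :
    x ∈ convexHull ℝ (range (T K.1).points ∩ range (T K'.1).points) := by
  rw [← (hT K.1 K'.1 fun h => hK (Subtype.ext h)).2]
  exact ⟨hx, hx'⟩

/-- Distinct cells do not have all their vertices in common. -/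
lemma exists_vertex_notMem {T : ι → Affine.Simplex ℝ (E d) d} {Ω : Set (E d)}
    (hT : IsTriangulation T) {K K' : Cells T Ω} (hK : K ≠ K') :
    ∃ i, (T K.1).points i ∉ range (T K'.1).points := by
  by_contra! h
  refine (hT K.1 K'.1 fun h => hK (Subtype.ext h)).1 ?_
  refine Set.eq_of_subset_of_ncard_le (range_subset_iff.2 h) ?_ (finite_range _)
  rw [← image_univ, ← image_univ, ncard_image_of_injective _ (T K.1).independent.injective,
    ncard_image_of_injective _ (T K'.1).independent.injective]

lemma cell_subset_closure_compDomain {T : ι → Affine.Simplex ℝ (E d) d} {Ω : Set (E d)}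
    (K : Cells T Ω) : interior (cell T Ω K) ⊆ compDomain T Ω ∧
      cell T Ω K ⊆ closure (compDomain T Ω) := by
  have h1 : interior (cell T Ω K) ⊆ compDomain T Ω := interior_mono (subset_iUnion _ K)
  refine ⟨h1, ?_⟩
  rw [cell, ← (closure_interior_simplex (T K.1) (by simp)).2]
  exact closure_mono h1

lemma isClosed_biUnion_cell [Finite ι] {T : ι → Affine.Simplex ℝ (E d) d} {Ω : Set (E d)}
    (A : Set (Cells T Ω)) : IsClosed (⋃ K ∈ A, cell T Ω K) :=
  (toFinite A).isClosed_biUnion fun K _ => (T K.1).isClosed_closedInterior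

/-- A point and all but two of the vertices of a simplex lie in a proper affine subspace. -/
lemma affineSpan_insert_ne_top (hd : 2 ≤ d) (s : Affine.Simplex ℝ (E d) d) {i j : Fin (d + 1)}
    (hij : i ≠ j) (y : E d) : affineSpan ℝ (insert y (s.points '' {i, j}ᶜ)) ≠ ⊤ := by
  intro h
  have h1 := finrank_vectorSpan_insert_le_set ℝ (s.points '' {i, j}ᶜ) y
  have h2 : Module.finrank ℝ (vectorSpan ℝ (s.points '' {i, j}ᶜ)) ≤ d - 2 := by
    have hc : (({i, j}ᶜ : Finset (Fin (d + 1)))).card = d - 2 + 1 := by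
      rw [Finset.card_compl, Finset.card_pair hij]; simp; omega
    have := finrank_vectorSpan_image_finset_le ℝ s.points ({i, j}ᶜ : Finset (Fin (d + 1))) hc
    rwa [Finset.coe_image, Finset.coe_compl, Finset.coe_pair] at this
  rw [← direction_affineSpan, h, AffineSubspace.direction_top, finrank_top,
    finrank_euclideanSpace_fin] at h1
  omega

variable [NeZero d]

/-- Cells which have all but one of their vertices in common share a face. -/
lemma faceSet_eq_of_common_vertices {T : ι → Affine.Simplex ℝ (E d) d} {Ω : Set (E d)}
    {K K' : Cells T Ω} {i : Fin (d + 1)}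
    (h : ∀ j, j ≠ i → (T K.1).points j ∈ range (T K'.1).points) :
    ∃ i', faceSet T Ω K i = faceSet T Ω K' i' := by
  have hinj := (T K.1).independent.injective
  have hinj' := (T K'.1).independent.injective
  set A := (T K.1).points '' {i}ᶜ with hA
  have hsub : A ⊆ range (T K'.1).points := by
    rintro _ ⟨j, hj, rfl⟩; exact h j hj
  have hcA : A.ncard = d := by
    rw [hA, ncard_image_of_injective _ hinj, ncard_compl]; simp
  have hcB : (range (T K'.1).points).ncard = d + 1 := by
    rw [← image_univ, ncard_image_of_injective _ hinj', ncard_univ]; simp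
  have hc : (range (T K'.1).points \ A).ncard = 1 := by
    rw [ncard_sdiff hsub, hcA, hcB]; simp
  obtain ⟨y, hy⟩ := ncard_eq_one.1 hc
  obtain ⟨⟨i', hi'⟩, -⟩ : y ∈ range (T K'.1).points \ A := hy ▸ mem_singleton y
  refine ⟨i', ?_⟩
  have e : A = (T K'.1).points '' {i'}ᶜ := by
    rw [image_compl_eq_range_sdiff_image hinj', image_singleton, hi', ← hy,
      sdiff_sdiff_cancel_left hsub]
  rw [faceSet, faceSet, ← Affine.Simplex.convexHull_eq_closedInterior,
    ← Affine.Simplex.convexHull_eq_closedInterior, Affine.Simplex.range_faceOpposite_points,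
    Affine.Simplex.range_faceOpposite_points]
  exact congrArg _ e

/-- A cell that contains a relative interior point of a face contains all vertices of the face. -/
lemma face_interior_vertices {T : ι → Affine.Simplex ℝ (E d) d} {Ω : Set (E d)}
    (hT : IsTriangulation T) {K K' : Cells T Ω} (hK : K ≠ K') {i : Fin (d + 1)} {x : E d}
    (hx : x ∈ ((T K.1).faceOpposite i).interior) (hx' : x ∈ cell T Ω K') {j : Fin (d + 1)}
    (hj : j ≠ i) : (T K.1).points j ∈ range (T K'.1).points := by
  by_contra hjn
  have hxK : x ∈ cell T Ω K := (T K.1).closedInterior_faceOpposite_subset_closedInterior i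
    (((T K.1).faceOpposite i).interior_subset_closedInterior hx)
  have h1 := mem_convexHull_common hT hK hxK hx'
  have h2 : x ∈ ((T K.1).faceOpposite j).closedInterior := by
    rw [← Affine.Simplex.convexHull_eq_closedInterior, Affine.Simplex.range_faceOpposite_points]
    refine convexHull_mono ?_ h1
    rintro _ ⟨⟨m, rfl⟩, hm⟩
    exact ⟨m, fun h => hjn (by rwa [mem_singleton_iff.1 h] at hm), rfl⟩
  obtain ⟨w, hw, rfl⟩ := eq_affineCombination_of_mem_affineSpan_of_fintype
    ((T K.1).closedInterior_subset_affineSpan hxK)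
  rw [Affine.Simplex.faceOpposite,
    Affine.Simplex.affineCombination_mem_closedInterior_face_iff_mem_Icc _ _ hw] at h2
  rw [Affine.Simplex.faceOpposite,
    Affine.Simplex.affineCombination_mem_interior_face_iff_mem_Ioo _ _ hw] at hx
  have h3 : w j = 0 := h2.2 j (by simp)
  have h4 := hx.1 j (by simpa using hj)
  rw [h3] at h4
  exact lt_irrefl _ h4.1

lemma inner_sub_vertex_le {s : Affine.Simplex ℝ (E d) d} {i : Fin (d + 1)} {x : E d}
    (hx : x ∈ s.closedInterior) :
    inner ℝ (x - s.points i) (outNormal s i) ≤ s.height i := by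
  obtain ⟨y, hy, t, ht, rfl⟩ := (mem_simplex_iff_face s i x).1 hx
  rw [add_sub_cancel_left, real_inner_smul_left,
    inner_sub_vertex s ((s.faceOpposite i).closedInterior_subset_affineSpan hy)]
  exact mul_le_of_le_one_left (s.height_pos i).le ht.2

/-- The relative interior of a boundary face is part of the boundary of the computational domain. -/
lemma face_interior_subset_frontier [Finite ι] {T : ι → Affine.Simplex ℝ (E d) d} {Ω : Set (E d)}
    (hT : IsTriangulation T) {K : Cells T Ω} {i : Fin (d + 1)} (he : (faceOf T Ω K i).IsBoundary) :
    ((T K.1).faceOpposite i).interior ⊆ frontier (compDomain T Ω) := by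
  intro x hx
  have hxF := ((T K.1).faceOpposite i).interior_subset_closedInterior hx
  have hxK : x ∈ cell T Ω K := (T K.1).closedInterior_faceOpposite_subset_closedInterior i hxF
  have hopen : IsOpen (compDomain T Ω) := isOpen_interior
  rw [hopen.frontier_eq]
  refine ⟨(cell_subset_closure_compDomain K).2 hxK, fun hxD => ?_⟩
  -- leaving `K` through `x` in the normal direction, one stays in the union of the other cells
  set n := outNormal (T K.1) i
  have hlim : Tendsto (fun t : ℝ => x + t • n) (𝓝[>] 0) (𝓝 x) := by
    have : Tendsto (fun t : ℝ => x + t • n) (𝓝 0) (𝓝 (x + (0 : ℝ) • n)) :=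
      Continuous.tendsto (by fun_prop) 0
    rw [zero_smul, add_zero] at this
    exact this.mono_left nhdsWithin_le_nhds
  have hmem : x ∈ ⋃ K' ∈ ({K}ᶜ : Set (Cells T Ω)), cell T Ω K' := by
    refine (isClosed_biUnion_cell _).mem_of_tendsto hlim ?_
    filter_upwards [hlim (mem_interior_iff_mem_nhds.1 hxD), self_mem_nhdsWithin] with t ht ht0
    obtain ⟨K', hK'⟩ := mem_iUnion.1 ht
    refine mem_biUnion (x := K') (fun h => ?_) hK'
    rw [mem_singleton_iff.1 h] at hK'
    have h1 := inner_sub_vertex_le (i := i) hK'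
    rw [add_sub_right_comm, inner_add_left, real_inner_smul_left, real_inner_self_eq_norm_sq,
      norm_outNormal, inner_sub_vertex _
        (((T K.1).faceOpposite i).closedInterior_subset_affineSpan hxF)] at h1
    have : (0 : ℝ) < t := ht0
    linarith
  obtain ⟨K', hK', hxK'⟩ := mem_iUnion₂.1 hmem
  have hne : K ≠ K' := fun h => hK' h.symm
  obtain ⟨i', hi'⟩ := faceSet_eq_of_common_vertices fun j hj =>
    face_interior_vertices hT hne hx hxK' hj
  exact he ⟨K, K', hne, ⟨i, rfl⟩, ⟨i', hi'⟩⟩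

/-- If the computational domain is connected, then so is the graph of cells and shared faces: a
generic segment that passes from some cells to the others crosses no intersection of two cells of
codimension at least two. -/
lemma exists_shared_face [Finite ι] (hd : 2 ≤ d) {T : ι → Affine.Simplex ℝ (E d) d} {Ω : Set (E d)}
    (hT : IsTriangulation T) (hconn : IsPreconnected (compDomain T Ω)) {A : Set (Cells T Ω)}
    (hA : A.Nonempty) (hB : Aᶜ.Nonempty) :
    ∃ K ∈ A, ∃ K' ∉ A, ∃ i i', faceSet T Ω K i = faceSet T Ω K' i' := by
  have hcl := isClosed_biUnion_cell (T := T) (Ω := Ω)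
  have hcover : compDomain T Ω ⊆ (⋃ K ∈ A, cell T Ω K) ∪ ⋃ K ∈ Aᶜ, cell T Ω K := by
    intro x hx
    obtain ⟨K, hK⟩ := mem_iUnion.1 (interior_subset hx)
    by_cases h : K ∈ A
    · exact Or.inl (mem_biUnion h hK)
    · exact Or.inr (mem_biUnion (x := K) h hK)
  have hne : ∀ B : Set (Cells T Ω), B.Nonempty →
      (compDomain T Ω ∩ ⋃ K ∈ B, cell T Ω K).Nonempty := by
    rintro B ⟨K, hK⟩
    obtain ⟨x, hx⟩ := (closure_interior_simplex (T K.1) (by simp)).1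
    exact ⟨x, (cell_subset_closure_compDomain K).1 hx, mem_biUnion hK (interior_subset hx)⟩
  obtain ⟨x, hxD, hxA, hxB⟩ := isPreconnected_closed_iff.1 hconn _ _ (hcl A) (hcl Aᶜ) hcover
    (hne A hA) (hne _ hB)
  obtain ⟨KA, hKA, hxA⟩ := mem_iUnion₂.1 hxA
  obtain ⟨KB, hKB, hxB⟩ := mem_iUnion₂.1 hxB
  obtain ⟨ε, hε, hball⟩ := Metric.isOpen_iff.1 isOpen_interior x hxD
  -- a point near `x` in the interior of a given cell through `x`, off the negligible sets
  have hgen : ∀ (K : Cells T Ω), x ∈ cell T Ω K → ∀ y : E d, ∃ z ∈ cell T Ω K, z ∈ Metric.ball x ε ∧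
      ∀ (K' : Cells T Ω) (i j : Fin (d + 1)), i ≠ j →
        z ∉ affineSpan ℝ (insert y ((T K'.1).points '' {i, j}ᶜ)) := by
    intro K hxK y
    have h1 : (Metric.ball x ε ∩ interior (cell T Ω K)).Nonempty := by
      have : x ∈ closure (interior (cell T Ω K)) := by
        rwa [cell, (closure_interior_simplex (T K.1) (by simp)).2]
      exact mem_closure_iff.1 this _ Metric.isOpen_ball (Metric.mem_ball_self hε)
    have h2 : volume (⋃ (q : Cells T Ω × {p : Fin (d + 1) × Fin (d + 1) // p.1 ≠ p.2}),
        (affineSpan ℝ (insert y ((T q.1.1).points '' {q.2.1.1, q.2.1.2}ᶜ)) : Set (E d))) = 0 :=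
      measure_iUnion_null fun q => Measure.addHaar_affineSubspace _ _
        (affineSpan_insert_ne_top hd _ q.2.2 y)
    have h3 := (Metric.isOpen_ball.inter isOpen_interior).measure_pos volume h1
    obtain ⟨z, hz, hz'⟩ := (sdiff_nonempty (s := Metric.ball x ε ∩ interior (cell T Ω K))).2
      fun hsub => h3.ne' (measure_mono_null hsub h2)
    refine ⟨z, interior_subset hz.2, hz.1, fun K' i j hij hmem => hz' ?_⟩
    exact mem_iUnion.2 ⟨(K', ⟨(i, j), hij⟩), hmem⟩
  obtain ⟨y, hyA, hyx, hy⟩ := hgen KA hxA x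
  obtain ⟨z, hzB, hzx, hz⟩ := hgen KB hxB y
  have hseg : segment ℝ y z ⊆ compDomain T Ω :=
    ((convex_ball x ε).segment_subset hyx hzx).trans hball
  obtain ⟨w, hw, hwA, hwB⟩ := isPreconnected_closed_iff.1
    (convex_segment (𝕜 := ℝ) y z).isPreconnected _ _ (hcl A) (hcl Aᶜ) (hseg.trans hcover)
    ⟨y, left_mem_segment ℝ y z, mem_biUnion hKA hyA⟩
    ⟨z, right_mem_segment ℝ y z, mem_biUnion hKB hzB⟩
  obtain ⟨K, hKA, hwK⟩ := mem_iUnion₂.1 hwA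
  obtain ⟨K', hKB, hwK'⟩ := mem_iUnion₂.1 hwB
  have hKK : K ≠ K' := fun h => hKB (h ▸ hKA)
  have hwhull := mem_convexHull_common hT hKK hwK hwK'
  obtain ⟨i, hi⟩ := exists_vertex_notMem hT hKK
  have hcommon : ∀ j, j ≠ i → (T K.1).points j ∈ range (T K'.1).points := by
    intro j hj
    by_contra hjn
    have hwS : w ∈ affineSpan ℝ ((T K.1).points '' {i, j}ᶜ) := by
      refine convexHull_subset_affineSpan _ (convexHull_mono ?_ hwhull)
      rintro _ ⟨⟨m, rfl⟩, hm⟩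
      refine ⟨m, ?_, rfl⟩
      rintro (h | h)
      · exact hi (h ▸ hm)
      · exact hjn (h ▸ hm)
    have hmono : ∀ p : E d, w ∈ affineSpan ℝ (insert p ((T K.1).points '' {i, j}ᶜ)) := fun p =>
      affineSpan_mono ℝ (subset_insert _ _) hwS
    rw [segment_eq_image_lineMap] at hw
    obtain ⟨t, ht, rfl⟩ := hw
    by_cases ht0 : t = 0
    · rw [ht0, AffineMap.lineMap_apply_zero] at hmono
      exact hy K i j hj.symm (hmono x)
    · refine hz K i j hj.symm ?_
      have : AffineMap.lineMap y (AffineMap.lineMap y z t) t⁻¹ = z := by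
        rw [AffineMap.lineMap_lineMap_right, inv_mul_cancel₀ ht0, AffineMap.lineMap_apply_one]
      rw [← this]
      exact AffineMap.lineMap_mem _ (mem_affineSpan ℝ (mem_insert _ _)) (hmono y)
  obtain ⟨i', hi'⟩ := faceSet_eq_of_common_vertices hcommon
  exact ⟨K, hKA, K', hKB, i, i', hi'⟩

end MeshGeometry

/-! ### Polynomials as functions -/

section Polynomials

variable {d : ℕ}

lemma ev_add (p q : MvPolynomial (Fin d) ℝ) (x : E d) : ev (p + q) x = ev p x + ev q x := by
  simp [ev]

lemma ev_smul (c : ℝ) (p : MvPolynomial (Fin d) ℝ) (x : E d) : ev (c • p) x = c * ev p x := by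
  simp [ev]

lemma ev_mul (p q : MvPolynomial (Fin d) ℝ) (x : E d) : ev (p * q) x = ev p x * ev q x := by
  simp [ev]

lemma ev_zero (x : E d) : ev (0 : MvPolynomial (Fin d) ℝ) x = 0 := by
  simp [ev]

lemma ev_sum {α : Type*} (t : Finset α) (p : α → MvPolynomial (Fin d) ℝ) (x : E d) :
    ev (∑ i ∈ t, p i) x = ∑ i ∈ t, ev (p i) x := by
  simp [ev]

lemma ev_C_mul (c : ℝ) (p : MvPolynomial (Fin d) ℝ) (x : E d) :
    ev (MvPolynomial.C c * p) x = c * ev p x := by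
  simp [ev]

lemma ev_dotPoly {k : ℕ} (p : Fin d → Pk d k) (n x : E d) :
    ev (dotPoly p n) x = ∑ j, ev (p j).1 x * n j := by
  rw [dotPoly, ev_sum]
  exact Finset.sum_congr rfl fun j _ => by rw [ev_C_mul, mul_comm]

lemma ev_dirDeriv (n : E d) (p : MvPolynomial (Fin d) ℝ) (x : E d) :
    ev (dirDeriv n p) x = ∑ j, n j * ev (MvPolynomial.pderiv j p) x := by
  simp [dirDeriv, ev_sum, ev_C_mul]

lemma contDiff_ev (p : MvPolynomial (Fin d) ℝ) : ContDiff ℝ 1 (ev p) := by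
  induction p using MvPolynomial.induction_on with
  | C a =>
    have : ev (MvPolynomial.C a) = fun _ : E d => a := by ext x; simp [ev]
    rw [this]; exact contDiff_const
  | add p q hp hq =>
    rw [show ev (p + q) = fun x => ev p x + ev q x from funext (ev_add p q)]
    exact hp.add hq
  | mul_X p i hp =>
    have : ev (p * MvPolynomial.X i) = fun x : E d => ev p x * x i := by
      ext x; simp [ev]
    rw [this]
    exact hp.mul (by fun_prop)

@[fun_prop]
lemma continuous_ev (p : MvPolynomial (Fin d) ℝ) : Continuous (ev p) := (contDiff_ev p).continuous

lemma hasFDerivAt_ev (p : MvPolynomial (Fin d) ℝ) (x : E d) :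
    HasFDerivAt (ev p) (∑ j, ev (MvPolynomial.pderiv j p) x •
      (EuclideanSpace.proj j : E d →L[ℝ] ℝ)) x := by
  induction p using MvPolynomial.induction_on with
  | C a =>
    have : ev (MvPolynomial.C a) = fun _ : E d => a := by ext x; simp [ev]
    rw [this]
    refine (hasFDerivAt_const a x).congr_fderiv ?_
    simp [ev]
  | add p q hp hq =>
    rw [show ev (p + q) = fun x => ev p x + ev q x from funext (ev_add p q)]
    refine (hp.add hq).congr_fderiv ?_
    simp only [map_add, ev_add, add_smul, Finset.sum_add_distrib]
  | mul_X p i hp =>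
    have e : ev (p * MvPolynomial.X i) = fun x : E d => ev p x * x i := by
      ext x; simp [ev]
    have h := hp.mul ((EuclideanSpace.proj i : E d →L[ℝ] ℝ).hasFDerivAt (x := x))
    rw [e]
    refine h.congr_fderiv ?_
    have h1 : ∀ j, ev (MvPolynomial.pderiv j (p * MvPolynomial.X i)) x =
        ev (MvPolynomial.pderiv j p) x * x i + if j = i then ev p x else 0 := by
      intro j
      rw [MvPolynomial.pderiv_mul, MvPolynomial.pderiv_X, ev_add, ev_mul, ev_mul]
      by_cases hj : j = i
      · subst hj; simp [ev]
      · simp [ev, Ne.symm hj, hj]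
    simp only [h1, add_smul, Finset.sum_add_distrib, ite_smul, zero_smul, Finset.sum_ite_eq',
      Finset.mem_univ, if_true, Finset.smul_sum, smul_smul]
    rw [add_comm]
    congr 1
    exact Finset.sum_congr rfl fun j _ => by rw [mul_comm]; rfl

lemma fderiv_ev (p : MvPolynomial (Fin d) ℝ) (x v : E d) :
    fderiv ℝ (ev p) x v = ev (dirDeriv v p) x := by
  rw [(hasFDerivAt_ev p x).fderiv, ev_dirDeriv]
  simp [mul_comm]

lemma totalDegree_pderiv_le (p : MvPolynomial (Fin d) ℝ) (j : Fin d) :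
    (MvPolynomial.pderiv j p).totalDegree ≤ p.totalDegree := by
  conv_lhs => rw [p.as_sum, map_sum]
  refine MvPolynomial.totalDegree_finsetSum_le fun m hm => ?_
  rw [MvPolynomial.pderiv_monomial]
  refine (MvPolynomial.totalDegree_monomial_le _ _).trans ?_
  refine le_trans ?_ (MvPolynomial.le_totalDegree hm)
  exact Finsupp.degree_mono (tsub_le_self (a := m) (b := Finsupp.single j 1))

lemma dirDeriv_mem {k : ℕ} {p : MvPolynomial (Fin d) ℝ} (hp : p ∈ Pk d k) (n : E d) :
    dirDeriv n p ∈ Pk d k := by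
  refine Submodule.sum_mem _ fun j _ => ?_
  rw [← MvPolynomial.smul_eq_C_mul]
  refine Submodule.smul_mem _ _ ?_
  rw [MvPolynomial.mem_restrictTotalDegree] at hp ⊢
  exact (totalDegree_pderiv_le p j).trans hp

lemma dotPoly_mem {k : ℕ} (p : Fin d → Pk d k) (n : E d) : dotPoly p n ∈ Pk d k := by
  refine Submodule.sum_mem _ fun j _ => ?_
  rw [← MvPolynomial.smul_eq_C_mul]
  exact Submodule.smul_mem _ _ (p j).2

lemma exists_dotPoly_eq {k : ℕ} {p : MvPolynomial (Fin d) ℝ} (hp : p ∈ Pk d k) {n : E d}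
    (hn : ‖n‖ = 1) : ∃ q : Fin d → Pk d k, dotPoly q n = p := by
  refine ⟨fun j => n j • ⟨p, hp⟩, ?_⟩
  have h : ∑ j, n j * n j = 1 := by
    have := EuclideanSpace.real_norm_sq_eq n
    rw [hn] at this
    simpa [sq] using this.symm
  simp only [dotPoly, Submodule.coe_smul, MvPolynomial.smul_eq_C_mul, ← mul_assoc, ← map_mul,
    ← Finset.sum_mul, ← map_sum, h, map_one, one_mul]

/-- A polynomial that vanishes on a set with non-empty interior is zero. -/
lemma eq_zero_of_ev_eq_zero {p : MvPolynomial (Fin d) ℝ} {s : Set (E d)}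
    (hs : (interior s).Nonempty) (h : ∀ x ∈ s, ev p x = 0) : p = 0 := by
  obtain ⟨x, hx⟩ := hs
  have hU : IsOpen ((fun y : Fin d → ℝ => (WithLp.toLp 2 y : E d)) ⁻¹' interior s) :=
    isOpen_interior.preimage (PiLp.continuous_toLp 2 _)
  obtain ⟨ε, hε, hball⟩ := Metric.isOpen_iff.1 hU (fun j => x j) hx
  refine MvPolynomial.funext_set (fun j => Metric.ball (x j) ε) (fun j => ?_) fun y hy => ?_
  · rw [Real.ball_eq_Ioo]
    exact Ioo_infinite (by linarith)
  · rw [ball_pi _ hε] at hball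
    simpa [ev] using h _ (interior_subset (hball hy))

lemma continuous_ae_zero {s : Set (E d)} (hs : s ⊆ closure (interior s)) {f : E d → ℝ}
    (hf : Continuous f) (h : ∀ᵐ x ∂(volume.restrict s), f x = 0) : ∀ x ∈ s, f x = 0 :=
  continuousOn_eq_zero_of_ae hs hf.continuousOn h

end Polynomials

/-! ### The consistency error of the transferred datum -/

section Transfer

lemma integral_le_toReal_lintegral {α : Type*} [MeasurableSpace α] {μ : Measure α} (f : α → ℝ) :
    ∫ x, f x ∂μ ≤ (∫⁻ x, ENNReal.ofReal (f x) ∂μ).toReal := by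
  by_cases hf : Integrable f μ
  · rw [integral_eq_lintegral_pos_part_sub_lintegral_neg_part hf]
    exact sub_le_self _ ENNReal.toReal_nonneg
  · rw [integral_undef hf]
    exact ENNReal.toReal_nonneg

/-- How the smallness of the proximity parameter enters: `r` is the ratio `H / h`, and `A`, `B` are
the suprema in the definitions of the extension and inverse constants. -/
lemma sq_mul_le_of_proximity {r h H A B N X Z : ℝ≥0∞} (hH : H = r * h)
    (hX : X ≤ A * N) (hN : N ≤ B * Z)
    (hr : r < 2 ^ (-(1 / 3) : ℝ) * ((h * B) * (A / r ^ (1 / 2 : ℝ))) ^ (-(2 / 3) : ℝ)) :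
    (H * X) ^ 2 ≤ 2⁻¹ * Z ^ 2 := by
  rcases eq_or_ne r 0 with h0 | h0
  · simp [hH, h0]
  have hrt : r ≠ ⊤ := hr.ne_top
  set P := (h * B) * (A / r ^ (1 / 2 : ℝ)) with hP
  have hs0 : r ^ (1 / 2 : ℝ) ≠ 0 := by simp [h0, hrt]
  have hst : r ^ (1 / 2 : ℝ) ≠ ⊤ := by simp [h0, hrt]
  have e : r ^ (3 / 2 : ℝ) = r * r ^ (1 / 2 : ℝ) := by
    rw [show (3 / 2 : ℝ) = 1 + 1 / 2 by norm_num, ENNReal.rpow_add _ _ h0 hrt, ENNReal.rpow_one]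
  have h1 : H * X ≤ r ^ (3 / 2 : ℝ) * P * Z := by
    calc H * X ≤ r * h * (A * (B * Z)) := by rw [hH]; gcongr; exact hX.trans (by gcongr)
      _ = r * (h * B * (r ^ (1 / 2 : ℝ) * (A / r ^ (1 / 2 : ℝ)))) * Z := by
        rw [ENNReal.mul_div_cancel hs0 hst]; ring
      _ = r ^ (3 / 2 : ℝ) * P * Z := by rw [e, hP]; ring
  have h2 : r ^ (3 / 2 : ℝ) * P ≤ 2 ^ (-(1 / 2) : ℝ) := by
    calc r ^ (3 / 2 : ℝ) * P
        ≤ (2 ^ (-(1 / 3) : ℝ) * P ^ (-(2 / 3) : ℝ)) ^ (3 / 2 : ℝ) * P := by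
          gcongr
      _ = 2 ^ (-(1 / 2) : ℝ) * (P⁻¹ * P) := by
        rw [ENNReal.mul_rpow_of_nonneg _ _ (by norm_num), ← ENNReal.rpow_mul, ← ENNReal.rpow_mul]
        norm_num
        rw [ENNReal.rpow_neg_one, mul_assoc]
      _ ≤ 2 ^ (-(1 / 2) : ℝ) * 1 := by gcongr; exact ENNReal.inv_mul_le_one P
      _ = _ := mul_one _
  calc (H * X) ^ 2 ≤ (2 ^ (-(1 / 2) : ℝ) * Z) ^ 2 := by
        refine pow_le_pow_left' (h1.trans ?_) 2
        gcongr
    _ = 2⁻¹ * Z ^ 2 := by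
      rw [mul_pow, ← ENNReal.rpow_natCast, ← ENNReal.rpow_mul]
      norm_num
      rw [ENNReal.rpow_neg_one]

variable {d : ℕ}

lemma eLpNorm_ev_ne (s : Affine.Simplex ℝ (E d) d) {p : MvPolynomial (Fin d) ℝ} (hp : p ≠ 0) :
    eLpNorm (ev p) 2 (volume.restrict s.closedInterior) ≠ 0 ∧
      eLpNorm (ev p) 2 (volume.restrict s.closedInterior) ≠ ⊤ := by
  obtain ⟨hne, hcl⟩ := closure_interior_simplex s (by simp)
  constructor
  · intro h
    rw [eLpNorm_eq_zero_iff (continuous_ev p).aestronglyMeasurable two_ne_zero] at h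
    exact hp (eq_zero_of_ev_eq_zero hne (continuous_ae_zero hcl.ge (continuous_ev p) h))
  · have h : MemLp (ev p) 2 (volume.restrict s.closedInterior) := by
      rw [memLp_two_iff_integrable_sq (continuous_ev p).aestronglyMeasurable]
      exact ((continuous_ev p).pow 2).continuousOn.integrableOn_compact s.isCompact_closedInterior
    exact h.eLpNorm_lt_top.ne

lemma eLpNorm_two_sq {α : Type*} [MeasurableSpace α] {μ : Measure α} (f : α → ℝ) :
    eLpNorm f 2 μ ^ 2 = ∫⁻ x, ENNReal.ofReal (f x ^ 2) ∂μ := by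
  have := eLpNorm_nnreal_pow_eq_lintegral (μ := μ) (f := f) (p := 2) two_ne_zero
  simp only [NNReal.coe_ofNat, ENNReal.rpow_ofNat, ENNReal.coe_ofNat] at this
  rw [this]
  refine lintegral_congr fun x => ?_
  rw [← enorm_pow, Real.enorm_of_nonneg (sq_nonneg _)]

/-- The pointwise estimate behind the coercivity. With `g` the integral of `p` over the transfer
path, `g - l p(x)` is a weighted integral of the normal derivative of `p`, so that `p(x) g` is
`g² / l` up to an error; since `4 τ l ≤ 1`, this dominates `τ g² / 2`. -/
lemma transfer_pointwise (p : MvPolynomial (Fin d) ℝ) (x n : E d) {l τ : ℝ} (hl : 0 ≤ l)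
    (hτ : 4 * τ * l ≤ 1) :
    τ / 2 * (∫ t in (0 : ℝ)..l, ev p (x + t • n)) ^ 2 -
        ev p x * ∫ t in (0 : ℝ)..l, ev p (x + t • n) ≤
      2 / 7 * (l ^ 2 * ∫ t in (0 : ℝ)..l, ev (dirDeriv n p) (x + t • n) ^ 2) := by
  rcases hl.eq_or_lt with rfl | hl
  · simp
  set g := ∫ t in (0 : ℝ)..l, ev p (x + t • n) with hg
  set Q := ∫ t in (0 : ℝ)..l, ev (dirDeriv n p) (x + t • n) ^ 2 with hQ
  have hc1 : Continuous fun t : ℝ => ev p (x + t • n) := by fun_prop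
  have hc2 : Continuous fun t : ℝ => ev (dirDeriv n p) (x + t • n) := by fun_prop
  -- integration by parts
  have hparts : ∫ t in (0 : ℝ)..l, (l - t) * ev (dirDeriv n p) (x + t • n) = g - l * ev p x := by
    have hder : ∀ t : ℝ, HasDerivAt (fun t => (l - t) * ev p (x + t • n))
        ((l - t) * ev (dirDeriv n p) (x + t • n) - ev p (x + t • n)) t := by
      intro t
      have h1 : HasDerivAt (fun t : ℝ => l - t) (-1) t := (hasDerivAt_id t).const_sub l
      have h2 : HasDerivAt (fun t : ℝ => x + t • n) n t := by
        simpa using ((hasDerivAt_id t).smul_const n).const_add x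
      have h3 := (((contDiff_ev p).differentiable one_ne_zero).differentiableAt.hasFDerivAt
        (x := x + t • n)).comp_hasDerivAt t h2
      refine (h1.mul h3).congr_deriv ?_
      rw [fderiv_ev]
      simp only [Function.comp]
      ring
    have h := intervalIntegral.integral_eq_sub_of_hasDerivAt (a := 0) (b := l)
      (fun t _ => hder t) (Continuous.intervalIntegrable (by fun_prop) _ _)
    rw [intervalIntegral.integral_sub (Continuous.intervalIntegrable (by fun_prop) _ _)
      (hc1.intervalIntegrable _ _), ← hg] at h
    simp only [sub_self, zero_mul, sub_zero, zero_smul, add_zero, zero_sub] at h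
    linarith
  -- Young's inequality: the part `7 / 8` of `g²` and the part `1 / 8` that bounds `τ l g² / 2`
  -- add up to one, and the factor `2 / 7` is small enough for the four faces of a tetrahedron
  have hyoung : g * (g - l * ev p x) ≤ 7 / 8 * g ^ 2 + 2 / 7 * l ^ 3 * Q := by
    rw [← hparts, ← intervalIntegral.integral_const_mul]
    have e : 7 / 8 * g ^ 2 + 2 / 7 * l ^ 3 * Q = ∫ t in (0 : ℝ)..l,
        (7 / 8 * g ^ 2 / l + 2 / 7 * l ^ 3 * ev (dirDeriv n p) (x + t • n) ^ 2) := by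
      rw [intervalIntegral.integral_add (by simp) (Continuous.intervalIntegrable (by fun_prop) _ _),
        intervalIntegral.integral_const_mul, ← hQ, intervalIntegral.integral_const, sub_zero,
        smul_eq_mul]
      field_simp
    rw [e]
    refine intervalIntegral.integral_mono_on hl.le
      (Continuous.intervalIntegrable (by fun_prop) _ _)
      (Continuous.intervalIntegrable (by fun_prop) _ _) fun t ht => ?_
    set q := ev (dirDeriv n p) (x + t • n)
    have h1 : (l - t) ^ 2 ≤ l ^ 2 := by nlinarith [ht.1, ht.2]
    have h2 : g * ((l - t) * q) ≤ 7 / 8 * g ^ 2 * (l - t) ^ 2 / l ^ 3 + 2 / 7 * l ^ 3 * q ^ 2 := by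
      have h3 : 0 ≤ (7 / 4 * g * (l - t) - l ^ 3 * q) ^ 2 := sq_nonneg _
      have hl3 : 0 < l ^ 3 := by positivity
      rw [← sub_nonneg]
      have : 7 / 8 * g ^ 2 * (l - t) ^ 2 / l ^ 3 + 2 / 7 * l ^ 3 * q ^ 2 - g * ((l - t) * q) =
          2 / 7 * (7 / 4 * g * (l - t) - l ^ 3 * q) ^ 2 / l ^ 3 := by
        field_simp
        ring
      rw [this]
      positivity
    refine h2.trans ?_
    refine add_le_add_left ?_ _
    rw [div_le_div_iff₀ (by positivity) hl]
    have : 7 / 8 * g ^ 2 * l ^ 3 = 7 / 8 * g ^ 2 * l ^ 2 * l := by ring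
    rw [this]
    gcongr
  have h5 : l * (τ / 2 * g ^ 2 - ev p x * g) ≤ l * (2 / 7 * (l ^ 2 * Q)) := by
    nlinarith [mul_le_mul_of_nonneg_right hτ (sq_nonneg g)]
  exact le_of_mul_le_mul_left h5 hl

variable {ι : Type} [NeZero d]

lemma ratio_lt_and_Hperp_ne_top {T : ι → Affine.Simplex ℝ (E d) d} {Ω : Set (E d)}
    {Kext : Face T Ω → Set (E d)} {k : ℕ} (hR : RBound T Ω Kext k) {K : Cells T Ω}
    {i : Fin (d + 1)} (he : (faceOf T Ω K i).IsBoundary) : ratio T Ω Kext K i <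
      2 ^ (-(1 / 3) : ℝ) * (Cinv T Ω k K i * Cext T Ω Kext k K i) ^ (-(2 / 3) : ℝ) ∧
    Hperp T Ω Kext K i = ratio T Ω Kext K i * ENNReal.ofReal (faceHeight T Ω K i) ∧
    Hperp T Ω Kext K i ≠ ⊤ := by
  have h1 : ratio T Ω Kext K i ≤ proximityR T Ω Kext :=
    le_iSup_of_le K (le_iSup_of_le i (le_iSup_of_le he le_rfl))
  have h2 := h1.trans_lt (hR K i he)
  have h3 : Hperp T Ω Kext K i = ratio T Ω Kext K i * ENNReal.ofReal (faceHeight T Ω K i) := by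
    rw [ratio, ENNReal.div_mul_cancel]
    · exact (ENNReal.ofReal_pos.2 ((T K.1).height_pos i)).ne'
    · exact ENNReal.ofReal_ne_top
  exact ⟨h2, h3, h3 ▸ ENNReal.mul_ne_top h2.ne_top ENNReal.ofReal_ne_top⟩

/-- The proximity condition bounds the normal derivative of a polynomial on the extension patch by
the polynomial on the cell. -/
lemma lintegral_ext_dirDeriv_le {T : ι → Affine.Simplex ℝ (E d) d} {Ω : Set (E d)}
    {Kext : Face T Ω → Set (E d)} {k : ℕ} (hR : RBound T Ω Kext k) {K : Cells T Ω}
    {i : Fin (d + 1)} (he : (faceOf T Ω K i).IsBoundary) {ζ : MvPolynomial (Fin d) ℝ}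
    (hζ : ζ ∈ Pk d k) :
    Hperp T Ω Kext K i ^ 2 * ∫⁻ x in Kext (faceOf T Ω K i),
        ENNReal.ofReal (ev (dirDeriv (normal T Ω K i) ζ) x ^ 2) ≤
      2⁻¹ * ∫⁻ x in cell T Ω K, ENNReal.ofReal (ev ζ x ^ 2) := by
  obtain ⟨h1, h2, -⟩ := ratio_lt_and_Hperp_ne_top hR he
  set n := normal T Ω K i with hn
  have hn1 : ‖n‖ = 1 := norm_outNormal (T K.1) i
  rw [← eLpNorm_two_sq, ← eLpNorm_two_sq, ← mul_pow]
  refine sq_mul_le_of_proximity h2 ?_ ?_ h1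
    (N := eLpNorm (ev (dirDeriv n ζ)) 2 (volume.restrict (cell T Ω K)))
  · rcases eq_or_ne (dirDeriv n ζ) 0 with h0 | h0
    · rw [h0]
      have : (ev (0 : MvPolynomial (Fin d) ℝ) : E d → ℝ) = 0 := funext ev_zero
      simp [this]
    obtain ⟨q, hq⟩ := exists_dotPoly_eq (dirDeriv_mem hζ n) hn1
    obtain ⟨hne, hnt⟩ := eLpNorm_ev_ne (T K.1) h0
    refine (ENNReal.div_le_iff hne hnt).1 ?_
    refine le_iSup_of_le q (le_iSup_of_le (by rw [hq]; exact h0) ?_)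
    rw [← hn, hq]
    exact le_rfl
  · rcases eq_or_ne ζ 0 with h0 | h0
    · have e : (ev (0 : MvPolynomial (Fin d) ℝ) : E d → ℝ) = 0 := funext ev_zero
      have : dirDeriv n (0 : MvPolynomial (Fin d) ℝ) = 0 := by simp [dirDeriv]
      rw [h0, this, e]
      simp
    obtain ⟨q, hq⟩ := exists_dotPoly_eq hζ hn1
    obtain ⟨hne, hnt⟩ := eLpNorm_ev_ne (T K.1) h0
    refine (ENNReal.div_le_iff hne hnt).1 ?_
    refine le_iSup_of_le q (le_iSup_of_le (by rw [hq]; exact h0) ?_)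
    rw [← hn, hq]
    exact le_rfl

/-- The segments in normal direction over a face are disjoint: integrating over all of them is
bounded by the integral over a set that contains them. -/
lemma lintegral_normal_segments_le (s : Affine.Simplex ℝ (E d) d) (i : Fin (d + 1)) {S : Set (E d)}
    (hS : MeasurableSet S) {G : E d → ℝ≥0∞} (hG : Measurable G) {l : E d → ℝ}
    (h : ∀ᵐ x ∂((surf d).restrict (s.faceOpposite i).closedInterior),
      ∀ t ∈ Icc 0 (l x), x + t • outNormal s i ∈ S) :
    ∫⁻ x in (s.faceOpposite i).closedInterior,
        (∫⁻ t in Icc 0 (l x), G (x + t • outNormal s i)) ∂(surf d) ≤ ∫⁻ y in S, G y := by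
  obtain ⟨hmp, hme⟩ := measurePreserving_orthCoord (s.altitudeFoot i) (norm_outNormal s i)
  have hm : Measurable (S.indicator G) := hG.indicator hS
  calc ∫⁻ x in (s.faceOpposite i).closedInterior,
        (∫⁻ t in Icc 0 (l x), G (x + t • outNormal s i)) ∂(surf d)
      ≤ ∫⁻ x in (s.faceOpposite i).closedInterior,
        (∫⁻ t : ℝ, S.indicator G (x + t • outNormal s i)) ∂(surf d) := by
        refine lintegral_mono_ae (h.mono fun x hx => ?_)
        rw [← lintegral_indicator measurableSet_Icc]
        refine lintegral_mono fun t => ?_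
        by_cases ht : t ∈ Icc 0 (l x)
        · rw [indicator_of_mem ht, indicator_of_mem (hx t ht)]
        · rw [indicator_of_notMem ht]; exact zero_le
    _ = ∫⁻ z in facePar s i,
        (∫⁻ t : ℝ, S.indicator G (orthCoord (s.altitudeFoot i) (outNormal s i) (t, z))) := by
        rw [surf_face_eq_map, (measurableEmbedding_planePt _ _).lintegral_map]
        simp only [planePt, orthCoord, add_right_comm]
    _ ≤ ∫⁻ z : perp (outNormal s i),
        (∫⁻ t : ℝ, S.indicator G (orthCoord (s.altitudeFoot i) (outNormal s i) (t, z))) :=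
        setLIntegral_le_lintegral _ _
    _ = ∫⁻ q : ℝ × perp (outNormal s i),
        S.indicator G (orthCoord (s.altitudeFoot i) (outNormal s i) q) ∂(volume.prod volume) := by
        rw [lintegral_prod_symm]
        exact (hm.comp hmp.measurable).aemeasurable
    _ = ∫⁻ y in S, G y := by
        rw [hmp.lintegral_comp_emb hme, lintegral_indicator hS]

end Transfer

/-! ### Fields on the faces -/

section FaceFields

variable {d k : ℕ}

lemma evVec_apply (p : Fin d → Pk d k) (x : E d) (i : Fin d) : evVec p x i = ev (p i).1 x := rfl

lemma evMatVec_apply (σ : Fin d → Fin d → Pk d k) (x v : E d) (i : Fin d) :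
    evMatVec σ x v i = ev (dotPoly (σ i) v) x := (ev_dotPoly _ _ _).symm

lemma inner_eq_sum (x y : E d) : inner ℝ x y = ∑ i, x i * y i := by
  rw [PiLp.inner_apply]
  exact Finset.sum_congr rfl fun i _ => by simp [mul_comm]

lemma continuous_of_coord {X : Type*} [TopologicalSpace X] {f : X → E d}
    (h : ∀ i, Continuous fun x => f x i) : Continuous f :=
  (PiLp.continuous_toLp 2 _).comp (continuous_pi h)

@[fun_prop]
lemma continuous_evVec (p : Fin d → Pk d k) : Continuous (evVec p) :=
  continuous_of_coord fun i => continuous_ev (p i).1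

@[fun_prop]
lemma continuous_evMatVec (σ : Fin d → Fin d → Pk d k) (v : E d) :
    Continuous fun x => evMatVec σ x v :=
  continuous_of_coord fun i => by simpa only [evMatVec_apply] using continuous_ev _

@[fun_prop]
lemma continuous_evDiv (σ : Fin d → Fin d → Pk d k) : Continuous (evDiv σ) :=
  continuous_of_coord fun i => by simp only [evDiv]; fun_prop

lemma integrable_inner_of_memLp_top {α : Type*} [MeasurableSpace α] {μ : Measure α}
    {f g : α → E d} (hf : Integrable f μ) (hg : MemLp g ⊤ μ) :
    Integrable (fun x => inner ℝ (f x) (g x)) μ := by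
  refine (hf.norm.mul_const (eLpNorm g ⊤ μ).toReal).mono' (hf.1.inner hg.1) ?_
  have h := ae_le_eLpNormEssSup (f := g) (μ := μ)
  filter_upwards [h] with x hx
  refine (norm_inner_le_norm _ _).trans ?_
  gcongr
  have := ENNReal.toReal_mono hg.2.ne (eLpNorm_exponent_top (f := g) (μ := μ) ▸ hx)
  simpa using this

lemma continuous_line_integral (σ : Fin d → Fin d → Pk d k) (n : E d) :
    Continuous fun q : E d × ℝ => ∫ t in (0 : ℝ)..q.2, evMatVec σ (q.1 + t • n) n := by
  refine intervalIntegral.continuous_parametric_intervalIntegral_of_continuous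
    (f := fun (q : E d × ℝ) t => evMatVec σ (q.1 + t • n) n) ?_ continuous_snd
  unfold Function.uncurry
  exact (continuous_evMatVec σ n).comp (by fun_prop)

lemma line_integral_apply (σ : Fin d → Fin d → Pk d k) (x n : E d) (l : ℝ) (i : Fin d) :
    (∫ t in (0 : ℝ)..l, evMatVec σ (x + t • n) n) i =
      ∫ t in (0 : ℝ)..l, ev (dotPoly (σ i) n) (x + t • n) := by
  have h := (EuclideanSpace.proj i : E d →L[ℝ] ℝ).intervalIntegral_comp_comm (μ := volume)
    (a := 0) (b := l) (f := fun t => evMatVec σ (x + t • n) n)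
    (Continuous.intervalIntegrable ((continuous_evMatVec σ n).comp
      (g := fun x => evMatVec σ x n) (f := fun t : ℝ => x + t • n) (by fun_prop)) _ _)
  have e : ∀ t : ℝ, (EuclideanSpace.proj i : E d →L[ℝ] ℝ) (evMatVec σ (x + t • n) n) =
      ev (dotPoly (σ i) n) (x + t • n) := fun t => evMatVec_apply _ _ _ _
  simp only [e] at h
  exact h.symm

variable [NeZero d]

instance isFiniteMeasure_face (s : Affine.Simplex ℝ (E d) d) (i : Fin (d + 1)) :
    IsFiniteMeasure ((surf d).restrict (s.faceOpposite i).closedInterior) :=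
  isFiniteMeasure_restrict.2 (surf_face_lt_top s i).ne

lemma memLp_top_face (s : Affine.Simplex ℝ (E d) d) (i : Fin (d + 1)) {f : E d → E d}
    (hf : ContinuousOn f (s.faceOpposite i).closedInterior) :
    MemLp f ⊤ ((surf d).restrict (s.faceOpposite i).closedInterior) := by
  have hm := (s.faceOpposite i).isClosed_closedInterior.measurableSet
  obtain ⟨C, hC⟩ := (s.faceOpposite i).isCompact_closedInterior.exists_bound_of_continuousOn hf
  exact memLp_top_of_bound (hf.aestronglyMeasurable hm) C
    ((ae_restrict_iff' hm).2 (Eventually.of_forall hC))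

variable {ι : Type} {T : ι → Affine.Simplex ℝ (E d) d} {Ω : Set (E d)}

/-- On its face, an element of `M_h` is a vector of polynomials. -/
lemma exists_evVec_eq_evM (μ : MSpace T Ω k) (e : Face T Ω) :
    ∃ p : Fin d → Pk d k, ∀ x ∈ e.1, evM μ e x = evVec p x := by
  choose p hp hpe using fun i => (μ e i).2
  refine ⟨fun i => ⟨p i, hp i⟩, fun x hx => ?_⟩
  ext i
  rw [evVec_apply]
  change (μ e i).1 x = _
  rw [← hpe i]
  exact indicator_of_mem hx _

lemma continuousOn_evM (μ : MSpace T Ω k) (e : Face T Ω) : ContinuousOn (evM μ e) e.1 := by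
  obtain ⟨p, hp⟩ := exists_evVec_eq_evM μ e
  exact (continuous_evVec p).continuousOn.congr hp

/-- The restriction of a vector of polynomials to a face. -/
noncomputable def faceRestrict (e : Face T Ω) (p : Fin d → Pk d k) (i : Fin d) : polyOn k e.1 :=
  ⟨restrictTo e.1 (p i).1, Submodule.mem_map_of_mem (p i).2⟩

lemma faceRestrict_apply (e : Face T Ω) (p : Fin d → Pk d k) {x : E d} (hx : x ∈ e.1) :
    (WithLp.toLp 2 fun i => (faceRestrict e p i).1 x : E d) = evVec p x := by
  ext i
  exact indicator_of_mem hx _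

/-- A boundary face determines its cell and the opposite vertex. -/
lemma isBoundary_faceOf_unique {K K' : Cells T Ω} {i i' : Fin (d + 1)}
    (he : (faceOf T Ω K i).IsBoundary) (h : faceOf T Ω K i = faceOf T Ω K' i') :
    K = K' ∧ i = i' := by
  have hs : faceSet T Ω K i = faceSet T Ω K' i' := congrArg Subtype.val h
  have hK : K = K' := by
    by_contra hne
    exact he ⟨K, K', hne, ⟨i, rfl⟩, ⟨i', hs⟩⟩
  subst hK
  refine ⟨rfl, ?_⟩
  by_contra hne
  have h1 : (T K.1).points i ∈ faceSet T Ω K i' :=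
    ((T K.1).point_mem_closedInterior_faceOpposite_iff).2 hne
  rw [← hs] at h1
  exact ((T K.1).point_mem_closedInterior_faceOpposite_iff).1 h1 rfl

end FaceFields

/-! ### The transferred datum on the Dirichlet faces -/

section Dirichlet

variable {d k : ℕ} [NeZero d] {ι : Type} [Finite ι] {T : ι → Affine.Simplex ℝ (E d) d}
  {Ω : Set (E d)} {Kext : Face T Ω → Set (E d)} {φ : E d → E d} {ΓD : Set (Face T Ω)} {τ : ℝ}
  {a : E d → ℝ}

/-- On a Dirichlet face the transfer path is normal, its length is at most `H` and `1 / (4 τ)`, and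
the transferred datum is a line integral in normal direction. -/
lemma dirichlet_path (hT : IsTriangulation T)
    (hφ : BijOn φ (frontier (compDomain T Ω)) (frontier Ω))
    (hΓD : ∀ e ∈ ΓD, e.IsBoundary) (hnormal : NormalPaths T Ω Kext φ ΓD) (hτ : 0 < τ)
    (hH : HBound T Ω Kext τ a) (σ : ZZSpace T Ω k) {K : Cells T Ω} {i : Fin (d + 1)}
    (he : faceOf T Ω K i ∈ ΓD) {x : E d} (hx : x ∈ ((T K.1).faceOpposite i).interior) :
    ENNReal.ofReal (dist x (φ x)) ≤ Hperp T Ω Kext K i ∧ 4 * τ * dist x (φ x) ≤ 1 ∧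
    (∀ t ∈ Icc 0 (dist x (φ x)), x + t • normal T Ω K i ∈ Kext (faceOf T Ω K i)) ∧
    ghD φ σ K x = ∫ t in (0 : ℝ)..dist x (φ x),
      evMatVec (σ K) (x + t • normal T Ω K i) (normal T Ω K i) := by
  obtain ⟨h1, h2⟩ := hnormal K i he x hx
  have hxF := face_interior_subset_frontier hT (hΓD _ he) hx
  set l := dist x (φ x) with hl
  set n := normal T Ω K i with hn
  have hl0 : 0 ≤ l := dist_nonneg
  have hle : ENNReal.ofReal l ≤ Hperp T Ω Kext K i := by
    refine le_iSup_of_le x (le_iSup_of_le l (le_iSup_of_le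
      ⟨((T K.1).faceOpposite i).interior_subset_closedInterior hx, hl0, ?_, ?_⟩ le_rfl))
    · rw [← hn, ← h1]; exact hφ.mapsTo hxF
    · rw [← hn, ← h1]; exact h2
  refine ⟨hle, ?_, fun t ht => ?_, ?_⟩
  · have h3 := hle.trans (hH K i (hΓD _ he))
    rw [min_eq_left, mul_one] at h3
    · have h4 : ENNReal.ofReal (4 * τ * l) ≤ 1 := by
        rw [ENNReal.ofReal_mul (by positivity), ENNReal.ofReal_mul (by norm_num)]
        refine (mul_le_mul_right h3 _).trans ?_
        rw [ENNReal.ofReal_ofNat]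
        exact ENNReal.mul_inv_le_one _
      simpa using h4
    · exact le_iSup₂_of_le x hxF le_self_add
  · refine h2 ?_
    rcases hl0.eq_or_lt with h0 | h0
    · have : t = 0 := le_antisymm (h0 ▸ ht.2) ht.1
      simpa [this] using left_mem_segment ℝ x (φ x)
    rw [h1, segment_eq_image']
    refine ⟨t / l, ⟨div_nonneg ht.1 hl0, (div_le_one h0).2 ht.2⟩, ?_⟩
    simp only [add_sub_cancel_left, smul_smul]
    rw [div_mul_cancel₀ _ h0.ne']
  · rcases hl0.eq_or_lt with h0 | h0
    · rw [ghD, ← hl, ← h0]; simp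
    · have : l⁻¹ • (φ x - x) = n := by
        rw [h1, add_sub_cancel_left, smul_smul, inv_mul_cancel₀ h0.ne', one_smul]
      rw [ghD, ← hl, this]

/-- The transferred datum is a line integral of a polynomial over paths of bounded length, whose
end points depend measurably on the point of the face. -/
lemma memLp_top_ghD (hd : 2 ≤ d) (hT : IsTriangulation T)
    (hφ : BijOn φ (frontier (compDomain T Ω)) (frontier Ω))
    (hφm : ∀ e : Face T Ω, e.IsBoundary → AEMeasurable φ ((surf d).restrict e.1))
    (hΓD : ∀ e ∈ ΓD, e.IsBoundary) (hnormal : NormalPaths T Ω Kext φ ΓD) (hτ : 0 < τ)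
    (hH : HBound T Ω Kext τ a) (σ : ZZSpace T Ω k) {K : Cells T Ω} {i : Fin (d + 1)}
    (he : faceOf T Ω K i ∈ ΓD) :
    MemLp (ghD φ σ K) ⊤ ((surf d).restrict (faceSet T Ω K i)) := by
  set n := normal T Ω K i with hn
  have hae : ∀ᵐ x ∂((surf d).restrict (faceSet T Ω K i)), x ∈ ((T K.1).faceOpposite i).interior :=
    ae_mem_face_interior (T K.1) hd i
  have hc := continuous_line_integral (σ K) n
  have hdm : AEMeasurable (fun x => (x, dist x (φ x))) ((surf d).restrict (faceSet T Ω K i)) :=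
    aemeasurable_id.prodMk (aemeasurable_id.dist (hφm _ (hΓD _ he)))
  have heq : ghD φ σ K =ᵐ[(surf d).restrict (faceSet T Ω K i)] fun x =>
      ∫ t in (0 : ℝ)..dist x (φ x), evMatVec (σ K) (x + t • n) n := by
    filter_upwards [hae] with x hx
    exact (dirichlet_path hT hφ hΓD hnormal hτ hH σ he hx).2.2.2
  have hcomp : IsCompact (faceSet T Ω K i ×ˢ Icc (0 : ℝ) (1 / (4 * τ))) :=
    ((T K.1).faceOpposite i).isCompact_closedInterior.prod isCompact_Icc
  obtain ⟨C, hC⟩ := hcomp.exists_bound_of_continuousOn hc.continuousOn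
  refine MemLp.ae_eq heq.symm (memLp_top_of_bound ?_ C ?_)
  · exact (hc.measurable.comp_aemeasurable hdm).aestronglyMeasurable
  · filter_upwards [hae] with x hx
    refine hC (x, dist x (φ x)) ⟨((T K.1).faceOpposite i).interior_subset_closedInterior hx,
      dist_nonneg, ?_⟩
    rw [le_div_iff₀ (by positivity)]
    linarith [(dirichlet_path hT hφ hΓD hnormal hτ hH σ he hx).2.1]

/-- The terms of the energy identity that contain the transferred datum, on a Dirichlet face, are
bounded by a small multiple of the norm of the flux on the cell: `transfer_pointwise` is integrated
over the face, the transfer paths sweep out a part of the extension patch, and the proximity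
condition brings the integral back to the cell. -/
lemma dirichlet_face_estimate (hd : 2 ≤ d) (hT : IsTriangulation T)
    (hφ : BijOn φ (frontier (compDomain T Ω)) (frontier Ω))
    (hΓD : ∀ e ∈ ΓD, e.IsBoundary) (hnormal : NormalPaths T Ω Kext φ ΓD) (hτ : 0 < τ)
    (hH : HBound T Ω Kext τ a) (hR : RBound T Ω Kext k)
    (hKext : IsExtensionPatch T Ω Kext) (σ : ZZSpace T Ω k)
    {K : Cells T Ω} {i : Fin (d + 1)} (he : faceOf T Ω K i ∈ ΓD) :
    ∫ x in faceSet T Ω K i, (τ / 2 * ‖ghD φ σ K x‖ ^ 2 -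
        inner ℝ (evMatVec (σ K) x (normal T Ω K i)) (ghD φ σ K x)) ∂(surf d) ≤
      1 / 7 * ∫ x in cell T Ω K, ‖evMatVec (σ K) x (normal T Ω K i)‖ ^ 2 := by
  set n := normal T Ω K i with hn
  set H := Hperp T Ω Kext K i with hHdef
  have hb := hΓD _ he
  obtain ⟨-, -, hHt⟩ := ratio_lt_and_Hperp_ne_top hR hb
  have hae : ∀ᵐ x ∂((surf d).restrict (faceSet T Ω K i)), x ∈ ((T K.1).faceOpposite i).interior :=
    ae_mem_face_interior (T K.1) hd i
  set G : Fin d → E d → ℝ≥0∞ := fun j x =>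
    ENNReal.ofReal (ev (dirDeriv n (dotPoly (σ K j) n)) x ^ 2) with hG
  have hGm : ∀ j, Measurable (G j) := fun j =>
    ((continuous_ev _).pow 2).measurable.ennreal_ofReal
  have hpt : ∀ᵐ x ∂((surf d).restrict (faceSet T Ω K i)),
      ENNReal.ofReal (τ / 2 * ‖ghD φ σ K x‖ ^ 2 -
        inner ℝ (evMatVec (σ K) x n) (ghD φ σ K x)) ≤
      ENNReal.ofReal (2 / 7) * H ^ 2 *
        ∫⁻ t in Icc 0 (dist x (φ x)), ∑ j, G j (x + t • n) := by
    filter_upwards [hae] with x hx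
    obtain ⟨h1, h2, -, h4⟩ := dirichlet_path hT hφ hΓD hnormal hτ hH σ he hx
    set l := dist x (φ x)
    have hl : 0 ≤ l := dist_nonneg
    have hQ : ∀ j, ENNReal.ofReal (∫ t in (0 : ℝ)..l,
        ev (dirDeriv n (dotPoly (σ K j) n)) (x + t • n) ^ 2) =
        ∫⁻ t in Icc 0 l, G j (x + t • n) := by
      intro j
      rw [intervalIntegral.integral_of_le hl, ← integral_Icc_eq_integral_Ioc,
        ofReal_integral_eq_lintegral_ofReal]
      · exact Continuous.integrableOn_Icc (by fun_prop)
      · exact Eventually.of_forall fun t => sq_nonneg _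
    have hsum : τ / 2 * ‖ghD φ σ K x‖ ^ 2 - inner ℝ (evMatVec (σ K) x n) (ghD φ σ K x) ≤
        2 / 7 * l ^ 2 * ∑ j, ∫ t in (0 : ℝ)..l,
          ev (dirDeriv n (dotPoly (σ K j) n)) (x + t • n) ^ 2 := by
      rw [EuclideanSpace.real_norm_sq_eq, inner_eq_sum, Finset.mul_sum, Finset.mul_sum,
        ← Finset.sum_sub_distrib, h4]
      refine Finset.sum_le_sum fun j _ => ?_
      rw [line_integral_apply, evMatVec_apply, mul_assoc]
      exact transfer_pointwise (dotPoly (σ K j) n) x n hl h2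
    refine (ENNReal.ofReal_le_ofReal hsum).trans ?_
    rw [ENNReal.ofReal_mul (by positivity), ENNReal.ofReal_mul (by positivity),
      ENNReal.ofReal_sum_of_nonneg]
    · simp only [hQ]
      have hGx : ∀ j, Measurable fun t : ℝ => G j (x + t • n) := fun j =>
        (hGm j).comp (by fun_prop : Measurable fun t : ℝ => x + t • n)
      rw [ENNReal.ofReal_pow hl, lintegral_finsetSum _ fun j _ => hGx j]
      gcongr
    · exact fun j _ => intervalIntegral.integral_nonneg hl fun t _ => sq_nonneg _
  have hle : ∫⁻ x in faceSet T Ω K i, ENNReal.ofReal (τ / 2 * ‖ghD φ σ K x‖ ^ 2 -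
        inner ℝ (evMatVec (σ K) x n) (ghD φ σ K x)) ∂(surf d) ≤
      ENNReal.ofReal (1 / 7) * ∫⁻ x in cell T Ω K,
        ENNReal.ofReal (‖evMatVec (σ K) x n‖ ^ 2) := by
    calc _ ≤ ∫⁻ x in faceSet T Ω K i, ENNReal.ofReal (2 / 7) * H ^ 2 *
          (∫⁻ t in Icc 0 (dist x (φ x)), ∑ j, G j (x + t • n)) ∂(surf d) := lintegral_mono_ae hpt
      _ = ENNReal.ofReal (2 / 7) * H ^ 2 * ∫⁻ x in faceSet T Ω K i,
          (∫⁻ t in Icc 0 (dist x (φ x)), ∑ j, G j (x + t • n)) ∂(surf d) :=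
        lintegral_const_mul' _ _ (ENNReal.mul_ne_top ENNReal.ofReal_ne_top (ENNReal.pow_ne_top hHt))
      _ ≤ ENNReal.ofReal (2 / 7) * H ^ 2 *
          ∫⁻ x in Kext (faceOf T Ω K i), ∑ j, G j x := by
        refine mul_le_mul_right ?_ _
        refine lintegral_normal_segments_le (T K.1) i (hKext.measurable _ hb)
          (Finset.measurable_fun_sum _ fun j _ => hGm j) ?_
        filter_upwards [hae] with x hx
        exact (dirichlet_path hT hφ hΓD hnormal hτ hH σ he hx).2.2.1
      _ = ENNReal.ofReal (2 / 7) * ∑ j, H ^ 2 * ∫⁻ x in Kext (faceOf T Ω K i), G j x := by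
        rw [lintegral_finsetSum _ fun j _ => hGm j, mul_assoc, Finset.mul_sum]
      _ ≤ ENNReal.ofReal (2 / 7) * ∑ j, 2⁻¹ * ∫⁻ x in cell T Ω K,
          ENNReal.ofReal (ev (dotPoly (σ K j) n) x ^ 2) := by
        refine mul_le_mul_right (Finset.sum_le_sum fun j _ => ?_) _
        exact lintegral_ext_dirDeriv_le hR hb (dotPoly_mem _ _)
      _ = ENNReal.ofReal (1 / 7) * ∫⁻ x in cell T Ω K,
          ENNReal.ofReal (‖evMatVec (σ K) x n‖ ^ 2) := by
        have hm : ∀ j, Measurable fun x => ENNReal.ofReal (ev (dotPoly (σ K j) n) x ^ 2) :=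
          fun j => ((continuous_ev _).pow 2).measurable.ennreal_ofReal
        rw [← Finset.mul_sum, ← mul_assoc, ← lintegral_finsetSum _ fun j _ => hm j]
        congr 1
        · rw [show (2⁻¹ : ℝ≥0∞) = ENNReal.ofReal 2⁻¹ by
            rw [ENNReal.ofReal_inv_of_pos two_pos]; norm_num, ← ENNReal.ofReal_mul (by norm_num)]
          norm_num
        · refine lintegral_congr fun x => ?_
          rw [EuclideanSpace.real_norm_sq_eq, ENNReal.ofReal_sum_of_nonneg fun _ _ => sq_nonneg _]
          simp only [evMatVec_apply]
  refine (integral_le_toReal_lintegral _).trans ?_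
  have hint : IntegrableOn (fun x => ‖evMatVec (σ K) x n‖ ^ 2) (cell T Ω K) :=
    Continuous.continuousOn (by fun_prop) |>.integrableOn_compact
      (T K.1).isCompact_closedInterior
  rw [← ofReal_integral_eq_lintegral_ofReal hint (Eventually.of_forall fun x => sq_nonneg _),
    ← ENNReal.ofReal_mul (by norm_num)] at hle
  refine ENNReal.toReal_le_of_le_ofReal ?_ hle
  exact mul_nonneg (by norm_num) (integral_nonneg fun x => sq_nonneg _)

end Dirichlet

/-! ### The scheme as a linear system -/

section LinearSystem

variable {d k : ℕ}

lemma evVec_comb (c : ℝ) (p q : Fin d → Pk d k) (x : E d) :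
    evVec (c • p + q) x = c • evVec p x + evVec q x := by
  ext i
  simp [evVec, ev_add, ev_smul]

lemma evMatVec_comb (c : ℝ) (p q : Fin d → Fin d → Pk d k) (x v : E d) :
    evMatVec (c • p + q) x v = c • evMatVec p x v + evMatVec q x v := by
  ext i
  simp [evMatVec, ev_add, ev_smul, add_mul, Finset.sum_add_distrib, Finset.mul_sum, mul_assoc]

lemma evDiv_comb (c : ℝ) (p q : Fin d → Fin d → Pk d k) (x : E d) :
    evDiv (c • p + q) x = c • evDiv p x + evDiv q x := by
  ext i
  simp [evDiv, ev_add, ev_smul, Finset.sum_add_distrib, Finset.mul_sum]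

variable {ι : Type} {T : ι → Affine.Simplex ℝ (E d) d} {Ω : Set (E d)}

lemma ghD_comb (φ : E d → E d) (c : ℝ) (σ σ' : ZZSpace T Ω k) (K : Cells T Ω) (x : E d) :
    ghD φ (c • σ + σ') K x = c • ghD φ σ K x + ghD φ σ' K x := by
  have hc : ∀ (σ : Fin d → Fin d → Pk d k) (v : E d),
      Continuous fun t : ℝ => evMatVec σ (x + t • v) v := fun σ v =>
    (continuous_evMatVec σ v).comp (g := fun x => evMatVec σ x v) (f := fun t : ℝ => x + t • v)
      (by fun_prop)
  simp only [ghD, Pi.add_apply, Pi.smul_apply]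
  rw [← intervalIntegral.integral_smul, ← intervalIntegral.integral_add]
  · exact intervalIntegral.integral_congr fun t _ => evMatVec_comb _ _ _ _ _
  · exact ((hc _ _).const_smul c).intervalIntegrable _ _
  · exact (hc _ _).intervalIntegrable _ _

variable [NeZero d]

lemma evM_comb (c : ℝ) (μ η : MSpace T Ω k) (e : Face T Ω) (x : E d) :
    evM (c • μ + η) e x = c • evM μ e x + evM η e x := by
  ext i
  simp [evM]

lemma flux_comb (τ c : ℝ) (σ σ' : ZZSpace T Ω k) (V V' : WSpace T Ω k) (U U' : MSpace T Ω k)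
    (K : Cells T Ω) (i : Fin (d + 1)) (x : E d) :
    flux τ (c • σ + σ') (c • V + V') (c • U + U') K i x =
      c • flux τ σ V U K i x + flux τ σ' V' U' K i x := by
  have h1 := evMatVec_comb c (σ K) (σ' K) x (normal T Ω K i)
  have h2 := evVec_comb c (V K) (V' K) x
  simp only [flux, evM_comb, Pi.add_apply, Pi.smul_apply] at *
  rw [h1, h2]
  module

lemma continuousOn_flux (τ : ℝ) (σ : ZZSpace T Ω k) (V : WSpace T Ω k) (U : MSpace T Ω k)
    (K : Cells T Ω) (i : Fin (d + 1)) : ContinuousOn (flux τ σ V U K i) (faceSet T Ω K i) := by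
  have h := continuousOn_evM U (faceOf T Ω K i)
  have h1 := (continuous_evMatVec (σ K) (normal T Ω K i)).continuousOn (s := faceSet T Ω K i)
  have h2 := (continuous_evVec (V K)).continuousOn (s := faceSet T Ω K i)
  exact h1.add ((h2.sub h).const_smul τ)

/-- The space of triples `(σ, V, Vhat)`. -/
abbrev Triple (T : ι → Affine.Simplex ℝ (E d) d) (Ω : Set (E d)) (k : ℕ) : Type :=
  ZZSpace T Ω k × WSpace T Ω k × MSpace T Ω k

/-- The integrand over a cell of the bilinear form of the scheme. -/
noncomputable def cellIntegrand (s t : Triple T Ω k) (K : Cells T Ω) (x : E d) : ℝ :=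
  (∑ i, ∑ j, ev (s.1 K i j).1 x * ev (t.1 K i j).1 x) -
    inner ℝ (evVec (s.2.1 K) x) (evDiv (t.1 K) x) -
    ∑ i, ∑ j, ev (s.1 K i j).1 x * ev (MvPolynomial.pderiv j (t.2.1 K i).1) x

open Classical in
/-- The residual on a face: the transmission or Neumann condition, or the Dirichlet condition. -/
noncomputable def faceResidual (φ : E d → E d) (ΓD : Set (Face T Ω)) (τ : ℝ) (s : Triple T Ω k)
    (K : Cells T Ω) (i : Fin (d + 1)) (x : E d) : E d :=
  if faceOf T Ω K i ∈ ΓD then evM s.2.2 (faceOf T Ω K i) x - ghD φ s.1 K x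
  else flux τ s.1 s.2.1 s.2.2 K i x

/-- The integrand over a face of the bilinear form of the scheme. -/
noncomputable def faceIntegrand (φ : E d → E d) (ΓD : Set (Face T Ω)) (τ : ℝ) (s t : Triple T Ω k)
    (K : Cells T Ω) (i : Fin (d + 1)) (x : E d) : ℝ :=
  inner ℝ (evM s.2.2 (faceOf T Ω K i) x) (evMatVec (t.1 K) x (normal T Ω K i)) +
    inner ℝ (flux τ s.1 s.2.1 s.2.2 K i x) (evVec (t.2.1 K) x) +
    inner ℝ (faceResidual φ ΓD τ s K i x) (evM t.2.2 (faceOf T Ω K i) x)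

lemma cellIntegrand_comb_left (c : ℝ) (s s' t : Triple T Ω k) (K : Cells T Ω) (x : E d) :
    cellIntegrand (c • s + s') t K x = c * cellIntegrand s t K x + cellIntegrand s' t K x := by
  have h := evVec_comb c (s.2.1 K) (s'.2.1 K) x
  simp only [cellIntegrand, Prod.fst_add, Prod.snd_add, Prod.smul_fst, Prod.smul_snd, Pi.add_apply,
    Pi.smul_apply, Submodule.coe_add, Submodule.coe_smul, ev_add, ev_smul] at h ⊢
  rw [h, inner_add_left, real_inner_smul_left]
  simp only [add_mul, Finset.sum_add_distrib, mul_assoc, ← Finset.mul_sum]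
  ring

lemma cellIntegrand_comb_right (c : ℝ) (s t t' : Triple T Ω k) (K : Cells T Ω) (x : E d) :
    cellIntegrand s (c • t + t') K x = c * cellIntegrand s t K x + cellIntegrand s t' K x := by
  have h := evDiv_comb c (t.1 K) (t'.1 K) x
  simp only [cellIntegrand, Prod.fst_add, Prod.snd_add, Prod.smul_fst, Prod.smul_snd, Pi.add_apply,
    Pi.smul_apply, Submodule.coe_add, Submodule.coe_smul, ev_add, ev_smul, map_add,
    Derivation.map_smul] at h ⊢
  rw [h, inner_add_right, real_inner_smul_right]
  simp only [mul_add, Finset.sum_add_distrib, mul_left_comm _ c, ← Finset.mul_sum]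
  ring

lemma faceResidual_comb (φ : E d → E d) (ΓD : Set (Face T Ω)) (τ c : ℝ) (s s' : Triple T Ω k)
    (K : Cells T Ω) (i : Fin (d + 1)) (x : E d) :
    faceResidual φ ΓD τ (c • s + s') K i x =
      c • faceResidual φ ΓD τ s K i x + faceResidual φ ΓD τ s' K i x := by
  simp only [faceResidual, Prod.fst_add, Prod.snd_add, Prod.smul_fst, Prod.smul_snd, evM_comb,
    ghD_comb, flux_comb]
  split_ifs <;> module

lemma faceIntegrand_comb_left (φ : E d → E d) (ΓD : Set (Face T Ω)) (τ c : ℝ)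
    (s s' t : Triple T Ω k) (K : Cells T Ω) (i : Fin (d + 1)) (x : E d) :
    faceIntegrand φ ΓD τ (c • s + s') t K i x =
      c * faceIntegrand φ ΓD τ s t K i x + faceIntegrand φ ΓD τ s' t K i x := by
  simp only [faceIntegrand, faceResidual_comb]
  simp only [Prod.fst_add, Prod.snd_add, Prod.smul_fst, Prod.smul_snd, evM_comb, flux_comb,
    inner_add_left, real_inner_smul_left]
  ring

lemma faceIntegrand_comb_right (φ : E d → E d) (ΓD : Set (Face T Ω)) (τ c : ℝ)
    (s t t' : Triple T Ω k) (K : Cells T Ω) (i : Fin (d + 1)) (x : E d) :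
    faceIntegrand φ ΓD τ s (c • t + t') K i x =
      c * faceIntegrand φ ΓD τ s t K i x + faceIntegrand φ ΓD τ s t' K i x := by
  have h1 := evMatVec_comb c (t.1 K) (t'.1 K) x (normal T Ω K i)
  have h2 := evVec_comb c (t.2.1 K) (t'.2.1 K) x
  simp only [faceIntegrand, Prod.fst_add, Prod.snd_add, Prod.smul_fst, Prod.smul_snd, evM_comb,
    Pi.add_apply, Pi.smul_apply] at *
  rw [h1, h2]
  simp only [inner_add_right, real_inner_smul_right]
  ring

lemma integrableOn_cellIntegrand (s t : Triple T Ω k) (K : Cells T Ω) :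
    IntegrableOn (cellIntegrand s t K) (cell T Ω K) := by
  refine Continuous.continuousOn ?_ |>.integrableOn_compact (T K.1).isCompact_closedInterior
  unfold cellIntegrand
  fun_prop

/-- The transferred datum is bounded and measurable on every Dirichlet face. -/
def BoundedDatum (φ : E d → E d) (ΓD : Set (Face T Ω)) (k : ℕ) : Prop :=
  ∀ (σ : ZZSpace T Ω k) (K : Cells T Ω) (i : Fin (d + 1)), faceOf T Ω K i ∈ ΓD →
    MemLp (ghD φ σ K) ⊤ ((surf d).restrict (faceSet T Ω K i))

variable {φ : E d → E d} {ΓD : Set (Face T Ω)} {τ : ℝ}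

lemma memLp_faceResidual (hg : BoundedDatum φ ΓD k) (s : Triple T Ω k) (K : Cells T Ω)
    (i : Fin (d + 1)) :
    MemLp (faceResidual φ ΓD τ s K i) ⊤ ((surf d).restrict (faceSet T Ω K i)) := by
  by_cases h : faceOf T Ω K i ∈ ΓD
  · have e : faceResidual φ ΓD τ s K i = fun x =>
        evM s.2.2 (faceOf T Ω K i) x - ghD φ s.1 K x := by
      ext1 x; simp only [faceResidual, if_pos h]
    rw [e]
    exact (memLp_top_face (T K.1) i (continuousOn_evM s.2.2 (faceOf T Ω K i))).sub (hg s.1 K i h)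
  · have e : faceResidual φ ΓD τ s K i = flux τ s.1 s.2.1 s.2.2 K i := by
      ext1 x; simp only [faceResidual, if_neg h]
    rw [e]
    exact memLp_top_face (T K.1) i (continuousOn_flux τ s.1 s.2.1 s.2.2 K i)

lemma integrable_inner_face {K : Cells T Ω} {i : Fin (d + 1)} {f g : E d → E d}
    (hf : MemLp f ⊤ ((surf d).restrict (faceSet T Ω K i)))
    (hg : ContinuousOn g (faceSet T Ω K i)) :
    IntegrableOn (fun x => inner ℝ (f x) (g x)) (faceSet T Ω K i) (surf d) := by
  have : IsFiniteMeasure ((surf d).restrict (faceSet T Ω K i)) := isFiniteMeasure_face (T K.1) i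
  exact integrable_inner_of_memLp_top (hf.integrable le_top) (memLp_top_face (T K.1) i hg)

lemma integrableOn_faceIntegrand (hg : BoundedDatum φ ΓD k) (s t : Triple T Ω k) (K : Cells T Ω)
    (i : Fin (d + 1)) :
    IntegrableOn (faceIntegrand φ ΓD τ s t K i) (faceSet T Ω K i) (surf d) := by
  refine (Integrable.add ?_ ?_).add ?_
  · exact integrable_inner_face
      (memLp_top_face (T K.1) i (continuousOn_evM s.2.2 (faceOf T Ω K i)))
      (continuous_evMatVec _ _).continuousOn
  · exact integrable_inner_face
      (memLp_top_face (T K.1) i (continuousOn_flux τ s.1 s.2.1 s.2.2 K i))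
      (continuous_evVec _).continuousOn
  · exact integrable_inner_face (memLp_faceResidual hg s K i)
      (continuousOn_evM t.2.2 (faceOf T Ω K i))

lemma integral_comb {α : Type*} [MeasurableSpace α] {μ : Measure α} {f g h : α → ℝ} {c : ℝ}
    (hf : Integrable f μ) (hg : Integrable g μ) (e : ∀ x, h x = c * f x + g x) :
    ∫ x, h x ∂μ = c * ∫ x, f x ∂μ + ∫ x, g x ∂μ := by
  simp only [e]
  rw [integral_add (hf.const_mul c) hg, integral_const_mul]

variable [Finite ι]

/-- The bilinear form of the scheme: the sum of the left-hand sides of its five equations, with the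
unknown `ghD` of the Dirichlet condition moved to the left. -/
noncomputable def schemeForm (φ : E d → E d) (ΓD : Set (Face T Ω)) (τ : ℝ)
    (s t : Triple T Ω k) : ℝ :=
  (∑ K, ∫ x in cell T Ω K, cellIntegrand s t K x) +
    ∑ K, ∑ i, ∫ x in faceSet T Ω K i, faceIntegrand φ ΓD τ s t K i x ∂(surf d)

lemma schemeForm_comb_left (hg : BoundedDatum φ ΓD k) (c : ℝ) (s s' t : Triple T Ω k) :
    schemeForm φ ΓD τ (c • s + s') t =
      c * schemeForm φ ΓD τ s t + schemeForm φ ΓD τ s' t := by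
  have h1 := fun K => integral_comb (integrableOn_cellIntegrand s t K)
    (integrableOn_cellIntegrand s' t K) (cellIntegrand_comb_left c s s' t K)
  have h2 := fun K i => integral_comb (integrableOn_faceIntegrand (τ := τ) hg s t K i)
    (integrableOn_faceIntegrand hg s' t K i) (faceIntegrand_comb_left φ ΓD τ c s s' t K i)
  simp only [schemeForm, h1, h2, Finset.sum_add_distrib, ← Finset.mul_sum]
  ring

lemma schemeForm_comb_right (hg : BoundedDatum φ ΓD k) (c : ℝ) (s t t' : Triple T Ω k) :
    schemeForm φ ΓD τ s (c • t + t') =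
      c * schemeForm φ ΓD τ s t + schemeForm φ ΓD τ s t' := by
  have h1 := fun K => integral_comb (integrableOn_cellIntegrand s t K)
    (integrableOn_cellIntegrand s t' K) (cellIntegrand_comb_right c s t t' K)
  have h2 := fun K i => integral_comb (integrableOn_faceIntegrand (τ := τ) hg s t K i)
    (integrableOn_faceIntegrand hg s t' K i) (faceIntegrand_comb_right φ ΓD τ c s t t' K i)
  simp only [schemeForm, h1, h2, Finset.sum_add_distrib, ← Finset.mul_sum]
  ring

lemma isLinearMap_of_comb {X : Type*} [AddCommGroup X] [Module ℝ X] {f : X → ℝ}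
    (h : ∀ (c : ℝ) (s t : X), f (c • s + t) = c * f s + f t) : IsLinearMap ℝ f := by
  have h0 : f 0 = 0 := by simpa using h 1 0 0
  exact ⟨fun s t => by simpa using h 1 s t, fun c s => by simpa [h0] using h c s 0⟩

/-- The bilinear form of the scheme as a linear map into the dual space. Without the bound on the
transferred datum the face integrals could be junk values and additivity could fail. -/
noncomputable def schemeMap (hg : BoundedDatum φ ΓD k) (τ : ℝ) :
    Triple T Ω k →ₗ[ℝ] Triple T Ω k →ₗ[ℝ] ℝ :=
  LinearMap.mk₂ ℝ (schemeForm φ ΓD τ)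
    (fun s s' t => (isLinearMap_of_comb (f := fun s => schemeForm φ ΓD τ s t)
      fun c s s' => schemeForm_comb_left hg c s s' t).map_add s s')
    (fun c s t => (isLinearMap_of_comb (f := fun s => schemeForm φ ΓD τ s t)
      fun c s s' => schemeForm_comb_left hg c s s' t).map_smul c s)
    (fun s t t' => (isLinearMap_of_comb (fun c t t' => schemeForm_comb_right hg c s t t')).map_add
      t t')
    (fun c s t => (isLinearMap_of_comb (fun c t t' => schemeForm_comb_right hg c s t t')).map_smul
      c t)

end LinearSystem

/-! ### Testing with one component at a time -/

section Tests

variable {d k : ℕ} {ι : Type} {T : ι → Affine.Simplex ℝ (E d) d} {Ω : Set (E d)}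

lemma evVec_zero (x : E d) : evVec (0 : Fin d → Pk d k) x = 0 := by
  ext i; simp [evVec, ev_zero]

lemma evMatVec_zero (x v : E d) : evMatVec (0 : Fin d → Fin d → Pk d k) x v = 0 := by
  ext i; simp [evMatVec, ev_zero]

lemma evDiv_zero (x : E d) : evDiv (0 : Fin d → Fin d → Pk d k) x = 0 := by
  ext i; simp [evDiv, ev_zero]

lemma ghD_zero (φ : E d → E d) (K : Cells T Ω) (x : E d) :
    ghD φ (0 : ZZSpace T Ω k) K x = 0 := by
  simp [ghD, evMatVec_zero]

variable [NeZero d]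

lemma evM_zero (e : Face T Ω) (x : E d) : evM (0 : MSpace T Ω k) e x = 0 := by
  ext i; simp [evM]

open Classical in
/-- The restriction of an element of `M_h` to the faces that satisfy `P`. -/
noncomputable def maskM (P : Face T Ω → Prop) (μ : MSpace T Ω k) : MSpace T Ω k :=
  fun e => if P e then μ e else 0

lemma evM_maskM_of_pos {P : Face T Ω → Prop} (μ : MSpace T Ω k) {e : Face T Ω} (h : P e) (x : E d) :
    evM (maskM P μ) e x = evM μ e x := by
  simp [evM, maskM, h]

lemma evM_maskM_of_neg {P : Face T Ω → Prop} (μ : MSpace T Ω k) {e : Face T Ω} (h : ¬ P e)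
    (x : E d) : evM (maskM P μ) e x = 0 := by
  ext i; simp [evM, maskM, h]

variable [Finite ι] {φ : E d → E d} {ΓD : Set (Face T Ω)} {τ : ℝ}

lemma faceSum_maskM (P Q : Face T Ω → Prop) (f : Cells T Ω → Fin (d + 1) → E d → E d)
    (μ : MSpace T Ω k) :
    faceSum T Ω Q (fun K i x => inner ℝ (f K i x) (evM (maskM P μ) (faceOf T Ω K i) x)) =
      faceSum T Ω (fun e => Q e ∧ P e)
        (fun K i x => inner ℝ (f K i x) (evM μ (faceOf T Ω K i) x)) := by
  classical
  refine Finset.sum_congr rfl fun K _ => Finset.sum_congr rfl fun i _ => ?_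
  by_cases hQ : Q (faceOf T Ω K i) <;> by_cases hP : P (faceOf T Ω K i) <;>
    simp [hQ, hP, evM_maskM_of_pos, evM_maskM_of_neg]

lemma faceSum_congr_pred {P Q : Face T Ω → Prop} (h : ∀ e, P e ↔ Q e)
    (f : Cells T Ω → Fin (d + 1) → E d → ℝ) : faceSum T Ω P f = faceSum T Ω Q f := by
  rw [funext fun e => propext (h e)]

lemma faceSum_eq_zero {P : Face T Ω → Prop} (h : ∀ e, ¬ P e)
    (f : Cells T Ω → Fin (d + 1) → E d → ℝ) : faceSum T Ω P f = 0 := by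
  simp [faceSum, h]

lemma schemeForm_test_a (s : Triple T Ω k) (ψ : ZZSpace T Ω k) :
    schemeForm φ ΓD τ s (ψ, 0, 0) =
    (∑ K : Cells T Ω, ∫ x in cell T Ω K, ∑ i, ∑ j, ev (s.1 K i j).1 x * ev (ψ K i j).1 x) -
      (∑ K : Cells T Ω, ∫ x in cell T Ω K, inner ℝ (evVec (s.2.1 K) x) (evDiv (ψ K) x)) +
      faceSum T Ω (fun _ => True) (fun K i x =>
        inner ℝ (evM s.2.2 (faceOf T Ω K i) x) (evMatVec (ψ K) x (normal T Ω K i))) := by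
  simp only [schemeForm, cellIntegrand, faceIntegrand, faceSum, Pi.zero_apply, evVec_zero, evM_zero,
    inner_zero_right, add_zero, if_true, Submodule.coe_zero, map_zero, ev_zero, mul_zero,
    Finset.sum_const_zero, sub_zero, ← Finset.sum_sub_distrib]
  congr 1
  refine Finset.sum_congr rfl fun K _ => integral_sub ?_ ?_
  · exact Continuous.continuousOn (by fun_prop) |>.integrableOn_compact
      (T K.1).isCompact_closedInterior
  · exact Continuous.continuousOn (by fun_prop) |>.integrableOn_compact
      (T K.1).isCompact_closedInterior

lemma schemeForm_test_b (s : Triple T Ω k) (w : WSpace T Ω k) :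
    schemeForm φ ΓD τ s (0, w, 0) =
    -(∑ K : Cells T Ω, ∫ x in cell T Ω K,
        ∑ i, ∑ j, ev (s.1 K i j).1 x * ev (MvPolynomial.pderiv j (w K i).1) x) +
      faceSum T Ω (fun _ => True) (fun K i x =>
        inner ℝ (flux τ s.1 s.2.1 s.2.2 K i x) (evVec (w K) x)) := by
  simp only [schemeForm, cellIntegrand, faceIntegrand, faceSum, Pi.zero_apply, evMatVec_zero,
    evM_zero, evDiv_zero, inner_zero_right, add_zero, zero_add, if_true, Submodule.coe_zero,
    ev_zero, mul_zero, Finset.sum_const_zero, sub_zero, zero_sub, integral_neg,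
    Finset.sum_neg_distrib]

lemma schemeForm_test_c (hg : BoundedDatum φ ΓD k) (hΓD : ∀ e ∈ ΓD, e.IsBoundary)
    (s : Triple T Ω k) (μ : MSpace T Ω k) :
    schemeForm φ ΓD τ s (0, 0, μ) =
      faceSum T Ω (fun e => ¬ e.IsBoundary) (fun K i x =>
        inner ℝ (flux τ s.1 s.2.1 s.2.2 K i x) (evM μ (faceOf T Ω K i) x)) +
      faceSum T Ω (fun e => e.IsBoundary ∧ e ∉ ΓD) (fun K i x =>
        inner ℝ (flux τ s.1 s.2.1 s.2.2 K i x) (evM μ (faceOf T Ω K i) x)) +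
      (faceSum T Ω (fun e => e ∈ ΓD) (fun K i x =>
        inner ℝ (evM s.2.2 (faceOf T Ω K i) x) (evM μ (faceOf T Ω K i) x)) -
      faceSum T Ω (fun e => e ∈ ΓD) (fun K i x =>
        inner ℝ (ghD φ s.1 K x) (evM μ (faceOf T Ω K i) x))) := by
  classical
  simp only [schemeForm, cellIntegrand, faceIntegrand, faceSum, Pi.zero_apply, evMatVec_zero,
    evVec_zero, evDiv_zero, inner_zero_right, zero_add, Submodule.coe_zero, map_zero,
    ev_zero, mul_zero, Finset.sum_const_zero, sub_zero, integral_zero,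
    ← Finset.sum_sub_distrib, ← Finset.sum_add_distrib]
  refine Finset.sum_congr rfl fun K _ => Finset.sum_congr rfl fun i _ => ?_
  by_cases hD : faceOf T Ω K i ∈ ΓD
  · have hb := hΓD _ hD
    simp only [faceResidual, hD, hb, if_true, not_true_eq_false, if_false, and_false, add_zero,
      inner_sub_left, zero_add]
    refine integral_sub ?_ ?_
    · exact integrable_inner_face (memLp_top_face (T K.1) i (continuousOn_evM s.2.2 _))
        (continuousOn_evM μ (faceOf T Ω K i))
    · exact integrable_inner_face (hg s.1 K i hD) (continuousOn_evM μ (faceOf T Ω K i))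
  · by_cases hb : (faceOf T Ω K i).IsBoundary <;> simp [faceResidual, hD, hb]

variable {a gΓ ytΓ : E d → ℝ} {DgΓ n : E d → E d} {ph rh : ZSpace T Ω k}

/-- The scheme is the linear system given by the bilinear form `schemeForm` and the functional of
the Neumann data. -/
lemma isSolution_iff (hg : BoundedDatum φ ΓD k) (hΓD : ∀ e ∈ ΓD, e.IsBoundary)
    (s : Triple T Ω k) :
    IsSolution T Ω k φ ΓD τ a gΓ ytΓ DgΓ n ph rh s.1 s.2.1 s.2.2 ↔
      ∀ t : Triple T Ω k, schemeForm φ ΓD τ s t =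
        faceSum T Ω (fun e => e.IsBoundary ∧ e ∉ ΓD) (fun K i x =>
          inner ℝ (Gh a gΓ ytΓ DgΓ n ph rh K (φ x) • n (φ x)) (evM t.2.2 (faceOf T Ω K i) x)) := by
  have hz : ∀ P : Face T Ω → Prop, faceSum T Ω P (fun K i x =>
      inner ℝ (Gh a gΓ ytΓ DgΓ n ph rh K (φ x) • n (φ x))
        (evM (0 : MSpace T Ω k) (faceOf T Ω K i) x)) = 0 := by
    intro P
    simp [faceSum, evM_zero]
  constructor
  · intro h t
    have e : t = (1 : ℝ) • (t.1, 0, 0) + ((1 : ℝ) • (0, t.2.1, 0) + (0, 0, t.2.2)) :=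
      Prod.ext (by simp) (Prod.ext (by simp) (by simp))
    conv_lhs => rw [e]
    rw [schemeForm_comb_right hg, schemeForm_comb_right hg, schemeForm_test_a, schemeForm_test_b,
      schemeForm_test_c hg hΓD, h.eq_a, h.eq_b, h.eq_c, h.eq_neumann, h.eq_dirichlet]
    ring
  · intro h
    have hc : ∀ μ : MSpace T Ω k, _ := fun μ => (schemeForm_test_c hg hΓD s μ).symm.trans
      (h (0, 0, μ))
    refine ⟨fun ψ => ?_, fun w => ?_, fun μ => ?_, fun μ => ?_, fun μ => ?_⟩
    · rw [← schemeForm_test_a, h]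
      exact hz _
    · rw [← schemeForm_test_b, h]
      exact hz _
    · have h1 := hc (maskM (fun e => ¬ e.IsBoundary) μ)
      simp only [faceSum_maskM] at h1
      rw [faceSum_congr_pred (fun e => and_self_iff),
        faceSum_eq_zero (P := fun e => (e.IsBoundary ∧ e ∉ ΓD) ∧ ¬ e.IsBoundary)
          (fun e h => h.2 h.1.1), faceSum_eq_zero (P := fun e => e ∈ ΓD ∧ ¬ e.IsBoundary)
          (fun e h => h.2 (hΓD e h.1)), faceSum_eq_zero (P := fun e => e ∈ ΓD ∧ ¬ e.IsBoundary)
          (fun e h => h.2 (hΓD e h.1)), faceSum_eq_zero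
          (P := fun e => (e.IsBoundary ∧ e ∉ ΓD) ∧ ¬ e.IsBoundary) (fun e h => h.2 h.1.1)] at h1
      simpa using h1
    · have h1 := hc (maskM (fun e => e.IsBoundary ∧ e ∉ ΓD) μ)
      simp only [faceSum_maskM] at h1
      simp only [and_self] at h1
      rw [faceSum_eq_zero (P := fun e => ¬ e.IsBoundary ∧ e.IsBoundary ∧ e ∉ ΓD)
          (fun e h => h.1 h.2.1), faceSum_eq_zero
          (P := fun e => e ∈ ΓD ∧ e.IsBoundary ∧ e ∉ ΓD) (fun e h => h.2.2 h.1),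
          faceSum_eq_zero
          (P := fun e => e ∈ ΓD ∧ e.IsBoundary ∧ e ∉ ΓD) (fun e h => h.2.2 h.1)] at h1
      simpa using h1
    · have h1 := hc (maskM (fun e => e ∈ ΓD) μ)
      simp only [faceSum_maskM] at h1
      simp only [and_self] at h1
      rw [faceSum_eq_zero (P := fun e => ¬ e.IsBoundary ∧ e ∈ ΓD)
          (fun e h => h.1 (hΓD e h.2)), faceSum_eq_zero
          (P := fun e => (e.IsBoundary ∧ e ∉ ΓD) ∧ e ∈ ΓD) (fun e h => h.1.2 h.2),
          faceSum_eq_zero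
          (P := fun e => (e.IsBoundary ∧ e ∉ ΓD) ∧ e ∈ ΓD) (fun e h => h.1.2 h.2)] at h1
      linarith

end Tests

/-! ### Integration by parts and the energy integrand -/

section Energy

variable {d k : ℕ} {ι : Type} {T : ι → Affine.Simplex ℝ (E d) d} {Ω : Set (E d)}

lemma integrableOn_cell_of_continuous {K : Cells T Ω} {f : E d → ℝ} (hf : Continuous f) :
    IntegrableOn f (cell T Ω K) :=
  hf.continuousOn.integrableOn_compact (T K.1).isCompact_closedInterior

/-- The pointwise squared Frobenius norm of a matrix of polynomials. -/
noncomputable def frobSq (σ : Fin d → Fin d → Pk d k) (x : E d) : ℝ :=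
  ∑ i, ∑ j, ev (σ i j).1 x * ev (σ i j).1 x

lemma frobSq_nonneg (σ : Fin d → Fin d → Pk d k) (x : E d) : 0 ≤ frobSq σ x :=
  Finset.sum_nonneg fun _ _ => Finset.sum_nonneg fun _ _ => mul_self_nonneg _

lemma continuous_frobSq (σ : Fin d → Fin d → Pk d k) : Continuous (frobSq σ) := by
  unfold frobSq; fun_prop

lemma norm_evMatVec_sq_le (σ : Fin d → Fin d → Pk d k) (x : E d) {v : E d} (hv : ‖v‖ = 1) :
    ‖evMatVec σ x v‖ ^ 2 ≤ frobSq σ x := by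
  rw [EuclideanSpace.real_norm_sq_eq]
  refine Finset.sum_le_sum fun i _ => ?_
  have h := Finset.sum_mul_sq_le_sq_mul_sq Finset.univ (fun j => ev (σ i j).1 x) (fun j => v j)
  have hv2 : ∑ j, v j ^ 2 = 1 := by rw [← EuclideanSpace.real_norm_sq_eq, hv]; norm_num
  rw [hv2, mul_one] at h
  simpa only [evMatVec, ← sq] using h

/-- A vector of polynomials with vanishing gradient is constant. -/
lemma evVec_const {V : Fin d → Pk d k} (h : ∀ i j, MvPolynomial.pderiv j (V i).1 = 0) (x y : E d) :
    evVec V x = evVec V y := by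
  ext i
  simp only [evVec_apply]
  refine is_const_of_fderiv_eq_zero ((contDiff_ev _).differentiable one_ne_zero) (fun z => ?_) x y
  ext v
  rw [fderiv_ev, ev_dirDeriv]
  simp [h, ev_zero]

/-- A matrix of polynomials of vanishing norm on a cell is zero. -/
lemma eq_zero_of_integral_frobSq {K : Cells T Ω} {σ : Fin d → Fin d → Pk d k}
    (h : ∫ x in cell T Ω K, frobSq σ x = 0) (i j : Fin d) : (σ i j).1 = 0 := by
  obtain ⟨hne, hcl⟩ := closure_interior_simplex (T K.1) (by simp)
  have h1 := (integral_eq_zero_iff_of_nonneg (frobSq_nonneg σ)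
    (integrableOn_cell_of_continuous (continuous_frobSq σ))).1 h
  have h2 := continuous_ae_zero hcl.ge (continuous_frobSq σ) h1
  refine eq_zero_of_ev_eq_zero hne fun x hx => ?_
  have h3 := h2 x hx
  rw [frobSq, Finset.sum_eq_zero_iff_of_nonneg
    fun _ _ => Finset.sum_nonneg fun _ _ => mul_self_nonneg _] at h3
  have h4 := h3 i (Finset.mem_univ i)
  rw [Finset.sum_eq_zero_iff_of_nonneg fun _ _ => mul_self_nonneg _] at h4
  exact mul_self_eq_zero.1 (h4 j (Finset.mem_univ j))

variable [NeZero d]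

lemma integrableOn_face_of_continuousOn {K : Cells T Ω} {i : Fin (d + 1)} {f : E d → ℝ}
    (hf : ContinuousOn f (faceSet T Ω K i)) : IntegrableOn f (faceSet T Ω K i) (surf d) := by
  have hm := ((T K.1).faceOpposite i).isClosed_closedInterior.measurableSet
  have : IsFiniteMeasure ((surf d).restrict (faceSet T Ω K i)) := isFiniteMeasure_face (T K.1) i
  obtain ⟨C, hC⟩ :=
    ((T K.1).faceOpposite i).isCompact_closedInterior.exists_bound_of_continuousOn hf
  exact Integrable.of_bound (hf.aestronglyMeasurable hm) C
    ((ae_restrict_iff' hm).2 (Eventually.of_forall hC))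

/-- Integration by parts on a cell, for a scalar polynomial and a coordinate direction. -/
lemma integral_cell_pderiv (K : Cells T Ω) (p : MvPolynomial (Fin d) ℝ) (j : Fin d) :
    ∫ x in cell T Ω K, ev (MvPolynomial.pderiv j p) x =
      ∑ i, ∫ x in faceSet T Ω K i, ev p x * normal T Ω K i j ∂(surf d) := by
  have h := integral_simplex_fderiv (T K.1) (contDiff_ev p) (EuclideanSpace.single j 1)
  simp only [fderiv_ev] at h
  have e : dirDeriv (EuclideanSpace.single j (1 : ℝ)) p = MvPolynomial.pderiv j p := by
    rw [dirDeriv, Finset.sum_eq_single j]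
    · simp
    · intro m _ hm; simp [hm]
    · simp
  rw [e] at h
  rw [cell, h]
  refine Finset.sum_congr rfl fun i _ => ?_
  rw [integral_mul_const, mul_comm, EuclideanSpace.inner_single_right]
  simp [faceSet, normal, outNormal]

/-- Integration by parts on a cell. -/
lemma integral_cell_by_parts (K : Cells T Ω) (V : Fin d → Pk d k) (σ : Fin d → Fin d → Pk d k) :
    ∫ x in cell T Ω K, (inner ℝ (evVec V x) (evDiv σ x) +
        ∑ i, ∑ j, ev (σ i j).1 x * ev (MvPolynomial.pderiv j (V i).1) x) =
      ∑ i, ∫ x in faceSet T Ω K i,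
        inner ℝ (evVec V x) (evMatVec σ x (normal T Ω K i)) ∂(surf d) := by
  have e1 : ∀ x, inner ℝ (evVec V x) (evDiv σ x) +
      ∑ i, ∑ j, ev (σ i j).1 x * ev (MvPolynomial.pderiv j (V i).1) x =
      ∑ i, ∑ j, ev (MvPolynomial.pderiv j ((V i).1 * (σ i j).1)) x := by
    intro x
    rw [inner_eq_sum, ← Finset.sum_add_distrib]
    refine Finset.sum_congr rfl fun i _ => ?_
    simp only [evVec, evDiv, Finset.mul_sum, ← Finset.sum_add_distrib]
    refine Finset.sum_congr rfl fun j _ => ?_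
    rw [MvPolynomial.pderiv_mul, ev_add, ev_mul, ev_mul]
    ring
  have e2 : ∀ m x, inner ℝ (evVec V x) (evMatVec σ x (normal T Ω K m)) =
      ∑ i, ∑ j, ev ((V i).1 * (σ i j).1) x * normal T Ω K m j := by
    intro m x
    rw [inner_eq_sum]
    refine Finset.sum_congr rfl fun i _ => ?_
    simp only [evVec, evMatVec, Finset.mul_sum]
    refine Finset.sum_congr rfl fun j _ => ?_
    rw [ev_mul]
    ring
  simp only [e1, e2]
  rw [integral_finsetSum _ fun i _ => integrableOn_cell_of_continuous (by fun_prop)]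
  have h1 : ∀ m, ∫ x in faceSet T Ω K m,
      (∑ i, ∑ j, ev ((V i).1 * (σ i j).1) x * normal T Ω K m j) ∂(surf d) =
      ∑ i, ∑ j, ∫ x in faceSet T Ω K m,
        ev ((V i).1 * (σ i j).1) x * normal T Ω K m j ∂(surf d) := by
    intro m
    rw [integral_finsetSum _ fun i _ => integrableOn_face_of_continuousOn
      (Continuous.continuousOn (by fun_prop))]
    refine Finset.sum_congr rfl fun i _ => ?_
    rw [integral_finsetSum _ fun j _ => integrableOn_face_of_continuousOn
      (Continuous.continuousOn (by fun_prop))]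
  simp only [h1]
  rw [Finset.sum_comm]
  refine Finset.sum_congr rfl fun i _ => ?_
  rw [integral_finsetSum _ fun j _ => integrableOn_cell_of_continuous (by fun_prop),
    Finset.sum_comm]
  exact Finset.sum_congr rfl fun j _ => integral_cell_pderiv K _ j

variable {φ : E d → E d} {ΓD : Set (Face T Ω)} {τ : ℝ}

open Classical in
/-- The last component of the test triple for the energy argument: `-Vhat` off the Dirichlet faces,
and `τ Vhat - σ n` on them. The cell `K` of a Dirichlet face is unique, so that `σ n` is a
polynomial on the face. -/
noncomputable def energyTest (ΓD : Set (Face T Ω)) (τ : ℝ) (s : Triple T Ω k) : MSpace T Ω k :=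
  fun e => if e ∈ ΓD then τ • s.2.2 e - faceRestrict e (fun j =>
    ⟨dotPoly (s.1 e.2.choose j) (normal T Ω e.2.choose e.2.choose_spec.choose), dotPoly_mem _ _⟩)
    else - s.2.2 e

lemma evM_energyTest_of_notMem (s : Triple T Ω k) {e : Face T Ω} (he : e ∉ ΓD) (x : E d) :
    evM (energyTest ΓD τ s) e x = - evM s.2.2 e x := by
  ext i
  simp [evM, energyTest, he]

lemma evM_energyTest_of_mem (hΓD : ∀ e ∈ ΓD, e.IsBoundary) (s : Triple T Ω k) {K : Cells T Ω}
    {i : Fin (d + 1)} (he : faceOf T Ω K i ∈ ΓD) {x : E d} (hx : x ∈ faceSet T Ω K i) :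
    evM (energyTest ΓD τ s) (faceOf T Ω K i) x =
      τ • evM s.2.2 (faceOf T Ω K i) x - evMatVec (s.1 K) x (normal T Ω K i) := by
  set e := faceOf T Ω K i with hedef
  have hspec : e = faceOf T Ω e.2.choose e.2.choose_spec.choose :=
    Subtype.ext e.2.choose_spec.choose_spec
  obtain ⟨hK, hi⟩ := isBoundary_faceOf_unique (hΓD _ he) hspec
  have h1 := faceRestrict_apply e (fun j => (⟨dotPoly (s.1 e.2.choose j)
    (normal T Ω e.2.choose e.2.choose_spec.choose), dotPoly_mem _ _⟩ : Pk d k)) hx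
  ext m
  have h2 := congrArg (fun y : E d => y m) h1
  simp only [evVec_apply] at h2
  simp only [evM, energyTest, he, if_true, PiLp.sub_apply, PiLp.smul_apply]
  rw [evMatVec_apply, Pi.sub_apply, Submodule.coe_sub, Pi.sub_apply, h2, Pi.smul_apply,
    Submodule.coe_smul, Pi.smul_apply]
  rw [← hi, ← hK]

open Classical in
/-- The pointwise lower bound for the integrand over the faces in the energy argument. On a
Dirichlet face the two sides differ by `τ (‖Vhat - ghD‖² + ‖V‖²) / 2`. -/
lemma faceIntegrand_energy_ge (hτ : 0 < τ) (hΓD : ∀ e ∈ ΓD, e.IsBoundary) (s : Triple T Ω k)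
    (K : Cells T Ω) (i : Fin (d + 1)) {x : E d} (hx : x ∈ faceSet T Ω K i) :
    τ / 2 * ‖evVec (s.2.1 K) x - evM s.2.2 (faceOf T Ω K i) x‖ ^ 2 -
        (if faceOf T Ω K i ∈ ΓD then τ / 2 * ‖ghD φ s.1 K x‖ ^ 2 -
          inner ℝ (evMatVec (s.1 K) x (normal T Ω K i)) (ghD φ s.1 K x) else 0) ≤
      faceIntegrand φ ΓD τ s (s.1, s.2.1, energyTest ΓD τ s) K i x -
        inner ℝ (evVec (s.2.1 K) x) (evMatVec (s.1 K) x (normal T Ω K i)) := by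
  simp only [faceIntegrand, faceResidual]
  by_cases he : faceOf T Ω K i ∈ ΓD
  · rw [evM_energyTest_of_mem hΓD s he hx]
    simp only [he, if_true, flux]
    generalize evVec (s.2.1 K) x = v
    generalize evM s.2.2 (faceOf T Ω K i) x = u
    generalize evMatVec (s.1 K) x (normal T Ω K i) = w
    generalize ghD φ s.1 K x = g
    have h1 : 0 ≤ ‖v‖ ^ 2 := sq_nonneg _
    have h2 := norm_sub_sq_real u g
    have h3 : 0 ≤ ‖u - g‖ ^ 2 := sq_nonneg _
    have h4 := norm_sub_sq_real v u
    simp only [inner_add_left, inner_sub_left, inner_sub_right, real_inner_smul_left,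
      real_inner_smul_right, real_inner_self_eq_norm_sq, real_inner_comm w, real_inner_comm u v,
      real_inner_comm g u] at *
    rw [h4]
    nlinarith [mul_nonneg hτ.le h3, mul_nonneg hτ.le h1]
  · rw [evM_energyTest_of_notMem s he]
    simp only [he, if_false, flux]
    generalize evVec (s.2.1 K) x = v
    generalize evM s.2.2 (faceOf T Ω K i) x = u
    generalize evMatVec (s.1 K) x (normal T Ω K i) = w
    have h3 : 0 ≤ ‖v - u‖ ^ 2 := sq_nonneg _
    have h4 := norm_sub_sq_real v u
    simp only [inner_add_left, inner_sub_left, inner_neg_right, real_inner_smul_left,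
      real_inner_self_eq_norm_sq, real_inner_comm w, real_inner_comm u v] at *
    rw [h4] at h3 ⊢
    nlinarith [mul_nonneg hτ.le h3]

end Energy

/-! ### Uniqueness -/

section Uniqueness

lemma ae_zero_of_integral_norm_sq {d : ℕ} {α : Type*} [MeasurableSpace α] {μ : Measure α}
    {f : α → E d} (hf : Integrable (fun x => ‖f x‖ ^ 2) μ) (h : ∫ x, ‖f x‖ ^ 2 ∂μ = 0) : ∀ᵐ x ∂μ, f x = 0 := by
  have h1 := (integral_eq_zero_iff_of_nonneg (fun x => sq_nonneg ‖f x‖) hf).1 h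
  filter_upwards [h1] with x hx
  simpa using hx

variable {d k : ℕ} [NeZero d] {ι : Type} {T : ι → Affine.Simplex ℝ (E d) d} {Ω : Set (E d)}
  {φ : E d → E d} {ΓD : Set (Face T Ω)} {τ : ℝ}

/-- The terms with the transferred datum in the energy identity are bounded by the flux. The
constant `1 / 7` is less than `1 / 4`, as a cell has up to four faces. -/
def DatumEstimate (φ : E d → E d) (ΓD : Set (Face T Ω)) (k : ℕ) (τ : ℝ) : Prop :=
  ∀ (σ : ZZSpace T Ω k) (K : Cells T Ω) (i : Fin (d + 1)), faceOf T Ω K i ∈ ΓD →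
    ∫ x in faceSet T Ω K i, (τ / 2 * ‖ghD φ σ K x‖ ^ 2 -
        inner ℝ (evMatVec (σ K) x (normal T Ω K i)) (ghD φ σ K x)) ∂(surf d) ≤
      1 / 7 * ∫ x in cell T Ω K, ‖evMatVec (σ K) x (normal T Ω K i)‖ ^ 2

lemma integrable_norm_sub_sq (s : Triple T Ω k) (K : Cells T Ω) (i : Fin (d + 1)) :
    IntegrableOn (fun x => ‖evVec (s.2.1 K) x - evM s.2.2 (faceOf T Ω K i) x‖ ^ 2)
      (faceSet T Ω K i) (surf d) := by
  refine integrableOn_face_of_continuousOn ?_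
  have h := continuousOn_evM s.2.2 (faceOf T Ω K i)
  exact (((continuous_evVec _).continuousOn.sub h).norm).pow 2

/-- The boundary term of the integration by parts cancels against the face integrand of the energy
test up to the jump `V - Vhat` and the transferred datum. -/
lemma integral_face_energy_ge (hτ : 0 < τ) (hΓD : ∀ e ∈ ΓD, e.IsBoundary)
    (hg : BoundedDatum φ ΓD k) (hest : DatumEstimate φ ΓD k τ) (s : Triple T Ω k) (K : Cells T Ω)
    (i : Fin (d + 1)) :
    τ / 2 * ∫ x in faceSet T Ω K i,
        ‖evVec (s.2.1 K) x - evM s.2.2 (faceOf T Ω K i) x‖ ^ 2 ∂(surf d) -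
        1 / 7 * ∫ x in cell T Ω K, frobSq (s.1 K) x ≤
      ∫ x in faceSet T Ω K i,
        faceIntegrand φ ΓD τ s (s.1, s.2.1, energyTest ΓD τ s) K i x ∂(surf d) -
      ∫ x in faceSet T Ω K i,
        inner ℝ (evVec (s.2.1 K) x) (evMatVec (s.1 K) x (normal T Ω K i)) ∂(surf d) := by
  classical
  have hVσ : IntegrableOn (fun x => inner ℝ (evVec (s.2.1 K) x)
      (evMatVec (s.1 K) x (normal T Ω K i))) (faceSet T Ω K i) (surf d) :=
    integrableOn_face_of_continuousOn (Continuous.continuousOn (by fun_prop))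
  have hF := integrableOn_faceIntegrand (τ := τ) hg s (s.1, s.2.1, energyTest ΓD τ s) K i
  have hm := ((T K.1).faceOpposite i).isClosed_closedInterior.measurableSet
  have hfrob : 0 ≤ ∫ x in cell T Ω K, frobSq (s.1 K) x := integral_nonneg (frobSq_nonneg _)
  rw [← integral_sub hF hVσ]
  have hle := fun x hx => faceIntegrand_energy_ge (φ := φ) hτ hΓD s K i (x := x) hx
  by_cases he : faceOf T Ω K i ∈ ΓD
  · simp only [he, if_true] at hle
    have hgm := hg s.1 K i he
    have hσg : IntegrableOn (fun x => inner ℝ (evMatVec (s.1 K) x (normal T Ω K i))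
        (ghD φ s.1 K x)) (faceSet T Ω K i) (surf d) := by
      simp only [fun x => real_inner_comm (ghD φ s.1 K x) (evMatVec (s.1 K) x (normal T Ω K i))]
      exact integrable_inner_face hgm (Continuous.continuousOn (by fun_prop))
    have hgg : IntegrableOn (fun x => τ / 2 * ‖ghD φ s.1 K x‖ ^ 2) (faceSet T Ω K i) (surf d) := by
      have : IsFiniteMeasure ((surf d).restrict (faceSet T Ω K i)) := isFiniteMeasure_face (T K.1) i
      simp only [← real_inner_self_eq_norm_sq]
      exact (integrable_inner_of_memLp_top (hgm.integrable le_top) hgm).const_mul _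
    have hgσ : IntegrableOn (fun x => τ / 2 * ‖ghD φ s.1 K x‖ ^ 2 -
        inner ℝ (evMatVec (s.1 K) x (normal T Ω K i)) (ghD φ s.1 K x)) (faceSet T Ω K i)
        (surf d) := hgg.sub hσg
    have h1 := setIntegral_mono_on (((integrable_norm_sub_sq s K i).const_mul (τ / 2)).sub hgσ)
      (hF.sub hVσ) hm hle
    simp only [Pi.sub_apply] at h1
    rw [integral_sub ((integrable_norm_sub_sq s K i).const_mul (τ / 2)) hgσ,
      integral_const_mul] at h1
    refine le_trans ?_ h1
    have h2 := hest s.1 K i he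
    have h3 : ∫ x in cell T Ω K, ‖evMatVec (s.1 K) x (normal T Ω K i)‖ ^ 2 ≤
        ∫ x in cell T Ω K, frobSq (s.1 K) x :=
      integral_mono (integrableOn_cell_of_continuous (by fun_prop))
        (integrableOn_cell_of_continuous (continuous_frobSq _))
        fun x => norm_evMatVec_sq_le _ _ (norm_outNormal (T K.1) i)
    linarith
  · simp only [he, if_false, sub_zero] at hle
    have h1 := setIntegral_mono_on ((integrable_norm_sub_sq s K i).const_mul (τ / 2))
      (hF.sub hVσ) hm hle
    rw [integral_const_mul] at h1
    refine le_trans ?_ h1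
    linarith

lemma eq_zero_on_faceSet {K : Cells T Ω} {i : Fin (d + 1)} {f : E d → E d}
    (hf : ContinuousOn f (faceSet T Ω K i))
    (h : ∀ᵐ x ∂((surf d).restrict (faceSet T Ω K i)), f x = 0) :
    ∀ x ∈ faceSet T Ω K i, f x = 0 := by
  intro x hx
  have h1 := eq_zero_on_face (T K.1) (i := i) (f := fun x => ‖f x‖) hf.norm
    (by filter_upwards [h] with y hy; simp [hy]) x hx
  exact norm_eq_zero.1 h1

lemma faceSet_nonempty (K : Cells T Ω) (i : Fin (d + 1)) : (faceSet T Ω K i).Nonempty :=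
  ((T K.1).faceOpposite i).nonempty_closedInterior

variable [Finite ι]

/-- The energy argument: a solution of the homogeneous system has no flux, and its traces agree
with the traces of its values on the cells. -/
lemma energy_eq_zero (hd : d ≤ 3) (hτ : 0 < τ) (hΓD : ∀ e ∈ ΓD, e.IsBoundary)
    (hg : BoundedDatum φ ΓD k) (hest : DatumEstimate φ ΓD k τ) {s : Triple T Ω k}
    (hs : ∀ t, schemeForm φ ΓD τ s t = 0) (K : Cells T Ω) :
    ∫ x in cell T Ω K, frobSq (s.1 K) x = 0 ∧ ∀ i, ∫ x in faceSet T Ω K i,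
      ‖evVec (s.2.1 K) x - evM s.2.2 (faceOf T Ω K i) x‖ ^ 2 ∂(surf d) = 0 := by
  set A : Cells T Ω → ℝ := fun K => ∫ x in cell T Ω K, frobSq (s.1 K) x with hA
  set B : Cells T Ω → Fin (d + 1) → ℝ := fun K i => ∫ x in faceSet T Ω K i,
      ‖evVec (s.2.1 K) x - evM s.2.2 (faceOf T Ω K i) x‖ ^ 2 ∂(surf d) with hB
  have hA0 : ∀ K, 0 ≤ A K := fun K => integral_nonneg (frobSq_nonneg _)
  have hB0 : ∀ K i, 0 ≤ B K i := fun K i => integral_nonneg fun x => sq_nonneg _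
  have hBs : ∀ K, 0 ≤ ∑ i, B K i := fun K => Finset.sum_nonneg fun i _ => hB0 K i
  have hcell : ∀ K, ∫ x in cell T Ω K, cellIntegrand s (s.1, s.2.1, energyTest ΓD τ s) K x =
      A K - ∑ i, ∫ x in faceSet T Ω K i,
        inner ℝ (evVec (s.2.1 K) x) (evMatVec (s.1 K) x (normal T Ω K i)) ∂(surf d) := by
    intro K
    rw [← integral_cell_by_parts, ← integral_sub
      (integrableOn_cell_of_continuous (continuous_frobSq _))
      (integrableOn_cell_of_continuous (by fun_prop))]
    simp only [cellIntegrand, frobSq, sub_add_eq_sub_sub]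
  -- a cell has at most four faces
  have hKge : ∀ K, 3 / 7 * A K + τ / 2 * ∑ i, B K i ≤
      (∫ x in cell T Ω K, cellIntegrand s (s.1, s.2.1, energyTest ΓD τ s) K x) +
      ∑ i, ∫ x in faceSet T Ω K i,
        faceIntegrand φ ΓD τ s (s.1, s.2.1, energyTest ΓD τ s) K i x ∂(surf d) := by
    intro K
    have h1 := Finset.sum_le_sum fun i (_ : i ∈ Finset.univ) =>
      integral_face_energy_ge hτ hΓD hg hest s K i
    rw [Finset.sum_sub_distrib, Finset.sum_sub_distrib, ← Finset.mul_sum, Finset.sum_const,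
      Finset.card_univ, Fintype.card_fin, nsmul_eq_mul] at h1
    have hd' : ((d + 1 : ℕ) : ℝ) ≤ 4 := by exact_mod_cast Nat.succ_le_succ hd
    have h2 := mul_le_mul_of_nonneg_right hd' (hA0 K)
    rw [hcell K]
    simp only [hA, hB] at h1 h2 ⊢
    linarith
  have h0 := hs (s.1, s.2.1, energyTest ΓD τ s)
  rw [schemeForm, ← Finset.sum_add_distrib] at h0
  have hsum := Finset.sum_le_sum fun K (_ : K ∈ Finset.univ) => hKge K
  rw [h0] at hsum
  have hnn : ∀ K ∈ Finset.univ, 0 ≤ 3 / 7 * A K + τ / 2 * ∑ i, B K i := fun K _ =>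
    add_nonneg (mul_nonneg (by norm_num) (hA0 K)) (mul_nonneg (by positivity) (hBs K))
  have hz := (Finset.sum_eq_zero_iff_of_nonneg hnn).1
    (le_antisymm hsum (Finset.sum_nonneg hnn)) K (Finset.mem_univ K)
  have hAz : A K = 0 := by
    have := mul_nonneg (by positivity : 0 ≤ τ / 2) (hBs K)
    linarith [hA0 K]
  refine ⟨hAz, fun i => ?_⟩
  rw [hAz, mul_zero, zero_add, mul_eq_zero, or_iff_right (by positivity),
    Finset.sum_eq_zero_iff_of_nonneg fun i _ => hB0 K i] at hz
  exact hz i (Finset.mem_univ i)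

/-- The homogeneous system has only the trivial solution. -/
lemma eq_zero_of_schemeForm_eq_zero (hd2 : 2 ≤ d) (hd : d ≤ 3) (hT : IsTriangulation T)
    (hconn : IsConnected (compDomain T Ω)) (hτ : 0 < τ) (hΓD : ∀ e ∈ ΓD, e.IsBoundary)
    (hne : ΓD.Nonempty) (hg : BoundedDatum φ ΓD k) (hest : DatumEstimate φ ΓD k τ)
    {s : Triple T Ω k} (hs : ∀ t, schemeForm φ ΓD τ s t = 0) : s = 0 := by
  obtain ⟨σ, V, U⟩ := s
  have hen := energy_eq_zero hd hτ hΓD hg hest hs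
  have hσ : σ = 0 := by
    ext K i j : 4
    exact eq_zero_of_integral_frobSq (hen K).1 i j
  subst hσ
  have hVU : ∀ K i, ∀ x ∈ faceSet T Ω K i, evVec (V K) x - evM U (faceOf T Ω K i) x = 0 :=
    fun K i => eq_zero_on_faceSet ((continuous_evVec _).continuousOn.sub (continuousOn_evM U _))
      (ae_zero_of_integral_norm_sq (integrable_norm_sub_sq (0, V, U) K i) ((hen K).2 i))
  -- testing with the gradient of `V` shows that `V` is constant on every cell
  have hconst : ∀ K x y, evVec (V K) x = evVec (V K) y := by
    set ψ : ZZSpace T Ω k := fun K i j => ⟨MvPolynomial.pderiv j (V K i).1, by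
      have := (V K i).2
      rw [MvPolynomial.mem_restrictTotalDegree] at this ⊢
      exact (totalDegree_pderiv_le _ j).trans this⟩ with hψ
    have h1 := hs (ψ, 0, 0)
    rw [schemeForm_test_a] at h1
    simp only [Pi.zero_apply, Submodule.coe_zero, ev_zero, zero_mul, Finset.sum_const_zero,
      integral_zero, zero_sub, faceSum, if_true] at h1
    have h2 : ∀ K : Cells T Ω, ∑ i, ∫ x in faceSet T Ω K i,
        inner ℝ (evM U (faceOf T Ω K i) x) (evMatVec (ψ K) x (normal T Ω K i)) ∂(surf d) =
        (∫ x in cell T Ω K, inner ℝ (evVec (V K) x) (evDiv (ψ K) x)) +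
          ∫ x in cell T Ω K, frobSq (ψ K) x := by
      intro K
      rw [← integral_add (integrableOn_cell_of_continuous (by fun_prop))
        (integrableOn_cell_of_continuous (continuous_frobSq _))]
      refine Eq.trans ?_ (integral_cell_by_parts K (V K) (ψ K)).symm
      refine Finset.sum_congr rfl fun i _ => setIntegral_congr_fun
        ((T K.1).faceOpposite i).isClosed_closedInterior.measurableSet fun x hx => ?_
      rw [sub_eq_zero.1 (hVU K i x hx)]
    simp only [h2, Finset.sum_add_distrib, neg_add_cancel_left] at h1
    intro K x y
    have h3 := (Finset.sum_eq_zero_iff_of_nonneg fun K _ =>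
      integral_nonneg (frobSq_nonneg (ψ K))).1 h1 K (Finset.mem_univ K)
    exact evVec_const (fun i j => eq_zero_of_integral_frobSq h3 i j) x y
  -- on the Dirichlet faces the values vanish, since the datum does
  have hDir : ∀ K i, faceOf T Ω K i ∈ ΓD → ∀ x ∈ faceSet T Ω K i,
      evM U (faceOf T Ω K i) x = 0 := by
    have h1 := hs (0, 0, maskM (fun e => e ∈ ΓD) U)
    rw [schemeForm_test_c hg hΓD] at h1
    simp only [faceSum_maskM] at h1
    rw [faceSum_eq_zero (P := fun e => ¬ e.IsBoundary ∧ e ∈ ΓD) (fun e h => h.1 (hΓD e h.2)),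
      faceSum_eq_zero (P := fun e => (e.IsBoundary ∧ e ∉ ΓD) ∧ e ∈ ΓD) (fun e h => h.1.2 h.2)] at h1
    simp only [ghD_zero, inner_zero_left, and_self, real_inner_self_eq_norm_sq, faceSum,
      integral_zero, ite_self, Finset.sum_const_zero, sub_zero, add_zero, zero_add] at h1
    have hnn : ∀ (K : Cells T Ω) (i : Fin (d + 1)), 0 ≤ ∫ x in faceSet T Ω K i,
        ‖evM U (faceOf T Ω K i) x‖ ^ 2 ∂(surf d) := fun K i => integral_nonneg fun x => sq_nonneg _
    intro K i hKi
    rw [Finset.sum_eq_zero_iff_of_nonneg fun K _ => Finset.sum_nonneg fun i _ => by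
      split_ifs; exacts [hnn K i, le_rfl]] at h1
    have h2 := h1 K (Finset.mem_univ K)
    rw [Finset.sum_eq_zero_iff_of_nonneg fun i _ => by split_ifs; exacts [hnn K i, le_rfl]] at h2
    have h3 := h2 i (Finset.mem_univ i)
    rw [if_pos ⟨hKi, hKi⟩] at h3
    exact eq_zero_on_faceSet (continuousOn_evM U _) (ae_zero_of_integral_norm_sq
      (integrableOn_face_of_continuousOn ((continuousOn_evM U (faceOf T Ω K i)).norm.pow 2)) h3)
  -- the constants agree across shared faces, and the mesh is connected
  have hV : ∀ K x, evVec (V K) x = 0 := by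
    by_contra! hcon
    obtain ⟨K₁, x₁, hx₁⟩ := hcon
    obtain ⟨e, he⟩ := hne
    obtain ⟨K₀, i₀, he₀⟩ := e.2
    have hKi : faceOf T Ω K₀ i₀ ∈ ΓD := by
      rwa [show faceOf T Ω K₀ i₀ = e from Subtype.ext he₀.symm]
    have hA : (K₀ : Cells T Ω) ∈ {K : Cells T Ω | ∀ x, evVec (V K) x = 0} := by
      intro x
      obtain ⟨y, hy⟩ := faceSet_nonempty K₀ i₀
      rw [hconst K₀ x y, sub_eq_zero.1 (hVU K₀ i₀ y hy), hDir K₀ i₀ hKi y hy]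
    obtain ⟨K, hK, K', hK', i, i', hii⟩ := exists_shared_face hd2 hT hconn.isPreconnected
      ⟨K₀, hA⟩ ⟨K₁, fun h => hx₁ (h x₁)⟩
    refine hK' fun x => ?_
    obtain ⟨y, hy⟩ := faceSet_nonempty K i
    have hf : faceOf T Ω K i = faceOf T Ω K' i' := Subtype.ext hii
    rw [hconst K' x y, sub_eq_zero.1 (hVU K' i' y (hii ▸ hy)), ← hf,
      ← sub_eq_zero.1 (hVU K i y hy)]
    exact hK y
  have hV0 : V = 0 := by
    ext K i : 3
    obtain ⟨hint, -⟩ := closure_interior_simplex (T K.1) (by simp)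
    refine eq_zero_of_ev_eq_zero hint fun x _ => ?_
    have := congrArg (fun y : E d => y i) (hV K x)
    simpa [evVec_apply] using this
  have hU0 : U = 0 := by
    ext e i x
    obtain ⟨K, j, he⟩ := e.2
    have hf : e = faceOf T Ω K j := Subtype.ext he
    subst hf
    change (U _ i).1 x = 0
    by_cases hx : x ∈ (faceOf T Ω K j).1
    · have h1 := hVU K j x hx
      rw [hV, zero_sub, neg_eq_zero] at h1
      exact congrArg (fun y : E d => y i) h1
    · obtain ⟨p, -, hp⟩ := (U (faceOf T Ω K j) i).2
      rw [← hp]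
      exact indicator_of_notMem hx _
  rw [hV0, hU0]
  rfl

end Uniqueness

/-! ### Existence -/

section Existence

variable {d k : ℕ} [NeZero d] {ι : Type} [Finite ι] {T : ι → Affine.Simplex ℝ (E d) d}
  {Ω : Set (E d)}

instance finite_face : Finite (Face T Ω) :=
  Finite.of_surjective (fun q : Cells T Ω × Fin (d + 1) => faceOf T Ω q.1 q.2)
    fun e => by
      obtain ⟨K, i, he⟩ := e.2
      exact ⟨(K, i), Subtype.ext he.symm⟩

instance finiteDimensional_polyOn (s : Set (E d)) : Module.Finite ℝ (polyOn k s) := by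
  unfold polyOn
  infer_instance

/-- The functional of the Neumann data. -/
noncomputable def neumannFunctional (ΓD : Set (Face T Ω)) (k : ℕ)
    {f : Cells T Ω → E d → E d}
    (hf : ∀ (K : Cells T Ω) (i : Fin (d + 1)), (faceOf T Ω K i).IsBoundary →
      faceOf T Ω K i ∉ ΓD → IntegrableOn (f K) (faceSet T Ω K i) (surf d)) :
    Triple T Ω k →ₗ[ℝ] ℝ :=
  (isLinearMap_of_comb (f := fun t : Triple T Ω k =>
    faceSum T Ω (fun e => e.IsBoundary ∧ e ∉ ΓD) (fun K i x =>
      inner ℝ (f K x) (evM t.2.2 (faceOf T Ω K i) x))) (by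
    classical
    intro c t t'
    simp only [faceSum, Finset.mul_sum, ← Finset.sum_add_distrib]
    refine Finset.sum_congr rfl fun K _ => Finset.sum_congr rfl fun i _ => ?_
    split_ifs with h
    · have hi : ∀ μ : MSpace T Ω k, IntegrableOn
          (fun x => inner ℝ (f K x) (evM μ (faceOf T Ω K i) x)) (faceSet T Ω K i) (surf d) :=
        fun μ => integrable_inner_of_memLp_top (hf K i h.1 h.2)
          (memLp_top_face (T K.1) i (continuousOn_evM μ (faceOf T Ω K i)))
      refine integral_comb (hi t.2.2) (hi t'.2.2) fun x => ?_
      simp only [Prod.snd_add, Prod.smul_snd, evM_comb, inner_add_right, real_inner_smul_right]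
    · simp)).mk' _

end Existence

end HDG

theorem mainTheorem1 {d : ℕ} [NeZero d] (hd : d = 2 ∨ d = 3) {ι : Type} [Finite ι]
    -- the domain, the background mesh, the transfer map
    (Ω : Set (E d)) (hΩ : IsLipschitzDomain Ω)
    (T : ι → Affine.Simplex ℝ (E d) d) (φ : E d → E d)
    (r ρ C : ℝ) (n : ℕ) (δ c : ℝ) (hr : 0 < r) (hρ : 0 < ρ) (hC : 0 < C) (hδ : 0 < δ) (hδ1 : δ < 1)
    (hc : 0 < c) (hadm : IsAdmissible T Ω φ r ρ C n δ c)
    (hconn : IsConnected (compDomain T Ω))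
    -- the Dirichlet faces
    (ΓD : Set (Face T Ω)) (hΓD : ∀ e ∈ ΓD, e.IsBoundary) (hΓDne : ΓD.Nonempty)
    -- polynomial degree, stabilization parameter, diffusivity, extension patches
    (k : ℕ) (τ : ℝ) (hτ : 0 < τ)
    (a : E d → ℝ) (ha : ∃ alo ahi : ℝ, 0 < alo ∧ ∀ᵐ x ∂(volume.restrict Ω), alo ≤ a x ∧ a x ≤ ahi)
    (Kext : Face T Ω → Set (E d)) (hKext : IsExtensionPatch T Ω Kext)
    (hnormal : NormalPaths T Ω Kext φ ΓD)
    (hH : HBound T Ω Kext τ a) (hR : RBound T Ω Kext k)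
    -- the data of the discrete Neumann condition
    (g yt gΓ ytΓ : E d → ℝ) (DgΓ : E d → E d)
    (hg : HasH2Trace Ω g gΓ DgΓ) (hyt : HasH1Trace Ω yt ytΓ)
    (ν : E d → E d) (hν : ∀ᵐ y ∂((surf d).restrict (frontier Ω)), IsOuterNormal Ω y (ν y))
    (ph rh : ZSpace T Ω k)
    (hint : ∀ (K : Cells T Ω) (i : Fin (d + 1)),
      (faceOf T Ω K i).IsBoundary → faceOf T Ω K i ∉ ΓD →
      IntegrableOn (fun x => Gh a gΓ ytΓ DgΓ ν ph rh K (φ x) • ν (φ x)) (faceSet T Ω K i)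
        (surf d)) :
    ∃! s : ZZSpace T Ω k × WSpace T Ω k × MSpace T Ω k,
      IsSolution T Ω k φ ΓD τ a gΓ ytΓ DgΓ ν ph rh s.1 s.2.1 s.2.2 := by
  have hd2 : 2 ≤ d := by omega
  have hd3 : d ≤ 3 := by omega
  have hbd : BoundedDatum φ ΓD k := fun σ K i he =>
    memLp_top_ghD hd2 hadm.conforming hadm.bijOn hadm.measurable hΓD hnormal hτ hH σ he
  have hest : DatumEstimate φ ΓD k τ := fun σ K i he =>
    dirichlet_face_estimate hd2 hadm.conforming hadm.bijOn hΓD hnormal hτ hH hR hKext σ he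
  have hinj : Function.Injective (schemeMap (T := T) (Ω := Ω) hbd τ) := by
    rw [← LinearMap.ker_eq_bot, LinearMap.ker_eq_bot']
    intro s hs
    exact eq_zero_of_schemeForm_eq_zero hd2 hd3 hadm.conforming hconn hτ hΓD hΓDne hbd hest
      fun t => LinearMap.congr_fun hs t
  -- the space and its dual have the same dimension
  have hsurj : Function.Surjective (schemeMap (T := T) (Ω := Ω) hbd τ) :=
    (LinearMap.injective_iff_surjective_of_finrank_eq_finrank
      (Subspace.dual_finrank_eq (K := ℝ) (V := Triple T Ω k)).symm).1 hinj
  obtain ⟨s, hs⟩ := hsurj (neumannFunctional ΓD k hint)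
  have key : ∀ s' : Triple T Ω k, IsSolution T Ω k φ ΓD τ a gΓ ytΓ DgΓ ν ph rh s'.1 s'.2.1 s'.2.2 ↔
      schemeMap hbd τ s' = neumannFunctional ΓD k hint := fun s' =>
    (isSolution_iff hbd hΓD s').trans
      ⟨fun h => LinearMap.ext h, fun h t => LinearMap.congr_fun h t⟩
  exact ⟨s, (key s).2 hs, fun s' hs' => hinj (((key s').1 hs').trans hs.symm)⟩
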